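/- All graphs are finite, simple and undirected, except that contractions may have parallel edges. A graph is called $2$-connected if it has at least two vertices, is connected, and has no cut vertex (so a single edge is $2$-connected and a single vertex is not). For $S\subseteq V(G)$ let $E(S)$ be the set of edges of $G$ with both ends in $S$; $S$ is a good flat of $G$ if both the induced subgraph $G|_S$ and the contraction $G/E(S)$ are $2$-connected. Let $\delta>2$ be an integer. A weight function of a graph $G=(V,E)$ is a function $w:E\to\{1,\delta-1\}$ such that, for every edge $e$, $w(e)=1$ if $G\setminus e$ is $2$-connected and $w(e)=\delta-1$ if $G/e$ is $2$-connected. We say that $G$ satisfies $(\spadesuit)_\delta$ if $G$ possesses a weight function $w$ (in particular, no edge has both $G\setminus e$ and $G/e$ $2$-connected) for which 1. $\sum_{e\in E}w(e)=\delta(|V|-1)$, and 2. $\sum_{e\in E(S)}w(e)+1=\delta(|S|-1)$ for every good flat $S\subseteq V$. **Theorem.** Let $G$ be a $2$-connected graph and let $\delta>2$. The following conditions are equivalent: 1. $G$ satisfies $(\spadesuit)_\delta$; 2. $G$ belongs to the smallest isomorphism-closed class of graphs that contains the $\delta$-cycle and is closed under the following two constructions: * (glueing) given graphs $G_1,\dots,G_{\delta-1}$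 in the class, which possess weight functions, and edges $e_i$ of $G_i$ of weight $\delta-1$ in $G_i$, form the disjoint union of $G_1,\dots,G_{\delta-1}$ with the edges $e_1,\dots,e_{\delta-1}$ (with their ends, in either orientation) identified to a single edge $e$, which is kept; * (subdivision) given a graph $G'$ in the class, which possesses a weight function, and an edge $e$ of $G'$ of weight $1$, replace $e$ by a path with $\delta-1$ edges whose inner vertices are new. -/

import Mathlib

universe u

namespace GraphicGorenstein

/-- `2`-connected: at least two vertices, connected, and without a cut vertex. In particular the
single edge `K₂` is `2`-connected and a one-vertex graph is not. -/
def TwoConnected {V : Type u} (G : SimpleGraph V) : Prop :=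
  Nontrivial V ∧ G.Connected ∧ ∀ v : V, (G.induce {x | x ≠ v}).Preconnected

/-- Contraction of `E(S)` in `G`, for `S` inducing a connected subgraph: the set `S` becomes the
single vertex `none`. Parallel edges are merged; this has no influence on `2`-connectedness. (No
loops arise, since all edges inside `S` are contracted.) -/
def contract {V : Type u} (G : SimpleGraph V) (S : Set V) : SimpleGraph (Option {x : V // x ∉ S}) :=
  SimpleGraph.fromRel fun a b =>
    match a, b with
    | some x, some y => G.Adj x.1 y.1
    | none, some y => ∃ s ∈ S, G.Adj s y.1
    | _, _ => False

/-- `w` (its values on the edges of `G`) is the weight function `E → {1, δ - 1}` of `G`: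
`w e = 1` if `G \ e` is `2`-connected and `w e = δ - 1` if `G / e` is `2`-connected. -/
structure IsWeight {V : Type u} (δ : ℕ) (G : SimpleGraph V) (w : Sym2 V → ℕ) : Prop where
  range : ∀ e ∈ G.edgeSet, w e = 1 ∨ w e = δ - 1
  deletion : ∀ e ∈ G.edgeSet, TwoConnected (G.deleteEdges {e}) → w e = 1
  contraction : ∀ e ∈ G.edgeSet, TwoConnected (contract G {x | x ∈ e}) → w e = δ - 1

/-- `E(S)`: the edges of `G` with both ends in `S`. -/
def edgesIn {V : Type u} (G : SimpleGraph V) (S : Set V) : Set (Sym2 V) :=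
  {e | e ∈ G.edgeSet ∧ ∀ x ∈ e, x ∈ S}

/-- A good flat: both the restriction of `G` to `S` and the contraction of `E(S)` in `G` are
`2`-connected. -/
def IsGoodFlat {V : Type u} (G : SimpleGraph V) (S : Set V) : Prop :=
  TwoConnected (G.induce S) ∧ TwoConnected (contract G S)

/-- The equalities `(♠)_δ`, including the existence of the weight function. -/
def Spade {V : Type u} (δ : ℕ) (G : SimpleGraph V) : Prop :=
  ∃ w : Sym2 V → ℕ, IsWeight δ G w ∧
    (∑ᶠ e ∈ G.edgeSet, w e) = δ * (Nat.card V - 1) ∧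
    ∀ S : Set V, IsGoodFlat G S → (∑ᶠ e ∈ edgesIn G S, w e) + 1 = δ * (S.ncard - 1)

/-- `G` is (isomorphic to) the graph glued from the graphs `H i` along the edges `a i b i`: the
disjoint union of the `H i` with all `a i` identified to a vertex `p`, all `b i` identified to a
vertex `q`, and the edges `a i b i` unified to the edge `pq`. -/
def IsGlueing {ι : Type} {V : Type u} {W : ι → Type u} (H : ∀ i, SimpleGraph (W i))
    (a b : ∀ i, W i) (G : SimpleGraph V) : Prop :=
  ∃ (p q : V) (f : ∀ i, W i → V),
    (∀ i, Function.Injective (f i)) ∧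
    (∀ i, f i (a i) = p) ∧ (∀ i, f i (b i) = q) ∧
    (∀ i j x y, i ≠ j → f i x = f j y → f i x = p ∨ f i x = q) ∧
    (∀ z, ∃ i x, f i x = z) ∧
    ∀ x y, G.Adj x y ↔ ∃ i x' y', (H i).Adj x' y' ∧ f i x' = x ∧ f i y' = y

/-- `G` is (isomorphic to) the graph obtained from `H` by replacing the edge `ab` by a path
`p 0, …, p k` with `k` edges whose inner vertices are new. -/
def IsSubdivision {V W : Type u} (k : ℕ) (H : SimpleGraph W) (a b : W) (G : SimpleGraph V) : Prop :=
  ∃ (f : W → V) (p : Fin (k + 1) → V),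
    Function.Injective f ∧ Function.Injective p ∧
    p 0 = f a ∧ p (Fin.last k) = f b ∧
    (∀ x i, f x = p i → i = 0 ∨ i = Fin.last k) ∧
    (∀ z, (∃ x, f x = z) ∨ ∃ i, p i = z) ∧
    ∀ x y, G.Adj x y ↔
      (∃ x' y', H.Adj x' y' ∧ s(x', y') ≠ s(a, b) ∧ f x' = x ∧ f y' = y) ∨
      ∃ i : Fin k, s(x, y) = s(p i.castSucc, p i.succ)

/-- The graphs obtained from a `δ`-cycle by the two constructions: glueing `δ - 1` graphs (already
obtained) along edges of weight `δ - 1`, and `(δ - 1)`-subdivision of an edge of weight `1`. -/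
inductive Obtainable (δ : ℕ) : ∀ {V : Type u}, SimpleGraph V → Prop
  | cycle {V : Type u} (G : SimpleGraph V) (h : Nonempty (SimpleGraph.cycleGraph δ ≃g G)) :
      Obtainable δ G
  | glue {V : Type u} (G : SimpleGraph V) (W : Fin (δ - 1) → Type u)
      (H : ∀ i, SimpleGraph (W i)) (w : ∀ i, Sym2 (W i) → ℕ) (a b : ∀ i, W i)
      (hH : ∀ i, Obtainable δ (H i)) (hw : ∀ i, IsWeight δ (H i) (w i))
      (hab : ∀ i, (H i).Adj (a i) (b i)) (hwab : ∀ i, w i s(a i, b i) = δ - 1)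
      (hG : IsGlueing H a b G) : Obtainable δ G
  | subdivide {V W : Type u} (G : SimpleGraph V) (H : SimpleGraph W) (w : Sym2 W → ℕ) (a b : W)
      (hH : Obtainable δ H) (hw : IsWeight δ H w)
      (hab : H.Adj a b) (hwab : w s(a, b) = 1)
      (hG : IsSubdivision (δ - 1) H a b G) : Obtainable δ G

end GraphicGorenstein

namespace GraphicGorenstein

/-! ### Connectedness of vertex sets inside a fixed graph -/

/-! For a vertex set T put d(T) = δ(|T| − 1) − w(E(T)) (`defect`). The equalities say that d(V) = 0
and that d(T) = 1 for every good flat T. In a 2-connected graph, contracting E(T) leaves a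
2-connected graph exactly when V∖T is nonempty and connected (`twoConnected_contract`), so good
flats can be treated entirely inside G. On at least three vertices, every edge has a 2-connected
deletion or a 2-connected contraction, so a weight function is unique on edges if it exists
(`canonicalWeight`). A good flat with two vertices is a contractible edge, and its equality only
says that its weight is δ − 1.

The main tool is a separation of G at two vertices u, v into sides S₁ and S₂. The defect is modular
across it, and S₁ with the edge uv added is again 2-connected. A good flat of this smaller graph
that contains u and v becomes a good flat of G when S₂ is added; any other is a good flat of G
already. Hence S₁ + uv inherits the equalities for all flats once the weight of uv is chosen so that
the total defect vanishes (`Relaxed.left`).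

The chosen weight must also be the one prescribed by deletion and contraction. This follows from
`Relaxed.not_conn2_del`: the equalities for flats on at least three vertices, with arbitrary weights
in {1, δ − 1}, already exclude an edge that is both deletable and contractible. A counterexample
either passes to a smaller one on one side of a separation, or stays 2-connected after removal of
any vertex. In the latter case all weighted degrees equal δ + 1, and counting edge ends gives |V|(δ
− 1) = 2δ, which is impossible for |V| ≥ 4 and δ ≥ 3.

From the equalities to the class: if the ends of an edge separate G, the resulting branches each
contribute −1 to the defect relative to that edge, so there are δ − 1 of them and G is a glueing.
Otherwise every edge is contractible, hence not deletable, and all weights are δ − 1. Then G is a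
2-connected set S plus one ear, and the defect forces the ear to have δ − 1 edges. So G is a
subdivision of a smaller graph, or a δ-cycle if S is a single edge. Conversely, for each
construction the good flats of the new graph are traced back to those of the parts
(`spadeOn_of_cycle`, `spadeOn_of_ear`, `spadeOn_of_glueing`). -/

/-- The subgraph induced on `A` is preconnected, phrased as a closure principle. -/
def Linked {V : Type u} (G : SimpleGraph V) (A : Set V) : Prop :=
  ∀ P : V → Prop, (∀ x ∈ A, ∀ y ∈ A, G.Adj x y → P x → P y) → ∀ x ∈ A, ∀ y ∈ A, P x → P y

/-- The subgraph induced on `S` is `2`-connected. -/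
def Conn2 {V : Type u} (G : SimpleGraph V) (S : Set V) : Prop :=
  S.Nontrivial ∧ Linked G S ∧ ∀ v ∈ S, Linked G (S \ {v})

/-- The graph `G` with the edge `uv` added. -/
abbrev addEdge {V : Type u} (G : SimpleGraph V) (u v : V) : SimpleGraph V :=
  G ⊔ SimpleGraph.edge u v

/-- The graph `G` with the edge `uv` deleted. -/
abbrev delEdge {V : Type u} (G : SimpleGraph V) (u v : V) : SimpleGraph V :=
  G.deleteEdges {s(u, v)}

section Basics

variable {V : Type u} {G G' : SimpleGraph V} {A B S T : Set V} {u v x y : V}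

theorem addEdge_adj : (addEdge G u v).Adj x y ↔ G.Adj x y ∨ (s(x, y) = s(u, v) ∧ x ≠ y) := by
  simp only [addEdge, SimpleGraph.sup_adj, SimpleGraph.edge_adj, Sym2.eq_iff]

theorem delEdge_adj : (delEdge G u v).Adj x y ↔ G.Adj x y ∧ s(x, y) ≠ s(u, v) := by
  simp [delEdge, SimpleGraph.deleteEdges_adj]

theorem addEdge_comm : addEdge G u v = addEdge G v u := by
  ext x y; simp only [addEdge_adj, Sym2.eq_swap (a := u)]

theorem addEdge_eq_self (h : G.Adj u v) : addEdge G u v = G := by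
  ext x y
  rw [addEdge_adj]
  refine ⟨?_, Or.inl⟩
  rintro (h' | ⟨h', -⟩)
  · exact h'
  · rw [Sym2.eq_iff] at h'
    rcases h' with ⟨rfl, rfl⟩ | ⟨rfl, rfl⟩
    exacts [h, h.symm]

theorem Linked.mono (h : Linked G A) (hG : ∀ x ∈ A, ∀ y ∈ A, G.Adj x y → G'.Adj x y) :
    Linked G' A := fun P hP => h P fun x hx y hy hxy => hP x hx y hy (hG x hx y hy hxy)

theorem Conn2.mono (h : Conn2 G A) (hG : ∀ x ∈ A, ∀ y ∈ A, G.Adj x y → G'.Adj x y) :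
    Conn2 G' A :=
  ⟨h.1, h.2.1.mono hG, fun v hv => (h.2.2 v hv).mono fun x hx y hy => hG x hx.1 y hy.1⟩

theorem Linked.of_addEdge (h : Linked (addEdge G u v) A) (huv : u ∉ A ∨ v ∉ A) : Linked G A := by
  refine h.mono fun x hx y hy hxy => ?_
  rw [addEdge_adj, Sym2.eq_iff] at hxy
  rcases hxy with h | ⟨⟨rfl, rfl⟩ | ⟨rfl, rfl⟩, -⟩ <;> tauto

theorem Conn2.of_addEdge (h : Conn2 (addEdge G u v) A) (huv : u ∉ A ∨ v ∉ A) : Conn2 G A := by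
  refine h.mono fun x hx y hy hxy => ?_
  rw [addEdge_adj, Sym2.eq_iff] at hxy
  rcases hxy with h | ⟨⟨rfl, rfl⟩ | ⟨rfl, rfl⟩, -⟩ <;> tauto

theorem Linked.add_edge (h : Linked G A) : Linked (addEdge G u v) A :=
  h.mono fun _ _ _ _ hxy => addEdge_adj.2 (Or.inl hxy)

theorem Conn2.add_edge (h : Conn2 G A) : Conn2 (addEdge G u v) A :=
  h.mono fun _ _ _ _ hxy => addEdge_adj.2 (Or.inl hxy)

theorem Linked.del_edge (h : Linked G A) (huv : u ∉ A ∨ v ∉ A) : Linked (delEdge G u v) A := by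
  refine h.mono fun x hx y hy hxy => delEdge_adj.2 ⟨hxy, fun h => ?_⟩
  rw [Sym2.eq_iff] at h
  rcases h with ⟨rfl, rfl⟩ | ⟨rfl, rfl⟩ <;> tauto

theorem Conn2.del_edge (h : Conn2 G A) (huv : u ∉ A ∨ v ∉ A) : Conn2 (delEdge G u v) A := by
  refine h.mono fun x hx y hy hxy => delEdge_adj.2 ⟨hxy, fun h => ?_⟩
  rw [Sym2.eq_iff] at h
  rcases h with ⟨rfl, rfl⟩ | ⟨rfl, rfl⟩ <;> tauto

/-- Adjacency is symmetric, so the hypothesis at the root can be applied to the predicate `P y ↔ P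
x`. This covers all pairs of vertices. -/
theorem linked_of_root (x : V) (_ : x ∈ A)
    (h : ∀ P : V → Prop, (∀ x ∈ A, ∀ y ∈ A, G.Adj x y → P x → P y) → P x → ∀ y ∈ A, P y) :
    Linked G A := by
  intro P hP y hy z hz hPy
  have key : ∀ y ∈ A, (P y ↔ P x) := by
    refine h (fun y => P y ↔ P x) (fun a ha b hb hab hax => ?_) Iff.rfl
    exact ⟨fun hb' => hax.1 (hP b hb a ha hab.symm hb'), fun h' => hP a ha b hb hab (hax.2 h')⟩
  exact (key z hz).2 ((key y hy).1 hPy)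

theorem linked_of_subsingleton (h : A.Subsingleton) : Linked G A :=
  fun _ _ _ hx _ hy hP => h hx hy ▸ hP

theorem Linked.union (hA : Linked G A) (hB : Linked G B) (h : (A ∩ B).Nonempty) :
    Linked G (A ∪ B) := by
  obtain ⟨c, hcA, hcB⟩ := h
  refine linked_of_root c (Or.inl hcA) fun P hP hc y hy => ?_
  rcases hy with hy | hy
  · exact hA P (fun x hx y hy => hP x (Or.inl hx) y (Or.inl hy)) c hcA y hy hc
  · exact hB P (fun x hx y hy => hP x (Or.inr hx) y (Or.inr hy)) c hcB y hy hc

theorem Linked.union_adj (hA : Linked G A) (hB : Linked G B) (hx : x ∈ A) (hy : y ∈ B)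
    (h : G.Adj x y) : Linked G (A ∪ B) := by
  refine linked_of_root x (Or.inl hx) fun P hP hc z hz => ?_
  rcases hz with hz | hz
  · exact hA P (fun x hx y hy => hP x (Or.inl hx) y (Or.inl hy)) x hx z hz hc
  · exact hB P (fun x hx y hy => hP x (Or.inr hx) y (Or.inr hy)) y hy z hz
      (hP x (Or.inl hx) y (Or.inr hy) h hc)

/-- If `A ∪ uv` is linked and `B` links `u` to `v`, the edge `uv` is not needed. -/
theorem Linked.union_of_addEdge (hA : Linked (addEdge G u v) A)
    (hB : Linked G B) (huv : u ∈ A → v ∈ A → u ∈ B ∧ v ∈ B) (h : (A ∩ B).Nonempty) :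
    Linked G (A ∪ B) := by
  obtain ⟨c, hcA, hcB⟩ := h
  refine linked_of_root c (Or.inl hcA) fun P hP hc y hy => ?_
  have hB' := hB P fun x hx y hy => hP x (Or.inr hx) y (Or.inr hy)
  rcases hy with hy | hy
  · refine hA P (fun x hx y hy hxy => ?_) c hcA y hy hc
    rw [addEdge_adj, Sym2.eq_iff] at hxy
    rcases hxy with h | ⟨⟨rfl, rfl⟩ | ⟨rfl, rfl⟩, -⟩
    · exact hP x (Or.inl hx) y (Or.inl hy) h
    · exact hB' x (huv hx hy).1 y (huv hx hy).2
    · exact hB' x (huv hy hx).2 y (huv hy hx).1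
  · exact hB' c hcB y hy hc

/-- The connected component of `x` in `A`. -/
theorem exists_component (hx : x ∈ A) : ∃ C ⊆ A, x ∈ C ∧ Linked G C ∧
    ∀ y ∈ C, ∀ z ∈ A, G.Adj y z → z ∈ C := by
  let C : Set V := {y | y ∈ A ∧ ∀ P : V → Prop,
    (∀ x ∈ A, ∀ y ∈ A, G.Adj x y → P x → P y) → P x → P y}
  have hcl : ∀ y ∈ C, ∀ z ∈ A, G.Adj y z → z ∈ C := fun y hy z hz hyz =>
    ⟨hz, fun P hP hPx => hP y hy.1 z hz hyz (hy.2 P hP hPx)⟩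
  refine ⟨C, fun y hy => hy.1, ⟨hx, fun P _ h => h⟩, ?_, hcl⟩
  refine linked_of_root x ⟨hx, fun P _ h => h⟩ fun P hP hPx y hy => ?_
  exact (hy.2 (fun z => z ∈ C ∧ P z)
    (fun a _ b hb hab ha' => ⟨hcl a ha'.1 b hb hab, hP a ha'.1 b (hcl a ha'.1 b hb hab) hab ha'.2⟩)
    ⟨⟨hx, fun P _ h => h⟩, hPx⟩).2

theorem Linked.subset_of_closed (hA : Linked G A) (hx : x ∈ A) (hxB : x ∈ B)
    (h : ∀ y ∈ A, ∀ z ∈ A, G.Adj y z → y ∈ B → z ∈ B) : A ⊆ B :=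
  fun y hy => hA (· ∈ B) h x hx y hy hxB

theorem Conn2.linked_diff (h : Conn2 G S) (v : V) : Linked G (S \ {v}) := by
  by_cases hv : v ∈ S
  · exact h.2.2 v hv
  · rw [Set.sdiff_singleton_eq_self hv]; exact h.2.1

theorem linked_iff_preconnected : (G.induce A).Preconnected ↔ Linked G A := by
  constructor
  · intro h P hP x hx y hy hPx
    obtain ⟨p⟩ := h ⟨x, hx⟩ ⟨y, hy⟩
    have : ∀ (a b : A), (G.induce A).Walk a b → P a → P b := by
      intro a b p
      induction p with
      | nil => exact id
      | cons hab _ ih => exact fun h => ih (hP _ (Subtype.mem _) _ (Subtype.mem _) hab h)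
    exact this _ _ p hPx
  · intro h x y
    have := h (fun z => ∃ hz : z ∈ A, (G.induce A).Reachable x ⟨z, hz⟩) ?_ x x.2 y y.2
      ⟨x.2, SimpleGraph.Reachable.refl _⟩
    · exact this.2
    · rintro a ha b hb hab ⟨ha', hr⟩
      exact ⟨hb, hr.trans (SimpleGraph.Adj.reachable hab)⟩

theorem linked_image {W : Type u} {H : SimpleGraph W} (f : H ↪g G) {A : Set W} :
    Linked G (f '' A) ↔ Linked H A := by
  constructor
  · intro h P hP x hx y hy hPx
    obtain ⟨z, hz, hPz⟩ := h (fun v => ∃ x, f x = v ∧ P x) (by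
      rintro _ ⟨a, ha, rfl⟩ _ ⟨b, hb, rfl⟩ hab ⟨c, hc, hPc⟩
      obtain rfl := f.injective hc
      exact ⟨b, rfl, hP _ ha _ hb (f.map_adj_iff.1 hab) hPc⟩) (f x) ⟨x, hx, rfl⟩ (f y) ⟨y, hy, rfl⟩
      ⟨x, rfl, hPx⟩
    exact f.injective hz ▸ hPz
  · rintro h P hP _ ⟨x, hx, rfl⟩ _ ⟨y, hy, rfl⟩ hPx
    exact h (fun x => P (f x)) (fun a ha b hb hab => hP _ ⟨a, ha, rfl⟩ _ ⟨b, hb, rfl⟩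
      (f.map_adj_iff.2 hab)) x hx y hy hPx

theorem conn2_image {W : Type u} {H : SimpleGraph W} (f : H ↪g G) {A : Set W} :
    Conn2 G (f '' A) ↔ Conn2 H A := by
  unfold Conn2
  rw [linked_image f, Set.forall_mem_image]
  refine and_congr ?_ (and_congr Iff.rfl (forall₂_congr fun x _ => ?_))
  · exact ⟨Set.nontrivial_of_image f A, fun h => h.image f.injective⟩
  · rw [← linked_image f, Set.image_sdiff f.injective, Set.image_singleton]

theorem twoConnected_induce : TwoConnected (G.induce S) ↔ Conn2 G S := by
  unfold TwoConnected Conn2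
  rw [SimpleGraph.connected_iff, ← linked_iff_preconnected, Set.nontrivial_coe_sort]
  have key : ∀ v : S, ((G.induce S).induce {x | x ≠ v}).Preconnected ↔ Linked G (S \ {v.1}) := by
    intro v
    rw [linked_iff_preconnected, ← linked_image (SimpleGraph.Embedding.induce S)]
    have : (SimpleGraph.Embedding.induce (G := G) S) '' {x | x ≠ v} = S \ {v.1} := by
      ext y
      simp only [SimpleGraph.Embedding.comap_apply, Set.mem_image, Set.mem_ofPred_eq, Set.mem_sdiff,
        Set.mem_singleton_iff]
      constructor
      · rintro ⟨z, hz, rfl⟩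
        exact ⟨z.2, fun h => hz (Subtype.ext h)⟩
      · rintro ⟨h1, h2⟩
        exact ⟨⟨y, h1⟩, fun h => h2 (congrArg Subtype.val h), rfl⟩
    rw [this]
  constructor
  · rintro ⟨h1, ⟨h2, -⟩, h3⟩
    exact ⟨h1, h2, fun v hv => (key ⟨v, hv⟩).1 (h3 ⟨v, hv⟩)⟩
  · rintro ⟨h1, h2, h3⟩
    exact ⟨h1, ⟨h2, h1.nonempty.to_subtype⟩, fun v => (key v).2 (h3 v v.2)⟩

theorem twoConnected_iff : TwoConnected G ↔ Conn2 G Set.univ := by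
  unfold TwoConnected Conn2
  rw [SimpleGraph.connected_iff, Set.nontrivial_univ_iff]
  have h1 : G.Preconnected ↔ Linked G Set.univ := by
    rw [← linked_iff_preconnected]
    exact (SimpleGraph.induceUnivIso G).preconnected_iff.symm
  have h2 : ∀ v, (G.induce {x | x ≠ v}).Preconnected ↔ Linked G (Set.univ \ {v}) := by
    intro v
    rw [linked_iff_preconnected]
    have : {x | x ≠ v} = Set.univ \ {v} := by ext; simp
    rw [this]
  simp only [h1, h2, Set.mem_univ, true_imp_iff]
  constructor
  · rintro ⟨h, ⟨h', -⟩, h''⟩; exact ⟨h, h', h''⟩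
  · rintro ⟨h, h', h''⟩; exact ⟨h, ⟨h', inferInstance⟩, h''⟩

theorem contract_some_some {S : Set V} {a b : {x // x ∉ S}} :
    (contract G S).Adj (some a) (some b) ↔ G.Adj a.1 b.1 := by
  simp only [contract, SimpleGraph.fromRel_adj]
  constructor
  · rintro ⟨-, h | h⟩
    exacts [h, h.symm]
  · intro h
    exact ⟨fun hab => h.ne (congrArg Subtype.val (Option.some.inj hab)), Or.inl h⟩

theorem contract_none_some {S : Set V} {b : {x // x ∉ S}} :
    (contract G S).Adj none (some b) ↔ ∃ s ∈ S, G.Adj s b.1 := by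
  simp [contract, SimpleGraph.fromRel_adj]

/-- A contraction of a `2`-connected graph is `2`-connected iff the complement is connected. -/
theorem twoConnected_contract (hG : Conn2 G Set.univ) (hS : S.Nonempty) :
    TwoConnected (contract G S) ↔ Sᶜ.Nonempty ∧ Linked G Sᶜ := by
  classical
  rw [twoConnected_iff]
  obtain ⟨s, hs⟩ := hS
  constructor
  · rintro ⟨h1, -, h3⟩
    refine ⟨?_, fun P hP x hx y hy hPx => ?_⟩
    · rw [Set.nontrivial_univ_iff] at h1
      obtain ⟨z, hz⟩ := exists_ne (none : Option {x // x ∉ S})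
      obtain ⟨y, rfl⟩ := Option.ne_none_iff_exists'.1 hz
      exact ⟨y.1, y.2⟩
    · refine h3 none trivial (fun o => ∀ z, o = some z → P z.1) ?_ (some ⟨x, hx⟩) (by simp)
        (some ⟨y, hy⟩) (by simp) (fun z hz => ?_) ⟨y, hy⟩ rfl
      · rintro a ha b hb hab hPa z rfl
        obtain ⟨a', rfl⟩ := Option.ne_none_iff_exists'.1 ha.2
        exact hP _ a'.2 _ z.2 (contract_some_some.1 hab) (hPa a' rfl)
      · obtain rfl := Option.some.inj hz; exact hPx
  · rintro ⟨⟨y, hy⟩, h2⟩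
    -- The contraction map. Linked sets project to linked sets, so only preimages have to be linked:
    -- everything for the whole graph, `Sᶜ` when `none` is removed, and `univ \ {z}` when another
    -- vertex is removed.
    let π : V → Option {x // x ∉ S} := fun x => if h : x ∈ S then none else some ⟨x, h⟩
    have π1 : ∀ x ∈ S, π x = none := fun x hx => dif_pos hx
    have π2 : ∀ x : {x // x ∉ S}, π x.1 = some x := fun x => dif_neg x.2
    have πadj : ∀ x z, G.Adj x z → π x ≠ π z → (contract G S).Adj (π x) (π z) := by
      intro x z hxz hne
      by_cases hx : x ∈ S <;> by_cases hz : z ∈ S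
      · rw [π1 x hx, π1 z hz] at hne; exact absurd rfl hne
      · rw [π1 x hx, π2 ⟨z, hz⟩]; exact contract_none_some.2 ⟨x, hx, hxz⟩
      · rw [π1 z hz, π2 ⟨x, hx⟩]; exact (contract_none_some.2 ⟨z, hz, hxz.symm⟩).symm
      · rw [π2 ⟨x, hx⟩, π2 ⟨z, hz⟩]; exact contract_some_some.2 hxz
    have πsurj : ∀ o, ∃ x, π x = o := by
      rintro (_ | z)
      exacts [⟨s, π1 s hs⟩, ⟨z.1, π2 z⟩]
    have lift : ∀ A : Set V, ∀ B, Linked G A → (∀ x, x ∈ A ↔ π x ∈ B) →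
        Linked (contract G S) B := by
      intro A B hA hAB P hP a ha b hb hPa
      obtain ⟨x, rfl⟩ := πsurj a
      obtain ⟨z, rfl⟩ := πsurj b
      refine hA (fun x => P (π x)) (fun x hx z hz hxz hPx => ?_) x ((hAB x).2 ha) z ((hAB z).2 hb)
        hPa
      by_cases h : π x = π z
      · exact h ▸ hPx
      · exact hP _ ((hAB x).1 hx) _ ((hAB z).1 hz) (πadj x z hxz h) hPx
    refine ⟨⟨none, trivial, some ⟨y, hy⟩, trivial, by simp⟩,
      lift Set.univ _ hG.2.1 (by simp), fun o _ => ?_⟩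
    rcases o with _ | z
    · refine lift Sᶜ _ h2 fun x => ?_
      by_cases hx : x ∈ S
      · simp [π1 x hx, hx]
      · simp [π2 ⟨x, hx⟩, hx]
    · refine lift (Set.univ \ {z.1}) _ (hG.2.2 z.1 trivial) fun x => ?_
      by_cases hx : x ∈ S
      · have : x ≠ z.1 := fun h => z.2 (h ▸ hx)
        simp [π1 x hx, this]
      · have : x = z.1 ↔ (⟨x, hx⟩ : {x // x ∉ S}) = z := by rw [Subtype.ext_iff]
        simp [π2 ⟨x, hx⟩, this]

end Basics

/-! ### Two-vertex separations -/

/-- The vertex sets `S₁` and `S₂` meet in `{u, v}` only, both have further vertices, and no edge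
joins these. -/
structure Sep {V : Type u} (G : SimpleGraph V) (S₁ S₂ : Set V) (u v : V) : Prop where
  inter : S₁ ∩ S₂ = {u, v}
  ne : u ≠ v
  left : ∃ c ∈ S₁, c ∉ S₂
  right : ∃ c ∈ S₂, c ∉ S₁
  cross : ∀ x ∈ S₁, x ∉ S₂ → ∀ y ∈ S₂, y ∉ S₁ → ¬G.Adj x y

section Separation

variable {V : Type u} {G G' : SimpleGraph V} {A B S T S₁ S₂ T₁ T₂ D Z : Set V} {u v x y : V}

theorem Sep.symm (h : Sep G S₁ S₂ u v) : Sep G S₂ S₁ u v :=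
  ⟨by rw [Set.inter_comm, h.inter], h.ne, h.right, h.left,
    fun x hx hx' y hy hy' hxy => h.cross y hy hy' x hx hx' hxy.symm⟩

theorem Sep.mem_left (h : Sep G S₁ S₂ u v) : u ∈ S₁ ∧ v ∈ S₁ :=
  ⟨(h.inter.ge (by simp : u ∈ ({u, v} : Set V))).1, (h.inter.ge (by simp : v ∈ ({u, v} : Set V))).1⟩

theorem Sep.mem_right (h : Sep G S₁ S₂ u v) : u ∈ S₂ ∧ v ∈ S₂ := h.symm.mem_left

theorem Sep.eq_or_eq (h : Sep G S₁ S₂ u v) (h₁ : x ∈ S₁) (h₂ : x ∈ S₂) : x = u ∨ x = v := by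
  simpa using h.inter.le ⟨h₁, h₂⟩

theorem Sep.mono (h : Sep G S₁ S₂ u v)
    (hG : ∀ x ∈ S₁, x ∉ S₂ → ∀ y ∈ S₂, y ∉ S₁ → G'.Adj x y → G.Adj x y) : Sep G' S₁ S₂ u v :=
  ⟨h.inter, h.ne, h.left, h.right,
    fun x hx hx' y hy hy' hxy => h.cross x hx hx' y hy hy' (hG x hx hx' y hy hy' hxy)⟩

theorem Sep.del_edge (h : Sep G S₁ S₂ u v) : Sep (delEdge G x y) S₁ S₂ u v :=
  h.mono fun _ _ _ _ _ _ hab => (delEdge_adj.1 hab).1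

theorem Sep.of_closed (hDS : D ⊆ S) (hD : D.Nonempty) (hu : u ∈ S) (hv : v ∈ S) (huD : u ∉ D)
    (hvD : v ∉ D) (huv : u ≠ v) (hc : ∃ c ∈ S, c ∉ D ∧ c ≠ u ∧ c ≠ v)
    (h : ∀ x ∈ D, ∀ y ∈ S, G.Adj x y → y ∈ D ∨ y = u ∨ y = v) :
    Sep G (D ∪ {u, v}) (S \ D) u v ∧ (D ∪ {u, v}) ∪ (S \ D) = S := by
  refine ⟨⟨?_, huv, ?_, ?_, ?_⟩, ?_⟩
  · ext x
    simp only [Set.mem_inter_iff, Set.mem_union, Set.mem_insert_iff, Set.mem_singleton_iff,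
      Set.mem_sdiff]
    constructor
    · tauto
    · rintro (rfl | rfl) <;> tauto
  · obtain ⟨c, hc⟩ := hD
    exact ⟨c, Or.inl hc, fun h => h.2 hc⟩
  · obtain ⟨c, hc, h1, h2, h3⟩ := hc
    exact ⟨c, ⟨hc, h1⟩, by simp [*]⟩
  · intro x hx hx' y hy hy' hxy
    simp only [Set.mem_union, Set.mem_insert_iff, Set.mem_singleton_iff, Set.mem_sdiff, not_or,
      not_and, not_not] at *
    have hxD : x ∈ D := by rcases hx with h | rfl | rfl <;> tauto
    have := h x hxD y hy.1 hxy
    tauto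
  · ext x
    simp only [Set.mem_union, Set.mem_insert_iff, Set.mem_singleton_iff, Set.mem_sdiff]
    constructor
    · rintro ((h | rfl | rfl) | h)
      exacts [hDS h, hu, hv, h.1]
    · tauto

/-- A walk leaves `S₁` only through `u` or `v`, and an excursion that returns through the other end
is replaced by the edge `uv`. The removed set `Z` is arbitrary, so that vertex deletions and
complements of flats are both covered. -/
theorem Sep.linked_left (h : Sep G S₁ S₂ u v) (hl : Linked G ((S₁ ∪ S₂) \ Z)) :
    Linked (addEdge G u v) (S₁ \ Z) := by
  intro P hP x hx y hy hPx
  have huv : u ∉ Z → v ∉ Z → (P u ↔ P v) := fun hu hv =>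
    ⟨hP u ⟨h.mem_left.1, hu⟩ v ⟨h.mem_left.2, hv⟩ (addEdge_adj.2 (Or.inr ⟨rfl, h.ne⟩)),
      hP v ⟨h.mem_left.2, hv⟩ u ⟨h.mem_left.1, hu⟩
        (addEdge_adj.2 (Or.inr ⟨Sym2.eq_swap, h.ne.symm⟩))⟩
  -- Outside `S₁` the predicate records that `P` holds at an end that survives the removal of `Z`.
  -- By `huv` it does not matter through which end an excursion returns.
  have := hl (fun z => (z ∈ S₁ ∧ P z) ∨ (z ∉ S₁ ∧ ((u ∉ Z ∧ P u) ∨ (v ∉ Z ∧ P v)))) ?_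
    x ⟨Or.inl hx.1, hx.2⟩ y ⟨Or.inl hy.1, hy.2⟩ (Or.inl ⟨hx.1, hPx⟩)
  · rcases this with h | h
    exacts [h.2, absurd hy.1 h.1]
  · rintro a ⟨ha, haZ⟩ b ⟨hb, hbZ⟩ hab hPa
    by_cases ha1 : a ∈ S₁ <;> by_cases hb1 : b ∈ S₁
    · have := hP a ⟨ha1, haZ⟩ b ⟨hb1, hbZ⟩ (addEdge_adj.2 (Or.inl hab))
      tauto
    · have hb2 : b ∈ S₂ := hb.resolve_left hb1
      have ha2 : a ∈ S₂ := by
        by_contra ha2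
        exact h.cross a ha1 ha2 b hb2 hb1 hab
      rcases h.eq_or_eq ha1 ha2 with rfl | rfl <;> tauto
    · have ha2 : a ∈ S₂ := ha.resolve_left ha1
      have hb2 : b ∈ S₂ := by
        by_contra hb2
        exact h.cross b hb1 hb2 a ha2 ha1 hab.symm
      rcases h.eq_or_eq hb1 hb2 with rfl | rfl <;> tauto
    · tauto

theorem Sep.conn2_left (h : Sep G S₁ S₂ u v) (hl : Conn2 G (S₁ ∪ S₂)) :
    Conn2 (addEdge G u v) S₁ := by
  refine ⟨⟨u, h.mem_left.1, v, h.mem_left.2, h.ne⟩, ?_, fun z _ => h.linked_left (hl.linked_diff z)⟩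
  have := h.linked_left (Z := ∅) (by rw [Set.sdiff_empty]; exact hl.2.1)
  rwa [Set.sdiff_empty] at this

/-- Removing `u` or `v` disables the edge `uv`, and the two linked sets obtained in this way overlap
in the third vertex `c`. -/
theorem Conn2.linked_of_addEdge (h : Conn2 (addEdge G u v) T)
    (hc : ∃ c ∈ T, c ≠ u ∧ c ≠ v) : Linked G T := by
  obtain ⟨c, hcT, hcu, hcv⟩ := hc
  have h1 : Linked G (T \ {u}) := (h.linked_diff u).of_addEdge (by simp)
  have h2 : Linked G (T \ {v}) := (h.linked_diff v).of_addEdge (by simp)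
  by_cases huv : u = v
  · subst huv
    exact h.2.1.mono fun x _ y _ hxy => by
      rw [addEdge_adj, Sym2.eq_iff] at hxy
      rcases hxy with h | ⟨⟨rfl, rfl⟩ | ⟨rfl, rfl⟩, hne⟩
      exacts [h, (hne rfl).elim, (hne rfl).elim]
  · have : T = T \ {u} ∪ T \ {v} := by
      ext x
      simp only [Set.mem_union, Set.mem_sdiff, Set.mem_singleton_iff]
      constructor
      · intro hx
        by_cases hxu : x = u
        · subst hxu; exact Or.inr ⟨hx, huv⟩
        · exact Or.inl ⟨hx, hxu⟩
      · tauto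
    rw [this]
    exact h1.union h2 ⟨c, ⟨hcT, hcu⟩, ⟨hcT, hcv⟩⟩

/-- Each side connects `u` to `v` and so replaces the edge `uv` for the other side. Removing a
vertex other than `u`, `v` damages one side only; removing `u` or `v` makes the edge irrelevant, and
the sides still share the other end. -/
theorem conn2_union (hinter : T₁ ∩ T₂ = {u, v}) (huv : u ≠ v) (h₁ : Conn2 (addEdge G u v) T₁)
    (h₂ : Conn2 (addEdge G u v) T₂) (hl₁ : Linked G T₁) (hl₂ : Linked G T₂) :
    Conn2 G (T₁ ∪ T₂) := by
  have hu : u ∈ T₁ ∩ T₂ := hinter.ge (by simp)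
  have hv : v ∈ T₁ ∩ T₂ := hinter.ge (by simp)
  refine ⟨⟨u, Or.inl hu.1, v, Or.inl hv.1, huv⟩, hl₁.union hl₂ ⟨u, hu⟩, fun z _ => ?_⟩
  by_cases hzu : z = u
  · subst hzu
    rw [Set.union_sdiff_distrib]
    exact ((h₁.linked_diff z).of_addEdge (by simp)).union ((h₂.linked_diff z).of_addEdge (by simp))
      ⟨v, ⟨hv.1, huv.symm⟩, ⟨hv.2, huv.symm⟩⟩
  by_cases hzv : z = v
  · subst hzv
    rw [Set.union_sdiff_distrib]
    exact ((h₁.linked_diff z).of_addEdge (by simp)).union ((h₂.linked_diff z).of_addEdge (by simp))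
      ⟨u, ⟨hu.1, huv⟩, ⟨hu.2, huv⟩⟩
  by_cases hz : z ∈ T₂
  · have hz1 : z ∉ T₁ := fun h => by
      have : z ∈ ({u, v} : Set V) := hinter.le ⟨h, hz⟩
      simp [hzu, hzv] at this
    have e : (T₁ ∪ T₂) \ {z} = (T₂ \ {z}) ∪ T₁ := by
      rw [Set.union_sdiff_distrib, Set.sdiff_singleton_eq_self hz1, Set.union_comm]
    rw [e]
    exact (h₂.linked_diff z).union_of_addEdge hl₁ (fun _ _ => ⟨hu.1, hv.1⟩)
      ⟨u, ⟨hu.2, Ne.symm hzu⟩, hu.1⟩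
  · have e : (T₁ ∪ T₂) \ {z} = (T₁ \ {z}) ∪ T₂ := by
      rw [Set.union_sdiff_distrib, Set.sdiff_singleton_eq_self hz]
    rw [e]
    exact (h₁.linked_diff z).union_of_addEdge hl₂ (fun _ _ => ⟨hu.2, hv.2⟩)
      ⟨u, ⟨hu.1, Ne.symm hzu⟩, hu.2⟩

theorem Sep.ne_of_right (h : Sep G S₁ S₂ u v) : ∃ c ∈ S₂, c ≠ u ∧ c ≠ v := by
  obtain ⟨c, hc, hc'⟩ := h.right
  refine ⟨c, hc, ?_, ?_⟩ <;> rintro rfl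
  exacts [hc' h.mem_left.1, hc' h.mem_left.2]

theorem Sep.linked_right (h : Sep G S₁ S₂ u v) (hl : Conn2 G (S₁ ∪ S₂)) : Linked G S₂ :=
  (h.symm.conn2_left (by rwa [Set.union_comm]) |> fun h => by rwa [addEdge_comm] at h :
    Conn2 (addEdge G v u) S₂).linked_of_addEdge
    (by obtain ⟨c, h1, h2, h3⟩ := h.ne_of_right; exact ⟨c, h1, h3, h2⟩)

theorem Sep.conn2_right (h : Sep G S₁ S₂ u v) (hl : Conn2 G (S₁ ∪ S₂)) :
    Conn2 (addEdge G u v) S₂ :=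
  h.symm.conn2_left (by rwa [Set.union_comm])

/-- The `2`-connected sets through both vertices of a separation. -/
theorem Sep.conn2_union_right (h : Sep G S₁ S₂ u v) (hl : Conn2 G (S₁ ∪ S₂)) (hT : T ⊆ S₁)
    (hu : u ∈ T) (hv : v ∈ T) (hc : ∃ c ∈ T, c ≠ u ∧ c ≠ v) (hT2 : Conn2 (addEdge G u v) T) :
    Conn2 G (T ∪ S₂) := by
  refine conn2_union ?_ h.ne hT2 (h.conn2_right hl) (hT2.linked_of_addEdge hc) (h.linked_right hl)
  apply Set.Subset.antisymm
  · rw [← h.inter]; exact Set.inter_subset_inter_left _ hT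
  · rintro x (rfl | rfl)
    exacts [⟨hu, h.mem_right.1⟩, ⟨hv, h.mem_right.2⟩]

/-- From `S₂` the set `T` takes at most one of `u`, `v`. The rest of `S₂` stays linked and replaces
the edge `uv` when both ends survive. -/
theorem Sep.linked_sdiff (h : Sep G S₁ S₂ u v) (hl : Conn2 G (S₁ ∪ S₂)) (hT : T ⊆ S₁)
    (huv : u ∉ T ∨ v ∉ T) (hl' : Linked (addEdge G u v) (S₁ \ T)) :
    Linked G ((S₁ ∪ S₂) \ T) := by
  have hr := h.conn2_right hl
  have hT2 : ∀ z ∈ S₂, z ≠ u → z ≠ v → z ∉ T := fun z hz hzu hzv hzT => by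
    rcases h.eq_or_eq (hT hzT) hz with rfl | rfl <;> contradiction
  have e : (S₁ ∪ S₂) \ T = (S₁ \ T) ∪ (S₂ \ T) := Set.union_sdiff_distrib
  by_cases hu : u ∈ T
  · have hv : v ∉ T := by tauto
    have e2 : S₂ \ T = S₂ \ {u} := by
      ext z
      simp only [Set.mem_sdiff, Set.mem_singleton_iff, and_congr_right_iff]
      intro hz
      constructor
      · rintro h' rfl; exact h' hu
      · intro hzu hzT
        rcases h.eq_or_eq (hT hzT) hz with rfl | rfl <;> contradiction
    rw [e, e2]
    exact (hl'.of_addEdge (by simp [hu])).union ((hr.linked_diff u).of_addEdge (by simp))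
      ⟨v, ⟨h.mem_left.2, hv⟩, ⟨h.mem_right.2, h.ne.symm⟩⟩
  by_cases hv : v ∈ T
  · have e2 : S₂ \ T = S₂ \ {v} := by
      ext z
      simp only [Set.mem_sdiff, Set.mem_singleton_iff, and_congr_right_iff]
      intro hz
      constructor
      · rintro h' rfl; exact h' hv
      · intro hzv hzT
        rcases h.eq_or_eq (hT hzT) hz with rfl | rfl <;> contradiction
    rw [e, e2]
    exact (hl'.of_addEdge (by simp [hv])).union ((hr.linked_diff v).of_addEdge (by simp))
      ⟨u, ⟨h.mem_left.1, hu⟩, ⟨h.mem_right.1, h.ne⟩⟩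
  · have e2 : S₂ \ T = S₂ := by
      ext z
      simp only [Set.mem_sdiff, and_iff_left_iff_imp]
      intro hz hzT
      rcases h.eq_or_eq (hT hzT) hz with rfl | rfl <;> contradiction
    rw [e, e2]
    exact hl'.union_of_addEdge (h.linked_right hl) (fun _ _ => h.mem_right)
      ⟨u, ⟨h.mem_left.1, hu⟩, h.mem_right.1⟩

/-- Deleting an edge on one side of a separation. -/
theorem Sep.conn2_delEdge (h : Sep G S₁ S₂ u v) (hl : Conn2 G (S₁ ∪ S₂)) (hx : x ∈ S₁)
    (hy : y ∈ S₁) (hne : s(x, y) ≠ s(u, v)) (hxy : x ≠ y) :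
    Conn2 (delEdge G x y) (S₁ ∪ S₂) ↔ Conn2 (delEdge (addEdge G u v) x y) S₁ := by
  have hcomm : delEdge (addEdge G u v) x y = addEdge (delEdge G x y) u v := by
    ext a b
    rw [addEdge_adj, delEdge_adj, delEdge_adj, addEdge_adj]
    constructor
    · tauto
    · rintro (h | ⟨h1, h2⟩)
      · tauto
      · exact ⟨Or.inr ⟨h1, h2⟩, h1 ▸ hne.symm⟩
  have hnot : x ∉ S₂ ∨ y ∉ S₂ := by
    by_contra! hcon
    rcases h.eq_or_eq hx hcon.1 with h1 | h1 <;> rcases h.eq_or_eq hy hcon.2 with h2 | h2 <;>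
      simp_all
  rw [hcomm]
  constructor
  · exact fun h' => h.del_edge.conn2_left h'
  · intro h'
    have h2 : Conn2 (addEdge (delEdge G x y) u v) S₂ := by
      rw [← hcomm]; exact (h.conn2_right hl).del_edge hnot
    refine conn2_union h.inter h.ne h' h2 (h'.linked_of_addEdge ?_) ((h.linked_right hl).del_edge hnot)
    obtain ⟨c, hc⟩ := h.symm.ne_of_right
    exact ⟨c, hc⟩

theorem Sep.linked_sdiff_pair (h : Sep G S₁ S₂ u v) (hl : Conn2 G (S₁ ∪ S₂)) (hx : x ∈ S₁)
    (hy : y ∈ S₁) (hne : s(x, y) ≠ s(u, v)) :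
    Linked G ((S₁ ∪ S₂) \ {x, y}) ↔ Linked (addEdge G u v) (S₁ \ {x, y}) := by
  refine ⟨h.linked_left, h.linked_sdiff hl ?_ ?_⟩
  · rintro z (rfl | rfl) <;> assumption
  · by_contra! hcon
    apply hne
    rw [Sym2.eq_iff]
    have h1 := hcon.1
    have h2 := hcon.2
    have := h.ne
    rcases h1 with rfl | rfl <;> rcases h2 with rfl | rfl <;> simp_all

theorem exists_sep_of_not_linked (h : ¬Linked G (S \ {u, v})) :
    ∃ D ⊆ S, D.Nonempty ∧ u ∉ D ∧ v ∉ D ∧ (∃ c ∈ S, c ∉ D ∧ c ≠ u ∧ c ≠ v) ∧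
      ∀ x ∈ D, ∀ y ∈ S, G.Adj x y → y ∈ D ∨ y = u ∨ y = v := by
  unfold Linked at h
  push Not at h
  obtain ⟨P, hP, x, hx, y, hy, hPx, hPy⟩ := h
  simp only [Set.mem_sdiff, Set.mem_insert_iff, Set.mem_singleton_iff, not_or] at hP hx hy
  refine ⟨{z | (z ∈ S ∧ z ≠ u ∧ z ≠ v) ∧ P z}, fun z hz => hz.1.1, ⟨x, hx, hPx⟩, ?_, ?_,
    ⟨y, hy.1, fun h => hPy h.2, hy.2⟩, ?_⟩
  · rintro ⟨⟨_, h, _⟩, _⟩; exact h rfl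
  · rintro ⟨⟨_, _, h⟩, _⟩; exact h rfl
  · rintro a ⟨ha, hPa⟩ b hb hab
    by_cases hb' : b = u ∨ b = v
    · exact Or.inr hb'
    · rw [not_or] at hb'
      exact Or.inl ⟨⟨hb, hb'⟩, hP a ha b ⟨hb, hb'⟩ hab hPa⟩

theorem delEdge_addEdge (h : G.Adj u v) : addEdge (delEdge G u v) u v = G := by
  ext a b
  rw [addEdge_adj, delEdge_adj]
  constructor
  · rintro (h' | ⟨h', -⟩)
    · exact h'.1
    · rw [Sym2.eq_iff] at h'
      rcases h' with ⟨rfl, rfl⟩ | ⟨rfl, rfl⟩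
      exacts [h, h.symm]
  · intro hab
    by_cases h' : s(a, b) = s(u, v)
    · exact Or.inr ⟨h', hab.ne⟩
    · exact Or.inl ⟨hab, h'⟩

theorem addEdge_delEdge (h : ¬G.Adj u v) : delEdge (addEdge G u v) u v = G := by
  ext a b
  rw [delEdge_adj, addEdge_adj]
  constructor
  · tauto
  · intro hab
    refine ⟨Or.inl hab, fun h' => h ?_⟩
    rw [Sym2.eq_iff] at h'
    rcases h' with ⟨rfl, rfl⟩ | ⟨rfl, rfl⟩
    exacts [hab, hab.symm]

/-- Both sides have a third vertex and therefore connect `u` to `v` without the edge `uv`. -/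
theorem Sep.conn2_del (h : Sep G S₁ S₂ u v) (hl : Conn2 G (S₁ ∪ S₂)) :
    Conn2 (delEdge G u v) (S₁ ∪ S₂) := by
  by_cases huv : G.Adj u v
  · have h1 := h.conn2_left hl
    have h2 := h.conn2_right hl
    rw [addEdge_eq_self huv, ← delEdge_addEdge huv] at h1 h2
    exact conn2_union h.inter h.ne h1 h2 (h1.linked_of_addEdge h.symm.ne_of_right)
      (h2.linked_of_addEdge h.ne_of_right)
  · exact hl.mono fun x _ y _ hxy => delEdge_adj.2 ⟨hxy, fun h' => by
      rw [Sym2.eq_iff] at h'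
      rcases h' with ⟨rfl, rfl⟩ | ⟨rfl, rfl⟩
      exacts [huv hxy, huv hxy.symm]⟩

/-- In a `2`-connected graph, one of deletion and contraction of an edge is `2`-connected. -/
theorem Conn2.del_of_not_linked (h : Conn2 G S) (hu : u ∈ S) (hv : v ∈ S) (huv : u ≠ v)
    (hl : ¬Linked G (S \ {u, v})) : Conn2 (delEdge G u v) S := by
  obtain ⟨D, hDS, hD, huD, hvD, hc, hcl⟩ := exists_sep_of_not_linked hl
  obtain ⟨hsep, hun⟩ := Sep.of_closed hDS hD hu hv huD hvD huv hc hcl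
  have := hsep.conn2_del (by rwa [hun])
  rwa [hun] at this

/-- In a `2`-connected graph on at least three vertices, degrees are at least two. -/
theorem Conn2.exists_adj_ne (h : Conn2 G T) (hx : x ∈ T) (hyx : y ≠ x)
    (hc : ∃ c ∈ T, c ≠ x ∧ c ≠ y) : ∃ z ∈ T, z ≠ y ∧ G.Adj x z := by
  by_contra! hcon
  obtain ⟨c, hc, hcx, hcy⟩ := hc
  have := (h.linked_diff y).subset_of_closed (x := x) (B := {x}) ⟨hx, hyx.symm⟩ rfl
    (by rintro a - b hb hab rfl; exact absurd hab (hcon b hb.1 hb.2))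
  exact hcx (this ⟨hc, hcy⟩)

end Separation

/-! ### The defect of a vertex set -/

/-- The difference `δ (|S| - 1) - w(E(S))`. -/
noncomputable def defect {V : Type u} (δ : ℕ) (G : SimpleGraph V) (w : Sym2 V → ℕ) (S : Set V) :
    ℤ :=
  δ * ((S.ncard : ℤ) - 1) - ((∑ᶠ e ∈ edgesIn G S, w e : ℕ) : ℤ)

section Defect

variable {V : Type u} {δ : ℕ} {G G' : SimpleGraph V} {w w' : Sym2 V → ℕ} {A B S T : Set V}
  {u v x y : V}

theorem mem_edgesIn : s(x, y) ∈ edgesIn G S ↔ G.Adj x y ∧ x ∈ S ∧ y ∈ S := by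
  simp [edgesIn]

theorem edgesIn_univ : edgesIn G Set.univ = G.edgeSet := by
  ext e; simp [edgesIn]

theorem defect_congr (hG : ∀ x ∈ S, ∀ y ∈ S, (G.Adj x y ↔ G'.Adj x y))
    (hw : ∀ x ∈ S, ∀ y ∈ S, G.Adj x y → w s(x, y) = w' s(x, y)) :
    defect δ G w S = defect δ G' w' S := by
  have h1 : edgesIn G S = edgesIn G' S := by
    ext e
    induction e with | _ x y => ?_
    rw [mem_edgesIn, mem_edgesIn]
    constructor
    · rintro ⟨h, hx, hy⟩; exact ⟨(hG x hx y hy).1 h, hx, hy⟩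
    · rintro ⟨h, hx, hy⟩; exact ⟨(hG x hx y hy).2 h, hx, hy⟩
  unfold defect
  rw [← h1]
  congr 2
  refine finsum_mem_congr rfl fun e => ?_
  induction e with | _ x y => ?_
  intro he
  rw [mem_edgesIn] at he
  exact hw x he.2.1 y he.2.2 he.1

theorem defect_image {W : Type u} {H : SimpleGraph W} (f : H ↪g G) (A : Set W) :
    defect δ G w (f '' A) = defect δ H (w ∘ Sym2.map f) A := by
  have h1 : edgesIn G (f '' A) = Sym2.map f '' edgesIn H A := by
    ext e
    constructor
    · induction e with | _ x y => ?_
      rw [mem_edgesIn]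
      rintro ⟨h, ⟨x, hx, rfl⟩, ⟨y, hy, rfl⟩⟩
      exact ⟨s(x, y), mem_edgesIn.2 ⟨f.map_adj_iff.1 h, hx, hy⟩, rfl⟩
    · rintro ⟨e, he, rfl⟩
      induction e with | _ x y => ?_
      rw [mem_edgesIn] at he
      rw [Sym2.map_mk, mem_edgesIn]
      exact ⟨f.map_adj_iff.2 he.1, ⟨x, he.2.1, rfl⟩, ⟨y, he.2.2, rfl⟩⟩
  unfold defect
  rw [Set.ncard_image_of_injective _ f.injective, h1,
    finsum_mem_image (Sym2.map.injective f.injective).injOn]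
  rfl

theorem defect_pair (huv : u ≠ v) (h : G.Adj u v) : defect δ G w {u, v} = δ - w s(u, v) := by
  have h1 : edgesIn G {u, v} = {s(u, v)} := by
    ext e
    induction e with | _ x y => ?_
    rw [mem_edgesIn, Set.mem_singleton_iff, Sym2.eq_iff]
    constructor
    · rintro ⟨h', rfl | rfl, rfl | rfl⟩
      exacts [(h'.ne rfl).elim, Or.inl ⟨rfl, rfl⟩, Or.inr ⟨rfl, rfl⟩, (h'.ne rfl).elim]
    · rintro (⟨rfl, rfl⟩ | ⟨rfl, rfl⟩)
      exacts [⟨h, by simp, by simp⟩, ⟨h.symm, by simp, by simp⟩]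
  unfold defect
  rw [h1, finsum_mem_singleton, Set.ncard_pair huv]
  push_cast; ring

theorem defect_pair_of_not_adj (huv : u ≠ v) (h : ¬G.Adj u v) : defect δ G w {u, v} = δ := by
  have h1 : edgesIn G {u, v} = ∅ := by
    ext e
    induction e with | _ x y => ?_
    rw [mem_edgesIn]
    simp only [Set.mem_empty_iff_false, iff_false]
    rintro ⟨h', rfl | rfl, rfl | rfl⟩
    exacts [h'.ne rfl, h h', h h'.symm, h'.ne rfl]
  unfold defect
  rw [h1, finsum_mem_empty, Set.ncard_pair huv]
  push_cast; ring

theorem defect_exchange_of_notMem (huv : u ∉ T ∨ v ∉ T)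
    (hG : ∀ x y, s(x, y) ≠ s(u, v) → (G'.Adj x y ↔ G.Adj x y))
    (hw : ∀ x ∈ T, ∀ y ∈ T, G.Adj x y → s(x, y) ≠ s(u, v) → w' s(x, y) = w s(x, y)) :
    defect δ G' w' T = defect δ G w T := by
  have hne : ∀ x ∈ T, ∀ y ∈ T, s(x, y) ≠ s(u, v) := by
    intro x hx y hy h
    rw [Sym2.eq_iff] at h
    rcases h with ⟨rfl, rfl⟩ | ⟨rfl, rfl⟩ <;> tauto
  exact defect_congr (fun x hx y hy => hG x y (hne x hx y hy)) fun x hx y hy h =>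
    hw x hx y hy ((hG x y (hne x hx y hy)).1 h) (hne x hx y hy)

variable [Finite V]

/-- Cardinality and edge weight are both modular here: without crossing edges, every edge of the
union lies in one of the two sets. -/
theorem defect_union (hcross : ∀ x ∈ A, x ∉ B → ∀ y ∈ B, y ∉ A → ¬G.Adj x y) :
    defect δ G w (A ∪ B) + defect δ G w (A ∩ B) = defect δ G w A + defect δ G w B := by
  have h1 : edgesIn G (A ∪ B) = edgesIn G A ∪ edgesIn G B := by
    ext e
    induction e with | _ x y => ?_
    rw [Set.mem_union, mem_edgesIn, mem_edgesIn, mem_edgesIn]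
    have h1 := hcross x
    have h2 := hcross y
    constructor
    · rintro ⟨h, hx, hy⟩
      by_contra hcon
      have hs := h.symm
      rcases hx with hx | hx <;> rcases hy with hy | hy
      · tauto
      · exact h1 hx (fun h' => hcon (Or.inr ⟨h, h', hy⟩)) y hy
          (fun h' => hcon (Or.inl ⟨h, hx, h'⟩)) h
      · exact h2 hy (fun h' => hcon (Or.inr ⟨h, hx, h'⟩)) x hx
          (fun h' => hcon (Or.inl ⟨h, h', hy⟩)) hs
      · tauto
    · rintro (⟨h, hx, hy⟩ | ⟨h, hx, hy⟩)
      exacts [⟨h, Or.inl hx, Or.inl hy⟩, ⟨h, Or.inr hx, Or.inr hy⟩]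
  have h2 : edgesIn G (A ∩ B) = edgesIn G A ∩ edgesIn G B := by
    ext e
    induction e with | _ x y => ?_
    rw [Set.mem_inter_iff, mem_edgesIn, mem_edgesIn, mem_edgesIn]
    simp only [Set.mem_inter_iff]
    tauto
  have h3 := finsum_mem_union_inter (f := w) (Set.toFinite (edgesIn G A))
    (Set.toFinite (edgesIn G B))
  have h4 := Set.ncard_union_add_ncard_inter A B
  unfold defect
  rw [h1, h2]
  zify at h4
  replace h3 := congrArg (Nat.cast : ℕ → ℤ) h3
  rw [Nat.cast_add, Nat.cast_add] at h3
  linear_combination (δ : ℤ) * h4 - h3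

/-- Subtracting the defect of `{u, v}` cancels the contribution of the edge `uv`, whether it is
present or not. The normalised defect is thus insensitive to adding, deleting or reweighting `uv`.
-/
theorem defect_delEdge (hu : u ∈ T) (hv : v ∈ T) (huv : u ≠ v) :
    defect δ G w T - defect δ G w {u, v} = defect δ (delEdge G u v) w T - δ := by
  have h1 : edgesIn G T = edgesIn (delEdge G u v) T ∪ edgesIn G {u, v} := by
    ext e
    induction e with | _ x y => ?_
    rw [Set.mem_union, mem_edgesIn, mem_edgesIn, mem_edgesIn, delEdge_adj, Ne, Sym2.eq_iff]
    constructor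
    · rintro ⟨h, hx, hy⟩
      by_cases h' : x = u ∧ y = v ∨ x = v ∧ y = u
      · refine Or.inr ⟨h, ?_⟩
        rcases h' with ⟨rfl, rfl⟩ | ⟨rfl, rfl⟩ <;> simp
      · exact Or.inl ⟨⟨h, h'⟩, hx, hy⟩
    · rintro (⟨h, hx, hy⟩ | ⟨h, rfl | rfl, rfl | rfl⟩)
      exacts [⟨h.1, hx, hy⟩, ⟨h, hu, hu⟩, ⟨h, hu, hv⟩, ⟨h, hv, hu⟩, ⟨h, hv, hv⟩]
  have h2 : Disjoint (edgesIn (delEdge G u v) T) (edgesIn G {u, v}) := by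
    rw [Set.disjoint_left]
    intro e
    induction e with | _ x y => ?_
    rw [mem_edgesIn, mem_edgesIn, delEdge_adj, Ne, Sym2.eq_iff]
    rintro ⟨⟨h, h'⟩, -⟩ ⟨-, rfl | rfl, rfl | rfl⟩
    exacts [h.ne rfl, h' (Or.inl ⟨rfl, rfl⟩), h' (Or.inr ⟨rfl, rfl⟩), h.ne rfl]
  unfold defect
  rw [h1, finsum_mem_union h2 (Set.toFinite _) (Set.toFinite _), Set.ncard_pair huv]
  push_cast; ring

/-- Changing the edge `uv` and its weight. -/
theorem defect_exchange (hu : u ∈ T) (hv : v ∈ T) (huv : u ≠ v)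
    (hG : ∀ x y, s(x, y) ≠ s(u, v) → (G'.Adj x y ↔ G.Adj x y))
    (hw : ∀ x ∈ T, ∀ y ∈ T, G.Adj x y → s(x, y) ≠ s(u, v) → w' s(x, y) = w s(x, y)) :
    defect δ G' w' T - defect δ G' w' {u, v} = defect δ G w T - defect δ G w {u, v} := by
  rw [defect_delEdge hu hv huv, defect_delEdge hu hv huv]
  congr 1
  refine defect_congr (fun x _ y _ => ?_) fun x hx y hy h => ?_
  · rw [delEdge_adj, delEdge_adj]
    constructor
    · rintro ⟨h1, h2⟩; exact ⟨(hG x y h2).1 h1, h2⟩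
    · rintro ⟨h1, h2⟩; exact ⟨(hG x y h2).2 h1, h2⟩
  · rw [delEdge_adj] at h
    exact hw x hx y hy ((hG x y h.2).1 h.1) h.2

/-- Relative to the common pair `{p, q}`, defects are additive over parts that meet only there. -/
theorem defect_biUnion {ι : Type*} {I : Finset ι} (hI : I.Nonempty) (C : ι → Set V) (p q : V)
    (hp : ∀ i, p ∈ C i) (hq : ∀ i, q ∈ C i)
    (hinter : ∀ i j x, i ≠ j → x ∈ C i → x ∈ C j → x = p ∨ x = q)
    (hcross : ∀ i j, i ≠ j → ∀ x ∈ C i, ∀ y ∈ C j, G.Adj x y → x ∈ C j ∨ y ∈ C i) :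
    defect δ G w (⋃ i ∈ I, C i) - defect δ G w {p, q} =
      ∑ i ∈ I, (defect δ G w (C i) - defect δ G w {p, q}) := by
  classical
  induction hI using Finset.Nonempty.cons_induction with
  | singleton a => simp
  | cons a I ha hI ih =>
    obtain ⟨b, hb⟩ := hI
    rw [Finset.sum_cons, ← ih]
    have h1 : C a ∩ (⋃ i ∈ I, C i) = {p, q} := by
      ext x
      simp only [Set.mem_inter_iff, Set.mem_iUnion, exists_prop, Set.mem_insert_iff,
        Set.mem_singleton_iff]
      constructor
      · rintro ⟨hxa, i, hi, hxi⟩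
        exact hinter a i x (fun h => ha (h ▸ hi)) hxa hxi
      · rintro (rfl | rfl)
        exacts [⟨hp a, b, hb, hp b⟩, ⟨hq a, b, hb, hq b⟩]
    have h2 : (⋃ i ∈ Finset.cons a I ha, C i) = C a ∪ ⋃ i ∈ I, C i := by simp
    have := defect_union (δ := δ) (w := w) (G := G) (A := C a) (B := ⋃ i ∈ I, C i) ?_
    · rw [h1] at this
      rw [h2]
      linarith
    · intro x hx hx' y hy hy' hxy
      simp only [Set.mem_iUnion, exists_prop, not_exists, not_and] at hx' hy
      obtain ⟨i, hi, hyi⟩ := hy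
      rcases hcross a i (fun h => ha (h ▸ hi)) x hx y hyi hxy with h | h
      exacts [hx' i hi h, hy' h]

/-- Every edge has two ends. -/
theorem sum_defect_sdiff (hS : ∀ v ∈ S, defect δ G w (S \ {v}) = 1) (h : defect δ G w S = 0) :
    (S.ncard : ℤ) * (δ + 1) = 2 * δ * (S.ncard - 1) := by
  classical
  have hfin := Set.toFinite (edgesIn G S)
  have hSf := Set.toFinite S
  set E := hfin.toFinset with hE
  set s := hSf.toFinset with hs
  have hsc : S.ncard = s.card := Set.ncard_eq_toFinset_card S hSf
  have hW : (∑ᶠ e ∈ edgesIn G S, w e) = ∑ e ∈ E, w e := finsum_mem_eq_finite_toFinset_sum w hfin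
  -- Passing from `S` to `S \ {v}` changes the defect by the weighted degree of `v` minus `δ`. This
  -- change is 1, so the weighted degree is `δ + 1`.
  have hv : ∀ v ∈ s, (∑ e ∈ E, if v ∈ e then (w e : ℤ) else 0) = δ + 1 := by
    intro v hv
    have hvS : v ∈ S := hSf.mem_toFinset.1 hv
    have h1 := hS v hvS
    have h2 : (∑ᶠ e ∈ edgesIn G (S \ {v}), w e) = ∑ e ∈ E with v ∉ e, w e := by
      rw [finsum_mem_eq_finite_toFinset_sum w (Set.toFinite _)]
      refine Finset.sum_congr ?_ fun _ _ => rfl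
      ext e
      induction e with | _ x y => ?_
      simp only [Set.Finite.mem_toFinset, mem_edgesIn, Finset.mem_filter, hE, Sym2.mem_iff,
        Set.mem_sdiff, Set.mem_singleton_iff, not_or]
      constructor
      · rintro ⟨h1, ⟨h2, h3⟩, h4, h5⟩; exact ⟨⟨h1, h2, h4⟩, Ne.symm h3, Ne.symm h5⟩
      · rintro ⟨⟨h1, h2, h4⟩, h3, h5⟩; exact ⟨h1, ⟨h2, Ne.symm h3⟩, h4, Ne.symm h5⟩
    have h3 := Finset.sum_filter_add_sum_filter_not E (fun e => v ∈ e) (fun e => (w e : ℤ))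
    have h4 : ((S \ {v}).ncard : ℤ) = S.ncard - 1 := by
      have := Set.ncard_sdiff_singleton_add_one hvS
      omega
    unfold defect at h1 h
    rw [h2, h4] at h1
    rw [hW] at h
    push_cast at h1 h
    rw [← Finset.sum_filter]
    linear_combination h3 - h + h1
  have h1 : (∑ v ∈ s, ∑ e ∈ E, if v ∈ e then (w e : ℤ) else 0) = s.card * (δ + 1) := by
    rw [Finset.sum_congr rfl hv]; simp
  have h2 : (∑ v ∈ s, ∑ e ∈ E, if v ∈ e then (w e : ℤ) else 0) = 2 * ∑ e ∈ E, (w e : ℤ) := by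
    rw [Finset.sum_comm, Finset.mul_sum]
    refine Finset.sum_congr rfl fun e => ?_
    induction e with | _ x y => ?_
    intro he
    rw [hfin.mem_toFinset, mem_edgesIn] at he
    rw [← Finset.sum_filter, Finset.sum_const]
    have : s.filter (fun v => v ∈ s(x, y)) = {x, y} := by
      ext z
      simp only [Finset.mem_filter, hs, Set.Finite.mem_toFinset, Sym2.mem_iff, Finset.mem_insert,
        Finset.mem_singleton, and_iff_right_iff_imp]
      rintro (rfl | rfl)
      exacts [he.2.1, he.2.2]
    rw [this, Finset.card_pair he.1.ne]
    simp
  unfold defect at h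
  rw [hW] at h
  push_cast at h
  rw [hsc] at h ⊢
  linear_combination h2 - h1 - 2 * h

end Defect

/-! ### Weights satisfying the equalities -/

/-- The equalities for the flats on at least three vertices, for any weights in `{1, δ - 1}`. -/
structure Relaxed {V : Type u} (δ : ℕ) (G : SimpleGraph V) (S : Set V) (w : Sym2 V → ℕ) :
    Prop where
  range : ∀ x ∈ S, ∀ y ∈ S, G.Adj x y → w s(x, y) = 1 ∨ w s(x, y) = δ - 1
  total : defect δ G w S = 0
  flat : ∀ T ⊆ S, 3 ≤ T.ncard → Conn2 G T → (S \ T).Nonempty → Linked G (S \ T) →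
    defect δ G w T = 1

section Relaxed

variable {V : Type u} {δ : ℕ} {G : SimpleGraph V} {w w' : Sym2 V → ℕ} {S T S₁ S₂ D : Set V}
  {u v x y a b : V}

theorem exists_ne_ne_of_ncard (hT : 3 ≤ T.ncard) (u v : V) : ∃ c ∈ T, c ≠ u ∧ c ≠ v := by
  have h1 : ({u, v} : Set V).ncard < T.ncard :=
    (Set.ncard_insert_le u {v}).trans_lt (by rw [Set.ncard_singleton]; omega)
  obtain ⟨c, hc, hc'⟩ := Set.exists_mem_notMem_of_ncard_lt_ncard h1
  exact ⟨c, hc, by simpa using hc'⟩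

theorem three_le_ncard [Finite V] (hu : u ∈ T) (hv : v ∈ T) (hx : x ∈ T) (huv : u ≠ v)
    (hxu : x ≠ u) (hxv : x ≠ v) : 3 ≤ T.ncard := by
  have : ({x, u, v} : Set V).ncard = 3 := by
    rw [Set.ncard_insert_of_notMem (by simp [*]), Set.ncard_pair huv]
  rw [← this]
  refine Set.ncard_le_ncard ?_
  rintro z (rfl | rfl | rfl) <;> assumption

theorem Sep.three_le_left [Finite V] (h : Sep G S₁ S₂ u v) : 3 ≤ S₁.ncard := by
  obtain ⟨c, hc, h1, h2⟩ := h.symm.ne_of_right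
  exact three_le_ncard h.mem_left.1 h.mem_left.2 hc h.ne h1 h2

theorem Sep.ncard_lt [Finite V] (h : Sep G S₁ S₂ u v) : S₁.ncard < (S₁ ∪ S₂).ncard := by
  obtain ⟨c, hc, hc'⟩ := h.right
  exact Set.ncard_lt_ncard (Set.ssubset_iff_exists.2 ⟨Set.subset_union_left, c, Or.inr hc, hc'⟩)

theorem addEdge_adj_iff (h : s(x, y) ≠ s(u, v)) : (addEdge G u v).Adj x y ↔ G.Adj x y := by
  rw [addEdge_adj]; tauto

theorem Sep.defect_union [Finite V] (h : Sep G S₁ S₂ u v) :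
    defect δ G w (S₁ ∪ S₂) + defect δ G w {u, v} = defect δ G w S₁ + defect δ G w S₂ := by
  rw [← h.inter]
  exact GraphicGorenstein.defect_union h.cross

theorem Sep.defect_union_of_subset [Finite V] (h : Sep G S₁ S₂ u v) (hT : T ⊆ S₁) (hu : u ∈ T)
    (hv : v ∈ T) :
    defect δ G w (T ∪ S₂) + defect δ G w {u, v} = defect δ G w T + defect δ G w S₂ := by
  have e : T ∩ S₂ = {u, v} := by
    apply Set.Subset.antisymm
    · rw [← h.inter]; exact Set.inter_subset_inter_left _ hT
    · rintro x (rfl | rfl)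
      exacts [⟨hu, h.mem_right.1⟩, ⟨hv, h.mem_right.2⟩]
  rw [← e]
  refine GraphicGorenstein.defect_union fun x hx hx' y hy hy' => ?_
  refine h.cross x (hT hx) hx' y hy fun hy1 => hy' ?_
  rcases h.eq_or_eq hy1 hy with rfl | rfl <;> assumption

/-- One side of a separation inherits the equalities. -/
theorem Relaxed.left [Finite V] (h : Relaxed δ G (S₁ ∪ S₂) w) (hsep : Sep G S₁ S₂ u v)
    (hc : Conn2 G (S₁ ∪ S₂))
    (hw : ∀ x ∈ S₁, ∀ y ∈ S₁, G.Adj x y → s(x, y) ≠ s(u, v) → w' s(x, y) = w s(x, y))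
    (ht : w' s(u, v) = 1 ∨ w' s(u, v) = δ - 1) (h0 : defect δ (addEdge G u v) w' S₁ = 0) :
    Relaxed δ (addEdge G u v) S₁ w' := by
  refine ⟨fun x hx y hy hxy => ?_, h0, fun T hT hT3 hTc hne hl => ?_⟩
  · by_cases he : s(x, y) = s(u, v)
    · rwa [he]
    · have hxy' := (addEdge_adj_iff he).1 hxy
      rw [hw x hx y hy hxy' he]
      exact h.range x (Or.inl hx) y (Or.inl hy) hxy'
  · have hwT : ∀ x ∈ T, ∀ y ∈ T, G.Adj x y → s(x, y) ≠ s(u, v) → w' s(x, y) = w s(x, y) :=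
      fun x hx y hy => hw x (hT hx) y (hT hy)
    -- A flat through both ends is completed by `S₂`, which leaves its complement unchanged, and the
    -- modular identities compare its defect with the total. Any other flat does not see the edge
    -- `uv` and is a flat of the whole graph.
    by_cases huv : u ∈ T ∧ v ∈ T
    · obtain ⟨hu, hv⟩ := huv
      have e : (S₁ ∪ S₂) \ (T ∪ S₂) = S₁ \ T := by
        ext z
        simp only [Set.mem_sdiff, Set.mem_union, not_or]
        constructor
        · tauto
        · rintro ⟨h1, h2⟩
          refine ⟨Or.inl h1, h2, fun h3 => h2 ?_⟩
          rcases hsep.eq_or_eq h1 h3 with rfl | rfl <;> assumption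
      have h1 := h.flat (T ∪ S₂) (Set.union_subset_union_left _ hT)
        (hT3.trans (Set.ncard_le_ncard Set.subset_union_left))
        (hsep.conn2_union_right hc hT hu hv (exists_ne_ne_of_ncard hT3 u v) hTc)
        (by rwa [e]) (by rw [e]; exact hl.of_addEdge (by simp [hu]))
      have h2 := hsep.defect_union_of_subset (δ := δ) (w := w) hT hu hv
      have h3 := hsep.defect_union (δ := δ) (w := w)
      have h4 := defect_exchange (δ := δ) (G := G) (G' := addEdge G u v) (w := w) (w' := w') hu hv
        hsep.ne (fun x y => addEdge_adj_iff) hwT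
      have h5 := defect_exchange (δ := δ) (G := G) (G' := addEdge G u v) (w := w) (w' := w')
        hsep.mem_left.1 hsep.mem_left.2 hsep.ne (fun x y => addEdge_adj_iff) hw
      have h6 := h.total
      linarith
    · rw [defect_exchange_of_notMem (G := G) (w := w) (by tauto) (fun x y => addEdge_adj_iff) hwT]
      refine h.flat T (hT.trans Set.subset_union_left) hT3 (hTc.of_addEdge (by tauto))
        (hne.mono (Set.sdiff_subset_sdiff_left Set.subset_union_left))
        (hsep.linked_sdiff hc hT (by tauto) hl)

theorem sdiff_pair_nonempty (hu : u ∈ S) (hv : v ∈ S) (huv : u ≠ v) (hne : s(a, b) ≠ s(u, v)) :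
    (S \ {a, b}).Nonempty := by
  by_contra hcon
  rw [Set.not_nonempty_iff_eq_empty, Set.sdiff_eq_empty] at hcon
  have h1 := hcon hu
  have h2 := hcon hv
  rcases h1 with rfl | rfl <;> rcases h2 with rfl | rfl
  exacts [huv rfl, hne rfl, hne Sym2.eq_swap, huv rfl]

/-! ### Pieces cut off by two vertices, away from a given edge -/

/-- A vertex set with two attachments, away from the edge `ab`, and not everything else. -/
structure Piece (G : SimpleGraph V) (S : Set V) (a b : V) (D : Set V) (u v : V) : Prop where
  subset : D ⊆ S
  nonempty : D.Nonempty
  hu : u ∈ S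
  hv : v ∈ S
  huv : u ≠ v
  huD : u ∉ D
  hvD : v ∉ D
  closed : ∀ x ∈ D, ∀ y ∈ S, G.Adj x y → y ∈ D ∨ y = u ∨ y = v
  linked : Linked G D
  ha : a ∉ D
  hb : b ∉ D
  rest : ∃ c ∈ S, c ∉ D ∧ c ≠ u ∧ c ≠ v

theorem Piece.symm (h : Piece G S a b D u v) : Piece G S a b D v u where
  subset := h.subset
  nonempty := h.nonempty
  hu := h.hv
  hv := h.hu
  huv := h.huv.symm
  huD := h.hvD
  hvD := h.huD
  closed x hx y hy hxy := (h.closed x hx y hy hxy).imp_right Or.symm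
  linked := h.linked
  ha := h.ha
  hb := h.hb
  rest := by obtain ⟨c, h1, h2, h3, h4⟩ := h.rest; exact ⟨c, h1, h2, h4, h3⟩

theorem Piece.sep (h : Piece G S a b D u v) :
    Sep G (D ∪ {u, v}) (S \ D) u v ∧ (D ∪ {u, v}) ∪ (S \ D) = S :=
  Sep.of_closed h.subset h.nonempty h.hu h.hv h.huD h.hvD h.huv h.rest h.closed

/-- If the pairs agreed, `D` would be closed under adjacency in the linked set `S \ {a, b}` and yet
miss the vertex provided by `rest`. -/
theorem Piece.ne (h : Piece G S a b D u v) (hl : Linked G (S \ {a, b})) :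
    s(a, b) ≠ s(u, v) := by
  intro he
  have e : ({a, b} : Set V) = {u, v} := by
    rw [Sym2.eq_iff] at he
    rcases he with ⟨rfl, rfl⟩ | ⟨rfl, rfl⟩
    exacts [rfl, Set.pair_comm _ _]
  rw [e] at hl
  obtain ⟨d, hd⟩ := h.nonempty
  obtain ⟨c, hc, hcD, hcu, hcv⟩ := h.rest
  refine hcD (hl.subset_of_closed (x := d) (B := D)
    ⟨h.subset hd, by rintro (rfl | rfl); exacts [h.huD hd, h.hvD hd]⟩ hd ?_ ⟨hc, by simp [*]⟩)
  rintro y - z ⟨hz, hz'⟩ hyz hy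
  rcases h.closed y hy z hz hyz with h | rfl | rfl
  · exact h
  · simp at hz'
  · simp at hz'

theorem exists_piece (hu : u ∈ S) (hv : v ∈ S) (huv : u ≠ v) (ha : a ∈ S) (hb : b ∈ S)
    (hab : G.Adj a b) (hl : ¬Linked G (S \ {u, v})) : ∃ D, Piece G S a b D u v := by
  obtain ⟨D, hDS, ⟨d, hd⟩, huD, hvD, ⟨c, hc, hcD, hcu, hcv⟩, hcl⟩ := exists_sep_of_not_linked hl
  -- Adjacent vertices cannot lie strictly on both sides of the cut. So either `D` or the opposite
  -- side avoids both `a` and `b`, and a component of that side is a piece.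
  by_cases hD : a ∉ D ∧ b ∉ D
  · obtain ⟨C, hCD, hdC, hCl, hCc⟩ := exists_component (G := G) hd
    refine ⟨C, fun x hx => hDS (hCD hx), ⟨d, hdC⟩, hu, hv, huv, fun h => huD (hCD h),
      fun h => hvD (hCD h), fun x hx y hy hxy => ?_, hCl, fun h => hD.1 (hCD h),
      fun h => hD.2 (hCD h), c, hc, fun h => hcD (hCD h), hcu, hcv⟩
    exact (hcl x (hCD hx) y hy hxy).imp_left fun h => hCc x hx y h hxy
  · have hc' : c ∈ S \ (D ∪ {u, v}) := ⟨hc, by simp [*]⟩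
    obtain ⟨C, hCD, hcC, hCl, hCc⟩ := exists_component (G := G) hc'
    have hu' : u ∉ C := fun h => (hCD h).2 (by simp)
    have hv' : v ∉ C := fun h => (hCD h).2 (by simp)
    have hab' : a ∉ S \ (D ∪ {u, v}) ∧ b ∉ S \ (D ∪ {u, v}) := by
      have h1 := fun h => hcl a h b hb hab
      have h2 := fun h => hcl b h a ha hab.symm
      simp only [Set.mem_sdiff, Set.mem_union, Set.mem_insert_iff, Set.mem_singleton_iff]
      tauto
    refine ⟨C, fun x hx => (hCD hx).1, ⟨c, hcC⟩, hu, hv, huv, hu', hv', fun x hx y hy hxy => ?_,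
      hCl, fun h => hab'.1 (hCD h), fun h => hab'.2 (hCD h), d, hDS hd, fun h => (hCD h).2 (Or.inl hd),
      fun h => huD (h ▸ hd), fun h => hvD (h ▸ hd)⟩
    by_cases hyD : y ∈ D ∪ {u, v}
    · rcases hyD with hyD | hyD
      · have := hcl y hyD x (hCD hx).1 hxy.symm
        exact absurd this (hCD hx).2
      · exact Or.inr hyD
    · exact Or.inl (hCc x hx y ⟨hy, hyD⟩ hxy)

/-- The predicate `P` splits `S \ D` at `x` into a part containing `u` and a part containing `v`.
The part `X` of `u` contains neither `a` nor `b`, so `D` can absorb it; the attachments of `D ∪ X`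
are `x` and `v`. -/
theorem Piece.enlarge (h : Piece G S a b D u v) (hc : Conn2 G S) (hdel : Conn2 (delEdge G a b) S)
    (ha : a ∈ S) (hb : b ∈ S) (hab : a ≠ b)
    (P : V → Prop) (hx : x ∈ S \ D) (hxu : x ≠ u) (hxv : x ≠ v)
    (hP : ∀ y ∈ (S \ D) \ {x}, ∀ z ∈ (S \ D) \ {x}, G.Adj y z → (P y ↔ P z))
    (hPu : P u) (hPv : ¬P v) (hPa : ¬P a ∨ a = x) (hPb : ¬P b ∨ b = x) :
    ∃ D', D ⊂ D' ∧ Piece G S a b D' x v := by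
  set X : Set V := {z | z ∈ (S \ D) \ {x} ∧ P z} with hX
  have huX : u ∈ X := ⟨⟨⟨h.hu, h.huD⟩, hxu.symm⟩, hPu⟩
  have hvX : v ∉ X := fun h' => hPv h'.2
  have hxX : x ∉ X := fun h' => h'.1.2 rfl
  have hvS : v ∈ (S \ D) \ {x} := ⟨⟨h.hv, h.hvD⟩, hxv.symm⟩
  have haX : a ∉ D ∪ X := by
    rintro (h' | h')
    · exact h.ha h'
    · rcases hPa with h'' | rfl
      exacts [h'' h'.2, hxX h']
  have hbX : b ∉ D ∪ X := by
    rintro (h' | h')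
    · exact h.hb h'
    · rcases hPb with h'' | rfl
      exacts [h'' h'.2, hxX h']
  have hXcl : ∀ y ∈ X, ∀ z ∈ S, G.Adj y z → z ∈ D ∪ X ∨ z = x := by
    intro y hy z hz hyz
    by_cases hzD : z ∈ D
    · exact Or.inl (Or.inl hzD)
    by_cases hzx : z = x
    · exact Or.inr hzx
    · exact Or.inl (Or.inr ⟨⟨⟨hz, hzD⟩, hzx⟩, (hP y hy.1 z ⟨⟨hz, hzD⟩, hzx⟩ hyz).1 hy.2⟩)
  refine ⟨D ∪ X, Set.ssubset_iff_exists.2 ⟨Set.subset_union_left, u, Or.inr huX, h.huD⟩,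
    Set.union_subset h.subset fun z hz => hz.1.1.1, h.nonempty.mono Set.subset_union_left, hx.1,
    h.hv, hxv, fun h' => h'.elim hx.2 hxX, fun h' => h'.elim h.hvD hvX, ?_, ?_, haX, hbX, ?_⟩
  · rintro y (hy | hy) z hz hyz
    · rcases h.closed y hy z hz hyz with h' | rfl | rfl
      exacts [Or.inl (Or.inl h'), Or.inl (Or.inr huX), Or.inr (Or.inr rfl)]
    · exact (hXcl y hy z hz hyz).imp_right Or.inl
  -- Vertices of `X` not joined to `D` would have neighbours only among themselves and `x`, which
  -- would make `x` a cut vertex of `S`.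
  · obtain ⟨d, hd⟩ := h.nonempty
    refine linked_of_root d (Or.inl hd) fun Q hQ hQd z hz => ?_
    have hQD : ∀ y ∈ D, Q y := fun y hy =>
      h.linked Q (fun a ha b hb => hQ a (Or.inl ha) b (Or.inl hb)) d hd y hy hQd
    rcases hz with hz | hz
    · exact hQD z hz
    by_contra hQz
    have := (hc.linked_diff x).subset_of_closed (x := z) (B := {z | z ∈ X ∧ ¬Q z})
      ⟨hz.1.1.1, hz.1.2⟩ ⟨hz, hQz⟩ ?_ ⟨h.subset hd, fun h' => hx.2 (h' ▸ hd)⟩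
    · exact this.1.1.1.2 hd
    · rintro y - z' ⟨hz', hz'x⟩ hyz ⟨hyX, hQy⟩
      have hz'' : z' ∈ D ∪ X := (hXcl y hyX z' hz' hyz).resolve_right hz'x
      have hQz' : ¬Q z' := fun h' => hQy (hQ z' hz'' y (Or.inr hyX) hyz.symm h')
      exact ⟨hz''.resolve_left fun h' => hQz' (hQD z' h'), hQz'⟩
  -- If nothing else remained outside `D ∪ X`, then `ab` would be the edge `xv`. Without this edge,
  -- removing `u` separates `D ∪ {v}` from `x`, although the deletion of `ab` is 2-connected.
  · by_contra! hcon
    have ha' : a = x ∨ a = v := by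
      by_contra! h'; exact h'.2 (hcon a ha haX h'.1)
    have hb' : b = x ∨ b = v := by
      by_contra! h'; exact h'.2 (hcon b hb hbX h'.1)
    have he : s(a, b) = s(x, v) := by
      rw [Sym2.eq_iff]
      rcases ha' with h1 | h1 <;> rcases hb' with h2 | h2
      exacts [(hab (h1.trans h2.symm)).elim, Or.inl ⟨h1, h2⟩, Or.inr ⟨h1, h2⟩,
        (hab (h1.trans h2.symm)).elim]
    have := (hdel.linked_diff u).subset_of_closed (x := v) (B := D ∪ {v})
      ⟨h.hv, h.huv.symm⟩ (Or.inr rfl) ?_ ⟨hx.1, hxu⟩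
    · exact this.elim hx.2 hxv
    · rintro y - z ⟨hz, hzu⟩ hyz hy
      rw [delEdge_adj, he] at hyz
      rcases hy with hy | rfl
      · rcases h.closed y hy z hz hyz.1 with h' | h' | h'
        exacts [Or.inl h', absurd h' hzu, Or.inr h']
      · by_cases hzD : z ∈ D
        · exact Or.inl hzD
        · have hzx : z ≠ x := by rintro rfl; exact hyz.2 Sym2.eq_swap
          have hPz : ¬P z := fun h' => hPv ((hP y hvS z ⟨⟨hz, hzD⟩, hzx⟩ hyz.1).2 h')
          exact Or.inr (hcon z hz (fun h' => h'.elim hzD fun h' => hPz h'.2) hzx)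

/-- The complement of a maximal piece is `2`-connected. -/
theorem Piece.conn2_compl [Finite V] (h : Piece G S a b D u v) (hc : Conn2 G S)
    (hdel : Conn2 (delEdge G a b) S) (ha : a ∈ S) (hb : b ∈ S) (hab : G.Adj a b)
    (hmax : ∀ D' u' v', Piece G S a b D' u' v' → D'.ncard ≤ D.ncard) : Conn2 G (S \ D) := by
  obtain ⟨hsep, hun⟩ := h.sep
  have hT : Conn2 (addEdge G u v) (S \ D) := hsep.conn2_right (by rwa [hun])
  refine ⟨hT.1, hT.linked_of_addEdge hsep.ne_of_right, fun x hx => ?_⟩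
  by_contra hcon
  have hmax' : ∀ D' u' v', Piece G S a b D' u' v' → ¬D ⊂ D' := fun D' u' v' h' hlt =>
    absurd (Set.ncard_lt_ncard hlt) (not_lt.2 (hmax D' u' v' h'))
  unfold Linked at hcon
  push Not at hcon
  obtain ⟨P, hP, y, hy, z, hz, hPy, hPz⟩ := hcon
  have hP' : ∀ y ∈ (S \ D) \ {x}, ∀ z ∈ (S \ D) \ {x}, G.Adj y z → (P y ↔ P z) :=
    fun y hy z hz hyz => ⟨hP y hy z hz hyz, hP z hz y hy hyz.symm⟩
  -- Adding the edge `uv` makes `S \ D` 2-connected, so a cut vertex `x` must separate `u` from `v`.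
  have hnot : u ∈ (S \ D) \ {x} ∧ v ∈ (S \ D) \ {x} ∧ ¬(P u ↔ P v) := by
    by_contra hn
    refine hPz (hT.linked_diff x P (fun p hp q hq hpq => ?_) y hy z hz hPy)
    rw [addEdge_adj, Sym2.eq_iff] at hpq
    rcases hpq with h' | ⟨⟨rfl, rfl⟩ | ⟨rfl, rfl⟩, -⟩
    · exact hP p hp q hq h'
    · tauto
    · tauto
  obtain ⟨⟨-, hux⟩, ⟨-, hvx⟩, hne⟩ := hnot
  have habP : a = x ∨ b = x ∨ (P a ↔ P b) := by
    by_cases h1 : a = x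
    · exact Or.inl h1
    by_cases h2 : b = x
    · exact Or.inr (Or.inl h2)
    · exact Or.inr (Or.inr (hP' a ⟨⟨ha, h.ha⟩, h1⟩ b ⟨⟨hb, h.hb⟩, h2⟩ hab))
  -- Apart from `x`, the ends of `ab` lie on one side of `P`. The opposite side contains exactly one
  -- of `u`, `v` and can be absorbed, which contradicts maximality.
  have hcase : ((¬P a ∨ a = x) ∧ (¬P b ∨ b = x)) ∨ ((¬¬P a ∨ a = x) ∧ (¬¬P b ∨ b = x)) := by
    clear hmax hmax'
    tauto
  have key : ∀ (Q : V → Prop) (u v : V), Piece G S a b D u v → x ≠ u → x ≠ v →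
      (∀ y ∈ (S \ D) \ {x}, ∀ z ∈ (S \ D) \ {x}, G.Adj y z → (Q y ↔ Q z)) → Q u → ¬Q v →
      (¬Q a ∨ a = x) → (¬Q b ∨ b = x) → False := by
    intro Q u v hp hxu hxv hQ hQu hQv hQa hQb
    obtain ⟨D', h1, h2⟩ := hp.enlarge hc hdel ha hb hab.ne Q hx hxu hxv hQ hQu hQv hQa hQb
    exact hmax' D' _ _ h2 h1
  have hP'' : ∀ y ∈ (S \ D) \ {x}, ∀ z ∈ (S \ D) \ {x}, G.Adj y z → (¬P y ↔ ¬P z) :=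
    fun y hy z hz hyz => not_congr (hP' y hy z hz hyz)
  have hux' := Ne.symm hux
  have hvx' := Ne.symm hvx
  by_cases hPu : P u
  · have hPv : ¬P v := fun h' => hne ⟨fun _ => h', fun _ => hPu⟩
    rcases hcase with ⟨h1, h2⟩ | ⟨h1, h2⟩
    · exact key P u v h hux' hvx' hP' hPu hPv h1 h2
    · exact key (fun z => ¬P z) v u h.symm hvx' hux' hP'' hPv (not_not.2 hPu) h1 h2
  · have hPv : P v := by_contra fun h' => hne ⟨fun h => absurd h hPu, fun h => absurd h h'⟩
    rcases hcase with ⟨h1, h2⟩ | ⟨h1, h2⟩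
    · exact key P v u h.symm hvx' hux' hP' hPv hPu h1 h2
    · exact key (fun z => ¬P z) u v h hux' hvx' hP'' hPu (not_not.2 hPv) h1 h2

/-- No edge can be both deleted and contracted. -/
theorem Relaxed.not_conn2_del [Finite V] (hδ : 2 < δ) (h : Relaxed δ G S w) (hc : Conn2 G S)
    (ha : a ∈ S) (hb : b ∈ S) (hab : G.Adj a b) (hne : (S \ {a, b}).Nonempty)
    (hl : Linked G (S \ {a, b})) : ¬Conn2 (delEdge G a b) S := by
  classical
  induction hn : S.ncard using Nat.strong_induction_on generalizing G S w with | _ n ih => ?_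
  subst hn
  intro hdel
  -- Descent: the side `S₁` containing `ab`, with `uv` given the weight `t`, is a smaller
  -- counterexample. The last hypothesis says that its total defect is zero.
  have step : ∀ (S₁ S₂ : Set V) (u v : V) (t : ℕ), Sep G S₁ S₂ u v → S₁ ∪ S₂ = S → a ∈ S₁ →
      b ∈ S₁ → s(a, b) ≠ s(u, v) → (t = 1 ∨ t = δ - 1) →
      defect δ G w S₁ - defect δ G w {u, v} + (δ - t) = 0 → False := by
    intro S₁ S₂ u v t hsep hun ha1 hb1 hne' ht hd
    subst hun
    have hw : ∀ x ∈ S₁, ∀ y ∈ S₁, G.Adj x y → s(x, y) ≠ s(u, v) →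
        Function.update w s(u, v) t s(x, y) = w s(x, y) := fun x _ y _ _ hxy =>
      Function.update_of_ne hxy _ _
    have h5 := defect_exchange (δ := δ) (G := G) (G' := addEdge G u v) (w := w)
      (w' := Function.update w s(u, v) t)
      hsep.mem_left.1 hsep.mem_left.2 hsep.ne (fun x y => addEdge_adj_iff) hw
    rw [defect_pair hsep.ne (addEdge_adj.2 (Or.inr ⟨rfl, hsep.ne⟩)), Function.update_self] at h5
    have hK := h.left hsep hc hw (by rwa [Function.update_self]) (by linarith)
    exact ih _ hsep.ncard_lt hK (hsep.conn2_left hc) ha1 hb1 (addEdge_adj.2 (Or.inl hab))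
      (sdiff_pair_nonempty hsep.mem_left.1 hsep.mem_left.2 hsep.ne hne') (hsep.linked_left hl) rfl
      ((hsep.conn2_delEdge hc ha1 hb1 hne' hab.ne).1 hdel)
  -- If every `S \ {v}` is 2-connected, all of them are good flats of defect 1. Counting edge ends
  -- gives `n (δ - 1) = 2 δ` for `n = |S|`, so `n ≤ 3`. But `a` has a neighbour `z` besides `b` and
  -- `c`, so `n ≥ 4`.
  by_cases hall : ∀ v ∈ S, Conn2 G (S \ {v})
  · obtain ⟨c, hcS, hcab⟩ := hne
    simp only [Set.mem_insert_iff, Set.mem_singleton_iff, not_or] at hcab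
    obtain ⟨z, hzS, hzc, hz⟩ := hdel.exists_adj_ne (y := c) ha hcab.1 ⟨b, hb, hab.ne', Ne.symm hcab.2⟩
    rw [delEdge_adj] at hz
    have hza : z ≠ a := hz.1.ne'
    have hzb : z ≠ b := by rintro rfl; exact hz.2 rfl
    have h3 : 3 ≤ (S \ {z}).ncard := three_le_ncard (u := a) (v := b) (x := c) ⟨ha, hza.symm⟩
      ⟨hb, hzb.symm⟩ ⟨hcS, hzc.symm⟩ hab.ne hcab.1 hcab.2
    have h4 : ∀ v ∈ S, (S \ {v}).ncard + 1 = S.ncard := fun v hv =>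
      Set.ncard_sdiff_singleton_add_one hv
    have h5 := sum_defect_sdiff (δ := δ) (w := w) (G := G) (S := S) (fun v hv => by
      have e : S \ (S \ {v}) = {v} := by
        rw [Set.sdiff_sdiff_right_self]; simpa using hv
      refine h.flat _ Set.sdiff_subset ?_ (hall v hv) ?_ ?_
      · have := h4 v hv
        have := h4 z hzS
        omega
      · rw [e]; exact Set.singleton_nonempty v
      · rw [e]; exact linked_of_subsingleton Set.subsingleton_singleton) h.total
    have h6 := h4 z hzS
    have h7 : (4 : ℤ) ≤ S.ncard := by omega
    have h8 : (3 : ℤ) ≤ δ := by omega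
    nlinarith
  push Not at hall
  obtain ⟨v, hv, hcv⟩ := hall
  -- The set `S \ {v}` is linked and nontrivial but not 2-connected, so it has a cut vertex `u`.
  have hpair : ∃ u ∈ S, u ≠ v ∧ ¬Linked G (S \ {u, v}) := by
    by_contra! hcon
    refine hcv ⟨?_, hc.linked_diff v, fun u hu => ?_⟩
    · obtain ⟨c, hcS, hcab⟩ := hne
      simp only [Set.mem_insert_iff, Set.mem_singleton_iff, not_or] at hcab
      by_cases hva : v = a
      · subst hva
        exact ⟨b, ⟨hb, hab.ne'⟩, c, ⟨hcS, hcab.1⟩, Ne.symm hcab.2⟩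
      by_cases hvb : v = b
      · subst hvb
        exact ⟨a, ⟨ha, hab.ne⟩, c, ⟨hcS, hcab.2⟩, Ne.symm hcab.1⟩
      · exact ⟨a, ⟨ha, Ne.symm hva⟩, b, ⟨hb, Ne.symm hvb⟩, hab.ne⟩
    · have := hcon u hu.1 hu.2
      rwa [show (S \ {v}) \ {u} = S \ {u, v} by
        rw [sdiff_sdiff]; congr 1; exact Set.pair_comm v u]
  obtain ⟨u, hu, huv, hnl⟩ := hpair
  obtain ⟨D₀, hD₀⟩ := exists_piece hu hv huv ha hb hab hnl
  -- If the attachments of some piece are adjacent, their edge keeps the complement of a component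
  -- 2-connected. If no attachments are adjacent, a largest piece is needed to obtain a 2-connected
  -- complement.
  by_cases hadj : ∃ D u v, Piece G S a b D u v ∧ G.Adj u v
  · obtain ⟨D, u, v, hD, huv⟩ := hadj
    have hne' := hD.ne hl
    have hx : ∃ x, (x = a ∨ x = b) ∧ x ≠ u ∧ x ≠ v := by
      by_contra! hcon
      have h1 := hcon a (Or.inl rfl)
      have h2 := hcon b (Or.inr rfl)
      have := hab.ne
      apply hne'
      rw [Sym2.eq_iff]
      grind
    obtain ⟨x, hxab, hxu, hxv⟩ := hx
    have hxS : x ∈ S \ {u, v} := ⟨by rcases hxab with rfl | rfl <;> assumption, by simp [*]⟩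
    obtain ⟨C, hCS, hxC, hCl, hCc⟩ := exists_component (G := G) hxS
    have hCD : ∀ z ∈ C, z ∉ D := by
      have hxD : x ∉ D := by rcases hxab with rfl | rfl; exacts [hD.ha, hD.hb]
      refine hCl.subset_of_closed (B := Dᶜ) hxC hxD fun y hy z hz hyz hyD hzD => ?_
      rcases hD.closed z hzD y (hCS hy).1 hyz.symm with h' | h'
      · exact hyD h'
      · exact (hCS hy).2 h'
    have huC : u ∉ C := fun h' => (hCS h').2 (by simp)
    have hvC : v ∉ C := fun h' => (hCS h').2 (by simp)
    obtain ⟨d, hd⟩ := hD.nonempty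
    have hcl : ∀ y ∈ C, ∀ z ∈ S, G.Adj y z → z ∈ C ∨ z = u ∨ z = v := fun y hy z hz hyz => by
      by_cases hz' : z = u ∨ z = v
      · exact Or.inr hz'
      · exact Or.inl (hCc y hy z ⟨hz, hz'⟩ hyz)
    obtain ⟨hsep, hun⟩ := Sep.of_closed (D := C) (S := S) (u := u) (v := v) (G := G)
      (fun z hz => (hCS hz).1) ⟨x, hxC⟩ hD.hu hD.hv huC hvC hD.huv
      ⟨d, hD.subset hd, fun h' => hCD d h' hd, fun h' => hD.huD (h' ▸ hd),
        fun h' => hD.hvD (h' ▸ hd)⟩ hcl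
    have hR : Conn2 G (S \ C) := by
      have := hsep.conn2_right (by rwa [hun])
      rwa [addEdge_eq_self huv] at this
    have e : S \ (S \ C) = C := by
      rw [Set.sdiff_sdiff_right_self]; exact Set.inter_eq_right.2 fun z hz => (hCS hz).1
    have h1 := h.flat (S \ C) Set.sdiff_subset hsep.symm.three_le_left hR (by rw [e]; exact ⟨x, hxC⟩)
      (by rwa [e])
    have h2 := hsep.defect_union (δ := δ) (w := w)
    rw [hun, h.total, h1] at h2
    have hab1 : a ∈ C ∪ {u, v} ∧ b ∈ C ∪ {u, v} := by
      rcases hxab with rfl | rfl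
      · exact ⟨Or.inl hxC, hcl x hxC b hb hab⟩
      · exact ⟨hcl x hxC a ha hab.symm, Or.inl hxC⟩
    -- As `S \ C` has defect 1, the set `C ∪ {u, v}` has defect one less than the pair `{u, v}`.
    -- Weight `δ - 1` on `uv` restores the total 0.
    refine step _ _ u v (δ - 1) hsep hun hab1.1 hab1.2 hne' (Or.inr rfl) ?_
    rw [Nat.cast_sub (by omega)]
    push_cast
    linarith
  · push Not at hadj
    have hfin : {t : Set V × V × V | Piece G S a b t.1 t.2.1 t.2.2}.Finite := Set.toFinite _
    -- The maximum runs over the attachments as well, since enlarging a piece changes one of them.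
    obtain ⟨⟨D, u, v⟩, hD, hmax⟩ := Set.exists_max_image _ (fun t => t.1.ncard) hfin
      ⟨(D₀, u, v), hD₀⟩
    replace hD : Piece G S a b D u v := hD
    have hR := hD.conn2_compl hc hdel ha hb hab fun D' u' v' h' => hmax (D', u', v') h'
    obtain ⟨hsep, hun⟩ := hD.sep
    have e : S \ (S \ D) = D := by
      rw [Set.sdiff_sdiff_right_self]; exact Set.inter_eq_right.2 hD.subset
    have h1 := h.flat (S \ D) Set.sdiff_subset hsep.symm.three_le_left hR
      (by rw [e]; exact hD.nonempty) (by rw [e]; exact hD.linked)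
    -- The set `S \ D` has defect 1 and the nonadjacent pair has defect `δ`. A new edge `uv` of
    -- weight 1 gives the total `1 - δ + (δ - 1) = 0`.
    refine step _ _ u v 1 hsep.symm (by rwa [Set.union_comm]) ⟨ha, hD.ha⟩ ⟨hb, hD.hb⟩ (hD.ne hl)
      (Or.inl rfl) ?_
    rw [h1, defect_pair_of_not_adj hD.huv (hadj D u v hD)]
    push_cast
    ring

end Relaxed

/-! ### The canonical weight and its equalities -/

open Classical in
/-- The only possible weight function of the `2`-connected graph `G[S]` on at least three
vertices. -/
noncomputable def canonicalWeight {V : Type u} (δ : ℕ) (G : SimpleGraph V) (S : Set V)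
    (e : Sym2 V) : ℕ :=
  if Conn2 (G.deleteEdges {e}) S then 1 else δ - 1

/-- The equalities `(♠)_δ` for the graph `G[S]`. -/
structure SpadeOn {V : Type u} (δ : ℕ) (G : SimpleGraph V) (S : Set V) : Prop where
  relaxed : Relaxed δ G S (canonicalWeight δ G S)
  contr : ∀ x ∈ S, ∀ y ∈ S, G.Adj x y → (S \ {x, y}).Nonempty → Linked G (S \ {x, y}) →
    ¬Conn2 (delEdge G x y) S

section SpadeOn

variable {V : Type u} {δ : ℕ} {G G' : SimpleGraph V} {w w' : Sym2 V → ℕ} {S T S₁ S₂ D : Set V}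
  {u v x y a b : V}

theorem canonicalWeight_of_conn2 (h : Conn2 (delEdge G x y) S) :
    canonicalWeight δ G S s(x, y) = 1 := if_pos h

theorem canonicalWeight_of_not_conn2 (h : ¬Conn2 (delEdge G x y) S) :
    canonicalWeight δ G S s(x, y) = δ - 1 := if_neg h

theorem canonicalWeight_eq_one_iff (hδ : 2 < δ) :
    canonicalWeight δ G S s(x, y) = 1 ↔ Conn2 (delEdge G x y) S := by
  refine ⟨fun h => by_contra fun h' => ?_, canonicalWeight_of_conn2⟩
  rw [canonicalWeight_of_not_conn2 h'] at h
  omega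

theorem canonicalWeight_range (e : Sym2 V) :
    canonicalWeight δ G S e = 1 ∨ canonicalWeight δ G S e = δ - 1 := by
  unfold canonicalWeight
  split_ifs <;> simp

theorem canonicalWeight_congr {W : Type u} {H : SimpleGraph W} {T : Set W} {x' y' : W}
    (h : Conn2 (delEdge G x y) S ↔ Conn2 (delEdge H x' y') T) :
    canonicalWeight δ G S s(x, y) = canonicalWeight δ H T s(x', y') := by
  by_cases h' : Conn2 (delEdge G x y) S
  · rw [canonicalWeight_of_conn2 h', canonicalWeight_of_conn2 (h.1 h')]
  · rw [canonicalWeight_of_not_conn2 h', canonicalWeight_of_not_conn2 (mt h.2 h')]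

theorem Relaxed.congr (h : Relaxed δ G S w)
    (hw : ∀ x ∈ S, ∀ y ∈ S, G.Adj x y → w s(x, y) = w' s(x, y)) : Relaxed δ G S w' where
  range x hx y hy hxy := by rw [← hw x hx y hy hxy]; exact h.range x hx y hy hxy
  total := by rw [← h.total]; exact (defect_congr (fun _ _ _ _ => Iff.rfl) hw).symm
  flat T hT h3 hc hne hl := by
    rw [← h.flat T hT h3 hc hne hl]
    exact (defect_congr (fun _ _ _ _ => Iff.rfl)
      fun x hx y hy => hw x (hT hx) y (hT hy)).symm

theorem Conn2.adj_of_pair (h : Conn2 G {u, v}) (huv : u ≠ v) : G.Adj u v := by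
  by_contra hcon
  refine huv (h.2.1.subset_of_closed (x := u) (B := {u}) (by simp) rfl ?_
    (by simp : v ∈ ({u, v} : Set V))).symm
  rintro y - z hz hyz (rfl : y = u)
  rcases hz with rfl | rfl
  · exact rfl
  · exact absurd hyz hcon

/-- A good flat with two vertices is a contractible edge. By `contr` it is not deletable, so its
weight is `δ - 1` and its defect is 1 automatically. -/
theorem SpadeOn.defect_eq_one [Finite V] (hδ : 2 < δ) (h : SpadeOn δ G S) (hT : T ⊆ S)
    (hc : Conn2 G T) (hne : (S \ T).Nonempty) (hl : Linked G (S \ T)) :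
    defect δ G (canonicalWeight δ G S) T = 1 := by
  by_cases h3 : 3 ≤ T.ncard
  · exact h.relaxed.flat T hT h3 hc hne hl
  have h2 : 1 < T.ncard := (Set.one_lt_ncard_iff_nontrivial).2 hc.1
  obtain ⟨u, v, huv, rfl⟩ := Set.ncard_eq_two.1 (by omega : T.ncard = 2)
  have hadj := hc.adj_of_pair huv
  rw [defect_pair huv hadj, canonicalWeight_of_not_conn2
    (h.contr u (hT (by simp)) v (hT (by simp)) hadj hne hl)]
  omega

/-- A single edge has defect `δ - 1` or `1`, never 0. -/
theorem SpadeOn.three_le [Finite V] (hδ : 2 < δ) (h : SpadeOn δ G S) (hc : Conn2 G S) :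
    3 ≤ S.ncard := by
  by_contra h3
  have h2 : 1 < S.ncard := (Set.one_lt_ncard_iff_nontrivial).2 hc.1
  obtain ⟨u, v, huv, rfl⟩ := Set.ncard_eq_two.1 (by omega : S.ncard = 2)
  have h0 := h.relaxed.total
  rw [defect_pair huv (hc.adj_of_pair huv)] at h0
  rcases canonicalWeight_range (δ := δ) (G := G) (S := {u, v}) s(u, v) with h' | h' <;> omega

/-! ### Transfer along induced embeddings -/

theorem exists_image_of_subset {W : Type u} {f : W → V} {A : Set W} {T : Set V} (hT : T ⊆ f '' A) :
    ∃ T' ⊆ A, T = f '' T' := by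
  obtain ⟨T', h1, h2⟩ := Set.subset_image_iff.1 hT
  exact ⟨T', h1, h2.symm⟩

theorem relaxed_image {W : Type u} {H : SimpleGraph W} (f : H ↪g G) {A : Set W} :
    Relaxed δ G (f '' A) w ↔ Relaxed δ H A (w ∘ Sym2.map f) := by
  constructor
  · intro h
    refine ⟨fun x hx y hy hxy => h.range _ ⟨x, hx, rfl⟩ _ ⟨y, hy, rfl⟩ (f.map_adj_iff.2 hxy), ?_,
      fun T hT h3 hc hne hl => ?_⟩
    · rw [← defect_image]; exact h.total
    · rw [← defect_image]
      refine h.flat _ (Set.image_mono hT) ?_ ((conn2_image f).2 hc) ?_ ?_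
      · rwa [Set.ncard_image_of_injective _ f.injective]
      · rw [← Set.image_sdiff f.injective]; exact hne.image f
      · rw [← Set.image_sdiff f.injective, linked_image f]; exact hl
  · intro h
    refine ⟨?_, ?_, fun T hT h3 hc hne hl => ?_⟩
    · rintro _ ⟨x, hx, rfl⟩ _ ⟨y, hy, rfl⟩ hxy
      exact h.range x hx y hy (f.map_adj_iff.1 hxy)
    · rw [defect_image]; exact h.total
    · obtain ⟨T, hTA, rfl⟩ := exists_image_of_subset hT
      rw [defect_image]
      rw [← Set.image_sdiff f.injective] at hne hl
      refine h.flat T hTA ?_ ((conn2_image f).1 hc) hne.of_image ((linked_image f).1 hl)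
      rwa [Set.ncard_image_of_injective _ f.injective] at h3

/-- The embedding between the graphs with an edge deleted. -/
def delEdgeEmbedding {W : Type u} {H : SimpleGraph W} (f : H ↪g G) (x y : W) :
    delEdge H x y ↪g delEdge G (f x) (f y) where
  toEmbedding := f.toEmbedding
  map_rel_iff' := by
    intro a b
    change (delEdge G (f x) (f y)).Adj (f a) (f b) ↔ _
    rw [delEdge_adj, delEdge_adj, f.map_adj_iff, ← Sym2.map_mk, ← Sym2.map_mk,
      (Sym2.map.injective f.injective).ne_iff]

theorem conn2_delEdge_image {W : Type u} {H : SimpleGraph W} (f : H ↪g G) {A : Set W} (x y : W) :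
    Conn2 (delEdge G (f x) (f y)) (f '' A) ↔ Conn2 (delEdge H x y) A :=
  conn2_image (delEdgeEmbedding f x y)

theorem canonicalWeight_image {W : Type u} {H : SimpleGraph W} (f : H ↪g G) {A : Set W}
    (x y : W) : canonicalWeight δ G (f '' A) s(f x, f y) = canonicalWeight δ H A s(x, y) :=
  canonicalWeight_congr (conn2_delEdge_image f x y)

theorem spadeOn_image {W : Type u} {H : SimpleGraph W} (f : H ↪g G) {A : Set W} :
    SpadeOn δ G (f '' A) ↔ SpadeOn δ H A := by
  have key : ∀ x ∈ A, ∀ y ∈ A, H.Adj x y →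
      (canonicalWeight δ G (f '' A) ∘ Sym2.map f) s(x, y) = canonicalWeight δ H A s(x, y) :=
    fun x _ y _ _ => canonicalWeight_image f x y
  have himg : ∀ x y : W, f '' A \ {f x, f y} = f '' (A \ {x, y}) := fun x y => by
    rw [Set.image_sdiff f.injective, Set.image_pair]
  constructor
  · intro h
    refine ⟨((relaxed_image f).1 h.relaxed).congr key, fun x hx y hy hxy hne hl => ?_⟩
    rw [← conn2_delEdge_image f]
    refine h.contr _ ⟨x, hx, rfl⟩ _ ⟨y, hy, rfl⟩ (f.map_adj_iff.2 hxy) ?_ ?_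
    · rw [himg]; exact hne.image f
    · rw [himg, linked_image f]; exact hl
  · intro h
    refine ⟨(relaxed_image f).2 (h.relaxed.congr fun x hx y hy hxy => (key x hx y hy hxy).symm), ?_⟩
    rintro _ ⟨x, hx, rfl⟩ _ ⟨y, hy, rfl⟩ hxy hne hl
    rw [himg] at hne hl
    rw [conn2_delEdge_image f]
    exact h.contr x hx y hy (f.map_adj_iff.1 hxy) hne.of_image ((linked_image f).1 hl)

theorem image_induce_univ : (SimpleGraph.Embedding.induce (G := G) S) '' Set.univ = S := by
  rw [Set.image_univ]
  exact Subtype.range_coe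

theorem spadeOn_induce : SpadeOn δ (G.induce S) Set.univ ↔ SpadeOn δ G S := by
  rw [← spadeOn_image (SimpleGraph.Embedding.induce S), image_induce_univ]

theorem conn2_induce : Conn2 (G.induce S) Set.univ ↔ Conn2 G S := by
  rw [← conn2_image (SimpleGraph.Embedding.induce S), image_induce_univ]

theorem canonicalWeight_induce (x y : S) :
    canonicalWeight δ (G.induce S) Set.univ s(x, y) = canonicalWeight δ G S s(x.1, y.1) := by
  rw [← canonicalWeight_image (SimpleGraph.Embedding.induce S), image_induce_univ]
  rfl

/-! ### Comparison with weight functions -/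

theorem twoConnected_contract_pair (hc : Conn2 G Set.univ) :
    TwoConnected (contract G {z | z ∈ s(x, y)}) ↔
      (Set.univ \ {x, y}).Nonempty ∧ Linked G (Set.univ \ {x, y}) := by
  have e : {z | z ∈ s(x, y)} = ({x, y} : Set V) := by ext z; simp
  rw [e, twoConnected_contract hc ⟨x, by simp⟩, Set.compl_eq_univ_sdiff]

theorem nonempty_sdiff_pair [Finite V] (h3 : 3 ≤ S.ncard) : (S \ {x, y}).Nonempty := by
  obtain ⟨c, hc, h1, h2⟩ := exists_ne_ne_of_ncard h3 x y
  exact ⟨c, hc, by simp [h1, h2]⟩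

/-- If the deletion of an edge is not 2-connected, its ends do not separate, so its contraction is
2-connected. One of the two conditions on a weight function therefore always applies. -/
theorem IsWeight.eq_canonicalWeight [Finite V] (hc : Conn2 G Set.univ)
    (h3 : 3 ≤ (Set.univ : Set V).ncard) (hw : IsWeight δ G w) (hxy : G.Adj x y) :
    w s(x, y) = canonicalWeight δ G Set.univ s(x, y) := by
  by_cases h : Conn2 (delEdge G x y) Set.univ
  · rw [canonicalWeight_of_conn2 h, hw.deletion s(x, y) hxy (twoConnected_iff.2 h)]
  · rw [canonicalWeight_of_not_conn2 h, hw.contraction s(x, y) hxy]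
    refine (twoConnected_contract_pair hc).2 ⟨nonempty_sdiff_pair h3, ?_⟩
    by_contra hl
    exact h (hc.del_of_not_linked trivial trivial hxy.ne hl)

theorem SpadeOn.isWeight [Finite V] (hc : Conn2 G Set.univ) (h : SpadeOn δ G Set.univ) :
    IsWeight δ G (canonicalWeight δ G Set.univ) where
  range e _ := canonicalWeight_range e
  deletion e _ h := if_pos (twoConnected_iff.1 h)
  contraction e he hcon := by
    induction e with | _ x y => ?_
    rw [twoConnected_contract_pair hc] at hcon
    exact canonicalWeight_of_not_conn2 (h.contr x trivial y trivial he hcon.1 hcon.2)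

theorem spade_iff [Finite V] (hδ : 2 < δ) (hc : Conn2 G Set.univ) :
    Spade δ G ↔ SpadeOn δ G Set.univ := by
  have htot : ∀ w, (∑ᶠ e ∈ G.edgeSet, w e) = δ * (Nat.card V - 1) ↔
      defect δ G w Set.univ = 0 := by
    intro w
    have h1 : 1 ≤ Nat.card V := by
      rw [← Set.ncard_univ]; exact (Set.ncard_pos).2 hc.1.nonempty
    unfold defect
    rw [edgesIn_univ, Set.ncard_univ, sub_eq_zero]
    zify [h1]
    exact eq_comm
  have hflat : ∀ w, ∀ T : Set V, T.Nonempty →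
      ((∑ᶠ e ∈ edgesIn G T, w e) + 1 = δ * (T.ncard - 1) ↔ defect δ G w T = 1) := by
    intro w T hT
    have h1 : 1 ≤ T.ncard := (Set.ncard_pos).2 hT
    unfold defect
    rw [sub_eq_iff_eq_add']
    zify [h1]
    exact eq_comm
  have hgood : ∀ T, IsGoodFlat G T ↔
      Conn2 G T ∧ (Set.univ \ T).Nonempty ∧ Linked G (Set.univ \ T) := by
    intro T
    unfold IsGoodFlat
    rw [twoConnected_induce]
    refine and_congr_right fun hT => ?_
    rw [twoConnected_contract hc hT.1.nonempty, Set.compl_eq_univ_sdiff]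
  constructor
  · rintro ⟨w, hw, h0, h1⟩
    rw [htot] at h0
    -- A single edge is excluded because its defect is positive for both admissible weights.
    have h3 : 3 ≤ (Set.univ : Set V).ncard := by
      by_contra h3
      have h2 : 1 < (Set.univ : Set V).ncard := (Set.one_lt_ncard_iff_nontrivial).2 hc.1
      obtain ⟨u, v, huv, he⟩ := Set.ncard_eq_two.1 (by omega : (Set.univ : Set V).ncard = 2)
      rw [he] at hc h0
      have hadj := hc.adj_of_pair huv
      rw [defect_pair huv hadj] at h0
      rcases hw.range s(u, v) hadj with h' | h' <;> omega
    refine ⟨Relaxed.congr (w := w) ⟨fun x _ y _ hxy => hw.range _ hxy, h0,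
      fun T _ _ hT hne hl => ?_⟩ fun x _ y _ hxy => hw.eq_canonicalWeight hc h3 hxy,
      fun x _ y _ hxy hne hl hdel => ?_⟩
    · exact (hflat w T hT.1.nonempty).1 (h1 T ((hgood T).2 ⟨hT, hne, hl⟩))
    · have k1 := hw.deletion s(x, y) hxy (twoConnected_iff.2 hdel)
      have k2 := hw.contraction s(x, y) hxy ((twoConnected_contract_pair hc).2 ⟨hne, hl⟩)
      omega
  · intro h
    refine ⟨_, h.isWeight hc, (htot _).2 h.relaxed.total, fun T hT => ?_⟩
    obtain ⟨h1, h2, h3⟩ := (hgood T).1 hT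
    exact (hflat _ T h1.1.nonempty).2 (h.defect_eq_one hδ (Set.subset_univ T) h1 h2 h3)

/-! ### One side of a separation -/

theorem delEdge_addEdge_self : delEdge (addEdge G u v) u v = delEdge G u v := by
  ext a b
  rw [delEdge_adj, delEdge_adj, addEdge_adj]
  tauto

theorem Sep.canonicalWeight_left (hsep : Sep G S₁ S₂ u v) (hc : Conn2 G (S₁ ∪ S₂)) (hx : x ∈ S₁)
    (hy : y ∈ S₁) (hxy : x ≠ y) (hne : s(x, y) ≠ s(u, v)) :
    canonicalWeight δ (addEdge G u v) S₁ s(x, y) = canonicalWeight δ G (S₁ ∪ S₂) s(x, y) :=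
  canonicalWeight_congr (hsep.conn2_delEdge hc hx hy hne hxy).symm

/-- The weight `t` balances the total by `h0`; it has to be shown that it is the canonical weight of
`uv`. By `Relaxed.not_conn2_del` the edge `uv` is not both deletable and contractible, so the
alternative granted by `ht` decides its weight. All other edges keep their behaviour when passing to
the side. -/
theorem SpadeOn.left [Finite V] (hδ : 2 < δ) (h : SpadeOn δ G (S₁ ∪ S₂)) (hsep : Sep G S₁ S₂ u v)
    (hc : Conn2 G (S₁ ∪ S₂)) {t : ℕ}
    (ht : (t = 1 ∧ Conn2 (delEdge G u v) S₁) ∨ (t = δ - 1 ∧ Linked G (S₁ \ {u, v})))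
    (h0 : defect δ G (canonicalWeight δ G (S₁ ∪ S₂)) S₁ -
      defect δ G (canonicalWeight δ G (S₁ ∪ S₂)) {u, v} + (δ - t) = 0) :
    SpadeOn δ (addEdge G u v) S₁ ∧ canonicalWeight δ (addEdge G u v) S₁ s(u, v) = t := by
  classical
  set w := canonicalWeight δ G (S₁ ∪ S₂)
  have hK := hsep.conn2_left hc
  have huv : (addEdge G u v).Adj u v := addEdge_adj.2 (Or.inr ⟨rfl, hsep.ne⟩)
  have hw : ∀ x ∈ S₁, ∀ y ∈ S₁, G.Adj x y → s(x, y) ≠ s(u, v) →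
      Function.update w s(u, v) t s(x, y) = w s(x, y) := fun x _ y _ _ hxy =>
    Function.update_of_ne hxy _ _
  have h5 := defect_exchange (δ := δ) (G := G) (G' := addEdge G u v) (w := w)
    (w' := Function.update w s(u, v) t)
    hsep.mem_left.1 hsep.mem_left.2 hsep.ne (fun x y => addEdge_adj_iff) hw
  rw [defect_pair hsep.ne huv, Function.update_self] at h5
  have hR := h.relaxed.left hsep hc hw (by rw [Function.update_self]; tauto) (by linarith)
  have hnot : (S₁ \ {u, v}).Nonempty → Linked (addEdge G u v) (S₁ \ {u, v}) →
      ¬Conn2 (delEdge (addEdge G u v) u v) S₁ :=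
    hR.not_conn2_del hδ hK hsep.mem_left.1 hsep.mem_left.2 huv
  have hcw : canonicalWeight δ (addEdge G u v) S₁ s(u, v) = t := by
    rcases ht with ⟨rfl, ht⟩ | ⟨rfl, ht⟩
    · exact canonicalWeight_of_conn2 (by rwa [delEdge_addEdge_self])
    · exact canonicalWeight_of_not_conn2
        (hnot (nonempty_sdiff_pair hsep.three_le_left) ht.add_edge)
  have hw' : ∀ x ∈ S₁, ∀ y ∈ S₁, (addEdge G u v).Adj x y →
      Function.update w s(u, v) t s(x, y) = canonicalWeight δ (addEdge G u v) S₁ s(x, y) := by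
    intro x hx y hy hxy
    by_cases he : s(x, y) = s(u, v)
    · rw [he, Function.update_self, hcw]
    · rw [Function.update_of_ne he, hsep.canonicalWeight_left hc hx hy hxy.ne he]
  refine ⟨⟨hR.congr hw', fun x hx y hy hxy hne hl => ?_⟩, hcw⟩
  by_cases he : s(x, y) = s(u, v)
  · have e : ({x, y} : Set V) = {u, v} := by
      rw [Sym2.eq_iff] at he
      rcases he with ⟨rfl, rfl⟩ | ⟨rfl, rfl⟩
      exacts [rfl, Set.pair_comm _ _]
    rw [e] at hne hl
    rw [show delEdge (addEdge G u v) x y = delEdge (addEdge G u v) u v by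
      unfold delEdge; rw [he]]
    exact hnot hne hl
  · rw [← hsep.conn2_delEdge hc hx hy he hxy.ne]
    exact h.contr x (Or.inl hx) y (Or.inl hy) ((addEdge_adj_iff he).1 hxy)
      (hne.mono (Set.sdiff_subset_sdiff_left Set.subset_union_left))
      ((hsep.linked_sdiff_pair hc hx hy he).2 hl)

end SpadeOn

/-! ### Ears -/

/-- A path `p 0, …, p k` with at least two edges that meets `S` in its ends only. -/
structure IsEar {V : Type u} (G : SimpleGraph V) (S : Set V) (k : ℕ) (p : ℕ → V) : Prop where
  inj : ∀ i ≤ k, ∀ j ≤ k, p i = p j → i = j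
  two_le : 2 ≤ k
  first : p 0 ∈ S
  last : p k ∈ S
  inner : ∀ i, 0 < i → i < k → p i ∉ S
  adj : ∀ i < k, G.Adj (p i) (p (i + 1))

/-- An ear such that `G` has no further vertices and edges. -/
structure IsFullEar {V : Type u} (G : SimpleGraph V) (S : Set V) (k : ℕ) (p : ℕ → V) : Prop
    extends IsEar G S k p where
  cover : ∀ z, z ∈ S ∨ ∃ i ≤ k, p i = z
  edges : ∀ x y, G.Adj x y → (x ∈ S ∧ y ∈ S) ∨ ∃ i < k, s(x, y) = s(p i, p (i + 1))

/-- The vertices `p i, …, p j`. -/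
def seg {V : Type u} (p : ℕ → V) (i j : ℕ) : Set V := {z | ∃ m, i ≤ m ∧ m ≤ j ∧ p m = z}

section Ears

variable {V : Type u} {δ : ℕ} {G G' : SimpleGraph V} {w : Sym2 V → ℕ} {S T : Set V}
  {u v x y : V} {k : ℕ} {p : ℕ → V}

theorem mem_seg {i j m : ℕ} (h1 : i ≤ m) (h2 : m ≤ j) : p m ∈ seg p i j := ⟨m, h1, h2, rfl⟩

theorem linked_seg {i j : ℕ} (h : ∀ m, i ≤ m → m < j → G.Adj (p m) (p (m + 1))) :
    Linked G (seg p i j) := by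
  by_cases hij : i ≤ j
  · refine linked_of_root (p i) (mem_seg le_rfl hij) fun P hP hPi y hy => ?_
    obtain ⟨m, him, hmj, rfl⟩ := hy
    induction m, him using Nat.le_induction with
    | base => exact hPi
    | succ m him ih =>
      exact hP _ (mem_seg him (by omega)) _ (mem_seg (by omega) hmj) (h m him (by omega))
        (ih (by omega))
  · refine linked_of_subsingleton fun x hx => ?_
    obtain ⟨m, h1, h2, -⟩ := hx
    omega

theorem IsEar.ends_ne (h : IsEar G S k p) : p 0 ≠ p k := fun he => by
  have := h.inj 0 (by omega) k le_rfl he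
  have := h.two_le
  omega

/-- The path together with the edge between its ends is a cycle. After removal of an inner vertex,
that edge joins the two remaining segments. -/
theorem IsEar.conn2_seg (h : IsEar G S k p) : Conn2 (addEdge G (p 0) (p k)) (seg p 0 k) := by
  have hk := h.two_le
  have hadj : (addEdge G (p 0) (p k)).Adj (p 0) (p k) := addEdge_adj.2 (Or.inr ⟨rfl, h.ends_ne⟩)
  have hl : ∀ i j, j ≤ k → Linked (addEdge G (p 0) (p k)) (seg p i j) := fun i j hj =>
    (linked_seg fun m _ hm => h.adj m (by omega)).add_edge
  refine ⟨⟨_, mem_seg le_rfl (Nat.zero_le k), _, mem_seg (Nat.zero_le k) le_rfl, h.ends_ne⟩,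
    hl 0 k le_rfl, ?_⟩
  rintro _ ⟨j, -, hj, rfl⟩
  have hsub : seg p 0 k \ {p j} = {z | ∃ m ≤ k, m ≠ j ∧ p m = z} := by
    ext z
    simp only [seg, Set.mem_sdiff, Set.mem_ofPred_eq, Set.mem_singleton_iff]
    constructor
    · rintro ⟨⟨m, -, hm, rfl⟩, hne⟩
      exact ⟨m, hm, fun h' => hne (h' ▸ rfl), rfl⟩
    · rintro ⟨m, hm, hmj, rfl⟩
      exact ⟨⟨m, Nat.zero_le m, hm, rfl⟩, fun h' => hmj (h.inj m hm j hj h')⟩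
  rw [hsub]
  rcases Nat.eq_zero_or_pos j with rfl | hj0
  · convert hl 1 k le_rfl using 1
    ext z
    simp only [seg, Set.mem_ofPred_eq]
    constructor
    · rintro ⟨m, h1, h2, rfl⟩; exact ⟨m, by omega, h1, rfl⟩
    · rintro ⟨m, h1, h2, rfl⟩; exact ⟨m, h2, by omega, rfl⟩
  rcases hj.eq_or_lt with rfl | hjk
  · convert hl 0 (j - 1) (by omega) using 1
    ext z
    simp only [seg, Set.mem_ofPred_eq]
    constructor
    · rintro ⟨m, h1, h2, rfl⟩; exact ⟨m, by omega, by omega, rfl⟩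
    · rintro ⟨m, h1, h2, rfl⟩; exact ⟨m, by omega, by omega, rfl⟩
  · convert (hl 0 (j - 1) (by omega)).union_adj (hl (j + 1) k le_rfl) (mem_seg le_rfl (by omega))
      (mem_seg (by omega) le_rfl) hadj using 1
    ext z
    simp only [seg, Set.mem_union, Set.mem_ofPred_eq]
    constructor
    · rintro ⟨m, h1, h2, rfl⟩
      rcases lt_or_gt_of_ne h2 with h2 | h2
      · exact Or.inl ⟨m, by omega, by omega, rfl⟩
      · exact Or.inr ⟨m, by omega, by omega, rfl⟩
    · rintro (⟨m, h1, h2, rfl⟩ | ⟨m, h1, h2, rfl⟩)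
      exacts [⟨m, by omega, by omega, rfl⟩, ⟨m, by omega, by omega, rfl⟩]

theorem IsEar.inter_seg (h : IsEar G S k p) : S ∩ seg p 0 k = {p 0, p k} := by
  apply Set.Subset.antisymm
  · rintro _ ⟨hS, m, -, hm, rfl⟩
    rcases Nat.eq_zero_or_pos m with rfl | h0
    · exact Or.inl rfl
    rcases hm.eq_or_lt with rfl | h1
    · exact Or.inr rfl
    · exact absurd hS (h.inner m h0 h1)
  · rintro x (rfl | rfl)
    exacts [⟨h.first, mem_seg le_rfl (Nat.zero_le k)⟩, ⟨h.last, mem_seg (Nat.zero_le k) le_rfl⟩]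

theorem IsEar.conn2_union (h : IsEar G S k p) (hS : Conn2 (addEdge G (p 0) (p k)) S)
    (hl : Linked G S) : Conn2 G (S ∪ seg p 0 k) :=
  GraphicGorenstein.conn2_union h.inter_seg h.ends_ne hS h.conn2_seg hl
    (linked_seg fun m _ hm => h.adj m hm)

theorem IsFullEar.union_seg (h : IsFullEar G S k p) : S ∪ seg p 0 k = Set.univ := by
  refine Set.eq_univ_of_forall fun z => ?_
  rcases h.cover z with h' | ⟨i, hi, rfl⟩
  exacts [Or.inl h', Or.inr (mem_seg (Nat.zero_le i) hi)]

theorem IsEar.notMem_of_seg (h : IsEar G S k p) {z : V} (hz : z ∈ seg p 1 (k - 1)) : z ∉ S := by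
  obtain ⟨m, h1, h2, rfl⟩ := hz
  have := h.two_le
  exact h.inner m (by omega) (by omega)

theorem IsFullEar.compl (h : IsFullEar G S k p) : Set.univ \ S = seg p 1 (k - 1) := by
  ext z
  constructor
  · rintro ⟨-, hz⟩
    rcases h.cover z with h' | ⟨i, hi, rfl⟩
    · exact absurd h' hz
    · have h0 : i ≠ 0 := by rintro rfl; exact hz h.first
      have h1 : i ≠ k := by rintro rfl; exact hz h.last
      exact mem_seg (by omega) (by omega)
  · exact fun hz => ⟨trivial, h.notMem_of_seg hz⟩

theorem IsEar.linked_inner (h : IsEar G S k p) : Linked G (seg p 1 (k - 1)) :=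
  linked_seg fun m _ hm => h.adj m (by omega)

theorem IsEar.inner_nonempty (h : IsEar G S k p) : (seg p 1 (k - 1)).Nonempty :=
  ⟨p 1, mem_seg le_rfl (by have := h.two_le; omega)⟩

theorem IsFullEar.sep (h : IsFullEar G S k p) (hS : ∃ c ∈ S, c ≠ p 0 ∧ c ≠ p k) :
    Sep G S (seg p 0 k) (p 0) (p k) := by
  have hk := h.two_le
  refine ⟨h.inter_seg, h.ends_ne, ?_, ⟨p 1, mem_seg (by omega) (by omega),
    h.inner 1 (by omega) (by omega)⟩, fun x hx hx' y hy hy' hxy => ?_⟩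
  · obtain ⟨c, hc, h0, h1⟩ := hS
    refine ⟨c, hc, fun hc' => ?_⟩
    rcases h.inter_seg.le ⟨hc, hc'⟩ with h' | h'
    exacts [h0 h', h1 h']
  · rcases h.edges x y hxy with h' | ⟨i, hi, h'⟩
    · exact hy' h'.2
    · rw [Sym2.eq_iff] at h'
      rcases h' with ⟨rfl, rfl⟩ | ⟨rfl, rfl⟩
      exacts [hx' (mem_seg (by omega) (by omega)), hx' (mem_seg (by omega) (by omega))]

theorem IsEar.edge_inj (h : IsEar G S k p) {i j : ℕ} (hi : i < k) (hj : j < k)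
    (he : s(p i, p (i + 1)) = s(p j, p (j + 1))) : i = j := by
  rw [Sym2.eq_iff] at he
  rcases he with ⟨h1, -⟩ | ⟨h1, h2⟩
  · exact h.inj i hi.le j hj.le h1
  · have h1 := h.inj i hi.le (j + 1) hj h1
    have h2 := h.inj (i + 1) hi j hj.le h2
    omega

theorem IsEar.edge_notMem (h : IsEar G S k p) {i : ℕ} (hi : i < k) :
    p i ∉ S ∨ p (i + 1) ∉ S := by
  have hk := h.two_le
  rcases Nat.eq_zero_or_pos i with rfl | h0
  · exact Or.inr (h.inner 1 (by omega) (by omega))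
  · exact Or.inl (h.inner i h0 hi)

/-- The defect of a graph with an ear of constant weight. -/
theorem IsFullEar.defect_univ [Finite V] (h : IsFullEar G S k p) {c : ℕ}
    (hw : ∀ i < k, w s(p i, p (i + 1)) = c) :
    defect δ G w Set.univ = defect δ G w S + δ * (k - 1) - k * c := by
  classical
  have hk := h.two_le
  have h1 : edgesIn G Set.univ =
      edgesIn G S ∪ (fun i => s(p i, p (i + 1))) '' (Finset.range k : Set ℕ) := by
    ext e
    induction e with | _ x y => ?_
    rw [Set.mem_union, mem_edgesIn, mem_edgesIn, Set.mem_image]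
    constructor
    · rintro ⟨hxy, -⟩
      rcases h.edges x y hxy with h' | ⟨i, hi, h'⟩
      · exact Or.inl ⟨hxy, h'⟩
      · exact Or.inr ⟨i, by simpa using hi, h'.symm⟩
    · rintro (h' | ⟨i, hi, h'⟩)
      · exact ⟨h'.1, trivial, trivial⟩
      · have hadj := h.adj i (by simpa using hi)
        rw [← SimpleGraph.mem_edgeSet, h', SimpleGraph.mem_edgeSet] at hadj
        exact ⟨hadj, trivial, trivial⟩
  have h2 : Disjoint (edgesIn G S) ((fun i => s(p i, p (i + 1))) '' (Finset.range k : Set ℕ)) := by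
    rw [Set.disjoint_right]
    rintro _ ⟨i, hi, rfl⟩ he
    rw [mem_edgesIn] at he
    have := h.edge_notMem (i := i) (by simpa using hi)
    tauto
  have h3 : (∑ᶠ e ∈ edgesIn G Set.univ, w e) = (∑ᶠ e ∈ edgesIn G S, w e) + k * c := by
    rw [h1, finsum_mem_union h2 (Set.toFinite _) (Set.toFinite _), finsum_mem_image,
      finsum_mem_coe_finset, Finset.sum_congr rfl (g := fun _ => c), Finset.sum_const,
      Finset.card_range, smul_eq_mul]
    · exact fun i hi => hw i (by simpa using hi)
    · exact fun i hi j hj => h.edge_inj (by simpa using hi) (by simpa using hj)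
  have h4 : ((Set.univ : Set V).ncard : ℤ) = S.ncard + (k - 1) := by
    have e : (Set.univ : Set V) = S ∪ p '' (Finset.Ioo 0 k : Set ℕ) := by
      symm
      refine Set.eq_univ_of_forall fun z => ?_
      by_cases hz : z ∈ S
      · exact Or.inl hz
      · obtain ⟨m, h1, h2, rfl⟩ := h.compl.le ⟨trivial, hz⟩
        exact Or.inr ⟨m, by simp; omega, rfl⟩
    rw [e, Set.ncard_union_eq _ (Set.toFinite _) (Set.toFinite _), Set.InjOn.ncard_image,
      Set.ncard_coe_finset, Nat.card_Ioo]
    · omega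
    · intro i hi j hj
      simp only [Finset.coe_Ioo, Set.mem_Ioo] at hi hj
      exact h.inj i hi.2.le j hj.2.le
    · rw [Set.disjoint_right]
      rintro _ ⟨i, hi, rfl⟩
      simp only [Finset.coe_Ioo, Set.mem_Ioo] at hi
      exact h.inner i hi.1 hi.2
  unfold defect
  rw [h3, h4]
  push_cast
  ring

/-- Leave `S` along an edge from `s` into a component `C` of the complement. Since `s` is not a cut
vertex, `C` also has a neighbour `t ≠ s` in `S`, and a path through `C` completes the ear. -/
theorem exists_ear (hc : Conn2 G Set.univ) (hS : S.Nontrivial) (hne : S ≠ Set.univ) :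
    ∃ k p, IsEar G S k p := by
  classical
  have h1 : ∃ s ∈ S, ∃ x, x ∉ S ∧ G.Adj s x := by
    by_contra! hcon
    obtain ⟨s, hs⟩ := hS.nonempty
    refine hne (Set.eq_univ_of_univ_subset (hc.2.1.subset_of_closed (x := s) trivial hs ?_))
    intro y _ z _ hyz hy
    by_contra hz
    exact hcon y hy z hz hyz
  obtain ⟨s, hs, x, hx, hsx⟩ := h1
  obtain ⟨C, hCS, hxC, hCl, hCc⟩ := exists_component (G := G) (A := Sᶜ) hx
  have h2 : ∃ y ∈ C, ∃ t ∈ S, t ≠ s ∧ G.Adj y t := by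
    by_contra! hcon
    obtain ⟨s', hs', hss'⟩ := hS.exists_ne s
    have := (hc.2.2 s trivial).subset_of_closed (x := x) (B := C)
      ⟨trivial, fun h => hx (h ▸ hs)⟩ hxC (fun y _ z hz hyz hy => ?_) ⟨trivial, hss'⟩
    · exact hCS this hs'
    · by_cases hzS : z ∈ S
      · exact absurd hyz (hcon y hy z hzS hz.2)
      · exact hCc y hy z hzS hyz
  obtain ⟨y, hy, t, ht, hts, hyt⟩ := h2
  obtain ⟨q₀⟩ := linked_iff_preconnected.2 hCl ⟨x, hxC⟩ ⟨y, hy⟩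
  obtain ⟨q, hq⟩ : ∃ q : (G.induce C).Walk ⟨x, hxC⟩ ⟨y, hy⟩, q.IsPath :=
    ⟨q₀.bypass, q₀.bypass_isPath⟩
  -- Index 0 is `s`, the indices from 1 to `q.length + 1` run along the path `q` in `C`, and index
  -- `q.length + 2` is `t`.
  let r : ℕ → V := fun i => if i = 0 then s else if i ≤ q.length + 1 then (q.getVert (i - 1)).1
    else t
  have r0 : r 0 = s := rfl
  have r1 : ∀ i, i ≤ q.length → r (i + 1) = (q.getVert i).1 := fun i hi => by
    simp [r, hi]
  have r2 : r (q.length + 2) = t := by simp [r]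
  have hrC : ∀ i, i ≤ q.length → r (i + 1) ∈ C := fun i hi => by
    rw [r1 i hi]; exact (q.getVert i).2
  have hcases : ∀ i ≤ q.length + 2, i = 0 ∨ i = q.length + 2 ∨ ∃ j ≤ q.length, i = j + 1 := by
    intro i hi
    rcases i with _ | i
    · simp
    · by_cases h : i = q.length + 1
      · subst h; simp
      · exact Or.inr (Or.inr ⟨i, by omega, rfl⟩)
  refine ⟨q.length + 2, r, ?_, by omega, hs, by rw [r2]; exact ht, ?_, ?_⟩
  · intro i hi j hj hij
    rcases hcases i hi with rfl | rfl | ⟨i, hi', rfl⟩ <;>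
      rcases hcases j hj with rfl | rfl | ⟨j, hj', rfl⟩
    · rfl
    · rw [r0, r2] at hij; exact absurd hij.symm hts
    · exact absurd hs (hCS (by rw [← r0, hij]; exact hrC j hj'))
    · rw [r0, r2] at hij; exact absurd hij hts
    · rfl
    · exact absurd ht (hCS (by rw [← r2, hij]; exact hrC j hj'))
    · exact absurd hs (hCS (by rw [← r0, ← hij]; exact hrC i hi'))
    · exact absurd ht (hCS (by rw [← r2, ← hij]; exact hrC i hi'))
    · rw [r1 i hi', r1 j hj'] at hij
      rw [hq.getVert_injOn hi' hj' (Subtype.ext hij)]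
  · intro i h0 hk
    rcases hcases i hk.le with rfl | rfl | ⟨i, hi', rfl⟩
    · omega
    · omega
    · exact hCS (hrC i hi')
  · intro i hi
    rcases hcases i hi.le with rfl | rfl | ⟨i, hi', rfl⟩
    · rw [r0, r1 0 (Nat.zero_le _), q.getVert_zero]; exact hsx
    · omega
    · by_cases hlast : i = q.length
      · subst hlast
        rw [r1 _ le_rfl, r2, q.getVert_length]; exact hyt
      · rw [r1 i hi', r1 (i + 1) (by omega)]
        exact q.adj_getVert_succ (by omega)

end Ears

/-! ### Decomposition -/

section Decomposition

variable {V : Type u} {δ : ℕ} {G : SimpleGraph V} {S C : Set V} {u v x y : V} {k : ℕ} {p : ℕ → V}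

theorem Sep.not_linked {S₁ S₂ : Set V} (h : Sep G S₁ S₂ u v) :
    ¬Linked G ((S₁ ∪ S₂) \ {u, v}) := by
  intro hl
  obtain ⟨c, hc, hc'⟩ := h.left
  obtain ⟨d, hd, hd'⟩ := h.right
  have hcu : c ∉ ({u, v} : Set V) := fun h' => hc' (h.inter.ge h').2
  have hdu : d ∉ ({u, v} : Set V) := fun h' => hd' (h.inter.ge h').1
  refine hd' (hl.subset_of_closed (x := c) (B := S₁) ⟨Or.inl hc, hcu⟩ hc ?_ ⟨Or.inr hd, hdu⟩)
  rintro y ⟨-, hy⟩ z ⟨hz, hz'⟩ hyz hy1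
  by_contra hz1
  refine h.cross y hy1 (fun hy2 => hy ?_) z (hz.resolve_left hz1) hz1 hyz
  exact h.inter.le ⟨hy1, hy2⟩

/-! ### Splitting at a separating edge -/

/-- A component of the complement of the ends of a separating edge. -/
structure IsBranch (G : SimpleGraph V) (u v : V) (C : Set V) : Prop where
  subset : C ⊆ Set.univ \ {u, v}
  nonempty : C.Nonempty
  linked : Linked G C
  closed : ∀ y ∈ C, ∀ z ∈ Set.univ \ {u, v}, G.Adj y z → z ∈ C

theorem IsBranch.eq (h : IsBranch G u v C) {C' : Set V} (h' : IsBranch G u v C') (hx : x ∈ C)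
    (hx' : x ∈ C') : C = C' :=
  Set.Subset.antisymm
    (h.linked.subset_of_closed hx hx' fun y _ z hz hyz hy => h'.closed y hy z (h.subset hz) hyz)
    (h'.linked.subset_of_closed hx' hx fun y _ z hz hyz hy => h.closed y hy z (h'.subset hz) hyz)

theorem IsBranch.sep (h : IsBranch G u v C) (huv : u ≠ v)
    (hl : ¬Linked G (Set.univ \ {u, v})) :
    Sep G (C ∪ {u, v}) (Set.univ \ C) u v ∧ (C ∪ {u, v}) ∪ (Set.univ \ C) = Set.univ := by
  have hu : u ∉ C := fun h' => (h.subset h').2 (by simp)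
  have hv : v ∉ C := fun h' => (h.subset h').2 (by simp)
  refine Sep.of_closed (Set.subset_univ C) h.nonempty trivial trivial hu hv huv ?_ ?_
  · by_contra! hcon
    have : C = Set.univ \ {u, v} := by
      refine Set.Subset.antisymm h.subset fun z hz => ?_
      by_contra hzC
      have hz2 := hz.2
      simp only [Set.mem_insert_iff, Set.mem_singleton_iff, not_or] at hz2
      exact hz2.2 (hcon z trivial hzC hz2.1)
    exact hl (this ▸ h.linked)
  · intro y hy z _ hyz
    by_cases hz : z = u ∨ z = v
    · exact Or.inr hz
    · exact Or.inl (h.closed y hy z ⟨trivial, hz⟩ hyz)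

/-- The complement of `C` contains the edge `uv`, so it is 2-connected without any added edge and is
a flat of defect 1. This leaves `-1` for the branch relative to `uv`. Within the branch, `C` remains
linked after removing `u` and `v`, so `uv` is contractible there and gets weight `δ - 1`. -/
theorem IsBranch.spadeOn [Finite V] (hδ : 2 < δ) (hc : Conn2 G Set.univ)
    (hs : SpadeOn δ G Set.univ) (hadj : G.Adj u v) (hl : ¬Linked G (Set.univ \ {u, v}))
    (h : IsBranch G u v C) :
    defect δ G (canonicalWeight δ G Set.univ) (C ∪ {u, v}) -
        defect δ G (canonicalWeight δ G Set.univ) {u, v} = -1 ∧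
      SpadeOn δ G (C ∪ {u, v}) ∧ canonicalWeight δ G (C ∪ {u, v}) s(u, v) = δ - 1 ∧
      Conn2 G (C ∪ {u, v}) := by
  obtain ⟨hsep, hun⟩ := h.sep hadj.ne hl
  have hK : addEdge G u v = G := addEdge_eq_self hadj
  have hR : Conn2 G (Set.univ \ C) := by
    have := hsep.conn2_right (by rwa [hun])
    rwa [hK] at this
  have hL : Conn2 G (C ∪ {u, v}) := by
    have := hsep.conn2_left (by rwa [hun])
    rwa [hK] at this
  have e : Set.univ \ (Set.univ \ C) = C := by simp
  have h1 := hs.defect_eq_one hδ (Set.subset_univ _) hR (by rw [e]; exact h.nonempty)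
    (by rw [e]; exact h.linked)
  have h2 := hsep.defect_union (δ := δ) (w := canonicalWeight δ G Set.univ)
  rw [hun, hs.relaxed.total, h1] at h2
  have e' : (C ∪ {u, v}) \ {u, v} = C := by
    rw [Set.union_sdiff_right, sdiff_eq_left, Set.disjoint_left]
    exact fun z hz => (h.subset hz).2
  have h3 := SpadeOn.left (t := δ - 1) hδ (by rwa [hun]) hsep (by rwa [hun])
    (Or.inr ⟨rfl, by rw [e']; exact h.linked⟩) (by
      rw [hun, Nat.cast_sub (by omega)]
      push_cast
      linarith)
  rw [hK] at h3
  exact ⟨by linarith, h3.1, h3.2, hL⟩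

theorem exists_isBranch (hx : x ∈ Set.univ \ ({u, v} : Set V)) :
    ∃ C, IsBranch G u v C ∧ x ∈ C := by
  obtain ⟨C, h1, h2, h3, h4⟩ := exists_component (G := G) hx
  exact ⟨C, ⟨h1, ⟨x, h2⟩, h3, h4⟩, h2⟩

theorem obtainable_of_separating_edge [Finite V] (hδ : 2 < δ) (hc : Conn2 G Set.univ)
    (hs : SpadeOn δ G Set.univ) (hadj : G.Adj u v) (hl : ¬Linked G (Set.univ \ {u, v}))
    (ih : ∀ S : Set V, S.ncard < Nat.card V → Conn2 G S → SpadeOn δ G S →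
      Obtainable δ (G.induce S)) : Obtainable δ G := by
  classical
  let ι := {C : Set V // IsBranch G u v C}
  have : Fintype ι := Fintype.ofFinite ι
  let B : ι → Set V := fun C => C.1 ∪ {u, v}
  have hb := fun C : ι => C.2.spadeOn hδ hc hs hadj hl
  have hB : ∀ (i : ι) z, z ∈ B i ↔ z ∈ i.1 ∨ z = u ∨ z = v := fun i z => Iff.rfl
  have hcross : ∀ i j : ι, i ≠ j → ∀ x ∈ B i, ∀ y ∈ B j, G.Adj x y → x ∈ B j ∨ y ∈ B i := by
    intro i j hij x hx y hy hxy
    rcases hx with hx | hx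
    · by_cases hy' : y ∈ ({u, v} : Set V)
      · exact Or.inr (Or.inr hy')
      · exact Or.inr (Or.inl (i.2.closed x hx y ⟨trivial, hy'⟩ hxy))
    · exact Or.inl (Or.inr hx)
  have hinter : ∀ (i j : ι) x, i ≠ j → x ∈ B i → x ∈ B j → x = u ∨ x = v := by
    intro i j x hij hi hj
    rcases hi with hi | hi
    · rcases hj with hj | hj
      · exact absurd (Subtype.ext (i.2.eq j.2 hi hj)) hij
      · exact hj
    · exact hi
  have hex : ∃ z, z ∈ Set.univ \ ({u, v} : Set V) := by
    by_contra! hcon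
    exact hl (linked_of_subsingleton fun z hz => absurd hz (hcon z))
  have hne : Nonempty ι := by
    obtain ⟨z, hz⟩ := hex
    obtain ⟨C, hC, -⟩ := exists_isBranch (G := G) hz
    exact ⟨⟨C, hC⟩⟩
  have hcov : ∀ z, ∃ i, z ∈ B i := by
    intro z
    by_cases hz : z ∈ ({u, v} : Set V)
    · exact ⟨hne.some, Or.inr hz⟩
    · obtain ⟨C, hC, hzC⟩ := exists_isBranch (G := G) ⟨trivial, hz⟩
      exact ⟨⟨C, hC⟩, Or.inl hzC⟩
  -- In `G` the edge `uv` is deletable, so it has weight 1 and defect `δ - 1`. Each branch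
  -- contributes `-1` relative to it, and the total is 0, which determines the number of branches.
  have hcard : Fintype.card ι = δ - 1 := by
    have h1 := defect_biUnion (δ := δ) (w := canonicalWeight δ G Set.univ)
      (I := (Finset.univ : Finset ι)) Finset.univ_nonempty B u v
      (fun i => Or.inr (by simp)) (fun i => Or.inr (by simp)) hinter hcross
    have h2 : (⋃ i ∈ (Finset.univ : Finset ι), B i) = Set.univ := by
      refine Set.eq_univ_of_forall fun z => ?_
      simpa using hcov z
    rw [h2, hs.relaxed.total, Finset.sum_congr rfl (fun i _ => (hb i).1), defect_pair hadj.ne hadj,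
      canonicalWeight_of_conn2 (hc.del_of_not_linked trivial trivial hadj.ne hl)] at h1
    simp only [Finset.sum_const, Finset.card_univ, nsmul_eq_mul] at h1
    push_cast at h1
    omega
  let φ : Fin (δ - 1) ≃ ι := (Fintype.equivFinOfCardEq hcard).symm
  have hu : ∀ i, u ∈ B i := fun i => Or.inr (by simp)
  have hv : ∀ i, v ∈ B i := fun i => Or.inr (by simp)
  refine Obtainable.glue G (fun i => ↥(B (φ i))) (fun i => G.induce (B (φ i)))
    (fun i => canonicalWeight δ (G.induce (B (φ i))) Set.univ) (fun i => ⟨u, hu _⟩)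
    (fun i => ⟨v, hv _⟩) (fun i => ?_) (fun i => ?_) (fun i => hadj) (fun i => ?_) ?_
  · refine ih _ ?_ (hb (φ i)).2.2.2 (hb (φ i)).2.1
    obtain ⟨hsep, hun⟩ := (φ i).2.sep hadj.ne hl
    have := hsep.ncard_lt
    rwa [hun, Set.ncard_univ] at this
  · exact SpadeOn.isWeight (conn2_induce.2 (hb (φ i)).2.2.2) (spadeOn_induce.2 (hb (φ i)).2.1)
  · rw [canonicalWeight_induce]
    exact (hb (φ i)).2.2.1
  · refine ⟨u, v, fun i => Subtype.val, fun i => Subtype.val_injective, fun i => rfl, fun i => rfl,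
      fun i j x y hij hxy => ?_, fun z => ?_, fun x y => ⟨fun hxy => ?_, ?_⟩⟩
    · exact hinter (φ i) (φ j) x.1 (fun h => hij (φ.injective h)) x.2 ((show x.1 = y.1 from hxy) ▸ y.2)
    · obtain ⟨i, hi⟩ := hcov z
      obtain ⟨j, rfl⟩ := φ.surjective i
      exact ⟨j, ⟨z, hi⟩, rfl⟩
    · have : ∃ i, x ∈ B i ∧ y ∈ B i := by
        by_cases hx : x ∈ ({u, v} : Set V)
        · obtain ⟨i, hi⟩ := hcov y
          exact ⟨i, Or.inr hx, hi⟩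
        · obtain ⟨i, hi⟩ := hcov x
          refine ⟨i, hi, ?_⟩
          by_cases hy : y ∈ ({u, v} : Set V)
          · exact Or.inr hy
          · exact Or.inl (i.2.closed x (hi.resolve_right hx) y ⟨trivial, hy⟩ hxy)
      obtain ⟨i, hx, hy⟩ := this
      obtain ⟨j, rfl⟩ := φ.surjective i
      exact ⟨j, ⟨x, hx⟩, ⟨y, hy⟩, hxy, rfl, rfl⟩
    · rintro ⟨i, x', y', h, rfl, rfl⟩
      exact h

/-! ### Splitting off a last ear -/

theorem cycleGraph_adj_iff {n : ℕ} {i j : Fin (n + 1)} (hn : 1 ≤ n) :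
    (SimpleGraph.cycleGraph (n + 1)).Adj i j ↔
      (i : ℕ) + 1 = j ∨ (j : ℕ) + 1 = i ∨ ((i : ℕ) = 0 ∧ (j : ℕ) = n) ∨
        ((i : ℕ) = n ∧ (j : ℕ) = 0) := by
  rw [SimpleGraph.cycleGraph_adj', Fin.val_sub, Fin.val_sub]
  have hi := i.2
  have hj := j.2
  have hmod : ∀ a b : ℕ, a < n + 1 → b < n + 1 → ((n + 1 - b + a) % (n + 1) = 1 ↔
      (a = b + 1) ∨ (a = 0 ∧ b = n)) := by
    intro a b ha hb
    by_cases hab : b ≤ a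
    · rw [show n + 1 - b + a = (a - b) + (n + 1) by omega, Nat.add_mod_right,
        Nat.mod_eq_of_lt (by omega)]
      omega
    · rw [Nat.mod_eq_of_lt (by omega)]
      omega
  rw [hmod _ _ hi hj, hmod _ _ hj hi]
  omega

theorem IsFullEar.nonempty_cycleGraph_iso (h : IsFullEar G S k p) (hS : S = {p 0, p k})
    (hadj : G.Adj (p 0) (p k)) : Nonempty (SimpleGraph.cycleGraph (k + 1) ≃g G) := by
  have hk := h.two_le
  have hbij : Function.Bijective fun i : Fin (k + 1) => p i := by
    refine ⟨fun i j hij => Fin.ext (h.inj i (by omega) j (by omega) hij), fun z => ?_⟩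
    rcases h.cover z with hz | ⟨i, hi, rfl⟩
    · rw [hS] at hz
      rcases hz with rfl | rfl
      exacts [⟨⟨0, by omega⟩, rfl⟩, ⟨⟨k, by omega⟩, rfl⟩]
    · exact ⟨⟨i, by omega⟩, rfl⟩
  refine ⟨⟨Equiv.ofBijective _ hbij, ?_⟩⟩
  intro i j
  simp only [Equiv.ofBijective_apply]
  rw [cycleGraph_adj_iff (by omega)]
  constructor
  · intro hij
    rcases h.edges _ _ hij with ⟨h1, h2⟩ | ⟨m, hm, he⟩
    · have hend : ∀ l ≤ k, p l ∈ S → l = 0 ∨ l = k := by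
        intro l hl hlS
        by_contra! hcon
        exact h.inner l (by omega) (by omega) hlS
      have hne : (i : ℕ) ≠ j := fun he => hij.ne (by rw [he])
      have := hend i (by omega) h1
      have := hend j (by omega) h2
      omega
    · rw [Sym2.eq_iff] at he
      rcases he with ⟨h1, h2⟩ | ⟨h1, h2⟩
      · have := h.inj _ (by omega) _ (by omega) h1
        have := h.inj _ (by omega) _ (by omega) h2
        omega
      · have := h.inj _ (by omega) _ (by omega) h1
        have := h.inj _ (by omega) _ (by omega) h2
        omega
  · rintro (h1 | h1 | ⟨h1, h2⟩ | ⟨h1, h2⟩)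
    · rw [← h1]; exact h.adj i (by omega)
    · rw [← h1]; exact (h.adj j (by omega)).symm
    · rw [h1, h2]; exact hadj
    · rw [h1, h2]; exact hadj.symm

theorem isSubdivision_of_isFullEar (h : IsFullEar G S k p) (hadj : ¬G.Adj (p 0) (p k)) :
    IsSubdivision k ((addEdge G (p 0) (p k)).induce S) ⟨p 0, h.first⟩ ⟨p k, h.last⟩ G := by
  refine ⟨Subtype.val, fun i => p i, Subtype.val_injective,
    fun i j hij => Fin.ext (h.inj i (by omega) j (by omega) hij), rfl, by simp, ?_, ?_, ?_⟩
  · intro x i hxi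
    by_contra! hcon
    have h0 : (i : ℕ) ≠ 0 := fun h' => hcon.1 (Fin.ext h')
    have h1 : (i : ℕ) ≠ k := fun h' => hcon.2 (Fin.ext h')
    exact h.inner i (by omega) (by omega) ((show x.1 = p i from hxi) ▸ x.2)
  · intro z
    rcases h.cover z with hz | ⟨i, hi, rfl⟩
    exacts [Or.inl ⟨⟨z, hz⟩, rfl⟩, Or.inr ⟨⟨i, by omega⟩, rfl⟩]
  · intro x y
    constructor
    · intro hxy
      rcases h.edges x y hxy with ⟨hx, hy⟩ | ⟨i, hi, he⟩
      · refine Or.inl ⟨⟨x, hx⟩, ⟨y, hy⟩, addEdge_adj.2 (Or.inl hxy), fun he => hadj ?_, rfl, rfl⟩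
        have he' := congrArg (Sym2.map Subtype.val) he
        simp only [Sym2.map_mk] at he'
        rwa [← SimpleGraph.mem_edgeSet, ← he', SimpleGraph.mem_edgeSet]
      · exact Or.inr ⟨⟨i, hi⟩, he⟩
    · rintro (⟨x', y', hxy, hne, rfl, rfl⟩ | ⟨i, he⟩)
      · refine (addEdge_adj_iff fun he => hne ?_).1 hxy
        exact Sym2.map.injective Subtype.val_injective he
      · rw [← SimpleGraph.mem_edgeSet, he, SimpleGraph.mem_edgeSet]
        exact h.adj i i.2

theorem conn2_pair (h : G.Adj u v) : Conn2 G {u, v} := by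
  refine ⟨⟨u, by simp, v, by simp, h.ne⟩,
    (linked_of_subsingleton Set.subsingleton_singleton).union_adj
      (linked_of_subsingleton Set.subsingleton_singleton) rfl rfl h, fun w hw => ?_⟩
  refine linked_of_subsingleton ?_
  rintro a ⟨ha, ha'⟩ b ⟨hb, hb'⟩
  simp only [Set.mem_insert_iff, Set.mem_singleton_iff] at *
  rcases hw with rfl | rfl
  · rw [ha.resolve_left ha', hb.resolve_left hb']
  · rw [ha.resolve_right ha', hb.resolve_right hb']

/-- Attach an ear to a largest proper 2-connected vertex set. By maximality the result contains
every vertex, and a further edge outside the set and the ear could be deleted without loss of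
2-connectedness, against `hdel`. -/
theorem exists_isFullEar [Finite V] (hc : Conn2 G Set.univ) (h3 : 3 ≤ (Set.univ : Set V).ncard)
    (hdel : ∀ x y, G.Adj x y → ¬Conn2 (delEdge G x y) Set.univ) :
    ∃ S k p, Conn2 G S ∧ IsFullEar G S k p := by
  have hne : {S : Set V | Conn2 G S ∧ S ≠ Set.univ}.Nonempty := by
    obtain ⟨x, -, y, -, hxy⟩ := hc.1
    obtain ⟨z, -, -, hz⟩ := hc.exists_adj_ne (x := x) (y := y) trivial hxy.symm (by
      obtain ⟨c, hc, h1⟩ := exists_ne_ne_of_ncard h3 x y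
      exact ⟨c, hc, h1⟩)
    refine ⟨{x, z}, conn2_pair hz, fun h => ?_⟩
    rw [← h, Set.ncard_pair hz.ne] at h3
    omega
  obtain ⟨S, ⟨hS, hSne⟩, hmax⟩ := Set.exists_max_image _ Set.ncard (Set.toFinite _) hne
  obtain ⟨k, p, hear⟩ := exists_ear hc hS.1 hSne
  have hk := hear.two_le
  have hun : S ∪ seg p 0 k = Set.univ := by
    by_contra hcon
    have h1 := hmax _ ⟨hear.conn2_union hS.add_edge hS.2.1, hcon⟩
    refine absurd h1 (not_le.2 (Set.ncard_lt_ncard (Set.ssubset_iff_exists.2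
      ⟨Set.subset_union_left, p 1, Or.inr (mem_seg (by omega) (by omega)), ?_⟩)))
    exact hear.inner 1 (by omega) (by omega)
  refine ⟨S, k, p, hS, hear, fun z => ?_, fun x y hxy => ?_⟩
  · rcases hun.ge (Set.mem_univ z) with hz | ⟨i, -, hi, rfl⟩
    exacts [Or.inl hz, Or.inr ⟨i, hi, rfl⟩]
  · by_contra! hcon
    have hS' : Conn2 (delEdge G x y) S := hS.del_edge (by tauto)
    have hear' : IsEar (delEdge G x y) S k p :=
      ⟨hear.inj, hear.two_le, hear.first, hear.last, hear.inner, fun i hi =>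
        delEdge_adj.2 ⟨hear.adj i hi, (hcon.2 i hi).symm⟩⟩
    refine hdel x y hxy ?_
    rw [← hun]
    exact hear'.conn2_union hS'.add_edge hS'.2.1

theorem obtainable_of_spadeOn [Finite V] (hδ : 2 < δ) (hc : Conn2 G Set.univ)
    (hs : SpadeOn δ G Set.univ) : Obtainable δ G := by
  induction hn : Nat.card V using Nat.strong_induction_on generalizing V with | _ n ih => ?_
  subst hn
  have ih' : ∀ (K : SimpleGraph V) (S : Set V), S.ncard < Nat.card V → Conn2 K S →
      SpadeOn δ K S → Obtainable δ (K.induce S) := fun K S hS hcS hsS =>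
    ih _ (by rwa [Nat.card_coe_set_eq]) (conn2_induce.2 hcS) (spadeOn_induce.2 hsS) rfl
  by_cases hsepedge : ∃ u v, G.Adj u v ∧ ¬Linked G (Set.univ \ {u, v})
  · obtain ⟨u, v, hadj, hl⟩ := hsepedge
    exact obtainable_of_separating_edge hδ hc hs hadj hl (ih' G)
  push Not at hsepedge
  have h3 := hs.three_le hδ hc
  -- No edge separates, so every edge is contractible and hence not deletable; all weights are `δ -
  -- 1`.
  have hdel : ∀ x y, G.Adj x y → ¬Conn2 (delEdge G x y) Set.univ := fun x y hxy =>
    hs.contr x trivial y trivial hxy (nonempty_sdiff_pair h3) (hsepedge x y hxy)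
  obtain ⟨S, k, p, hS, hear⟩ := exists_isFullEar hc h3 hdel
  have hk := hear.two_le
  have hw : ∀ x y, G.Adj x y → canonicalWeight δ G Set.univ s(x, y) = δ - 1 := fun x y hxy =>
    canonicalWeight_of_not_conn2 (hdel x y hxy)
  have hdS := hs.defect_eq_one hδ (Set.subset_univ S) hS
    (by rw [hear.compl]; exact hear.inner_nonempty) (by rw [hear.compl]; exact hear.linked_inner)
  -- With `d(V) = 0` and `d(S) = 1`, the ear gives `0 = 1 + δ (k - 1) - k (δ - 1)`.
  have hkδ : k = δ - 1 := by
    have h0 := hear.defect_univ (δ := δ) fun i hi => hw _ _ (hear.adj i hi)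
    rw [hs.relaxed.total, hdS, Nat.cast_sub (by omega)] at h0
    push_cast at h0
    have : (k : ℤ) = δ - 1 := by linear_combination -h0
    omega
  by_cases hrest : ∃ c ∈ S, c ≠ p 0 ∧ c ≠ p k
  · have hsep := hear.sep hrest
    have hun := hear.union_seg
    have hnadj : ¬G.Adj (p 0) (p k) := fun hadj => by
      have := hsep.not_linked
      rw [hun] at this
      exact this (hsepedge _ _ hadj)
    have hS' : Conn2 (delEdge G (p 0) (p k)) S := by
      rw [← delEdge_addEdge_self, addEdge_delEdge hnadj]; exact hS
    -- The ear is replaced by an edge between its ends. Deleting it leaves the 2-connected graph on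
    -- `S`, so its weight should be 1, and the total is `1 - δ + (δ - 1) = 0`.
    obtain ⟨hsS, hwS⟩ := SpadeOn.left (t := 1) hδ (by rwa [hun]) hsep (by rwa [hun])
      (Or.inl ⟨rfl, hS'⟩) (by
        rw [hun, hdS, defect_pair_of_not_adj hsep.ne hnadj]
        push_cast; ring)
    have hcS : Conn2 (addEdge G (p 0) (p k)) S := hS.add_edge
    have hlt : S.ncard < Nat.card V := by
      have := hsep.ncard_lt
      rwa [hun, Set.ncard_univ] at this
    refine Obtainable.subdivide G ((addEdge G (p 0) (p k)).induce S)
      (canonicalWeight δ ((addEdge G (p 0) (p k)).induce S) Set.univ) ⟨p 0, hear.first⟩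
      ⟨p k, hear.last⟩ (ih' _ S hlt hcS hsS)
      (SpadeOn.isWeight (conn2_induce.2 hcS) (spadeOn_induce.2 hsS))
      (addEdge_adj.2 (Or.inr ⟨rfl, hsep.ne⟩)) ?_ ?_
    · rw [canonicalWeight_induce]; exact hwS
    · rw [← hkδ]; exact isSubdivision_of_isFullEar hear hnadj
  -- Now `S` is a single edge, and with the ear it forms a cycle of length `k + 1 = δ`.
  · have hSe : S = {p 0, p k} := by
      apply Set.Subset.antisymm
      · intro c hc
        by_contra hcon
        exact hrest ⟨c, hc, by simpa [not_or] using hcon⟩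
      · rintro x (rfl | rfl)
        exacts [hear.first, hear.last]
    have hadj : G.Adj (p 0) (p k) := Conn2.adj_of_pair (hSe ▸ hS) hear.ends_ne
    have := hear.nonempty_cycleGraph_iso hSe hadj
    rw [show k + 1 = δ by omega] at this
    exact Obtainable.cycle G this

end Decomposition

/-! ### Construction -/

section Construction

variable {V : Type u} {δ : ℕ} {G : SimpleGraph V} {S T : Set V} {u v x y a b : V} {k : ℕ}
  {p : ℕ → V}

/-- Within a 2-connected set on at least three vertices, `x` has at least two neighbours, and only
`a` and `b` are available. -/
theorem Conn2.mem_of_degree_two [Finite V] (hT : Conn2 G T) (h3 : 3 ≤ T.ncard) (hxT : x ∈ T)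
    (hx : ∀ z, G.Adj x z → z = a ∨ z = b) (ha : a ≠ x) (hb : b ≠ x) : a ∈ T ∧ b ∈ T := by
  constructor
  · obtain ⟨z, hz, hzb, hxz⟩ := hT.exists_adj_ne hxT hb (exists_ne_ne_of_ncard h3 x b)
    rcases hx z hxz with rfl | rfl
    exacts [hz, absurd rfl hzb]
  · obtain ⟨z, hz, hza, hxz⟩ := hT.exists_adj_ne hxT ha (exists_ne_ne_of_ncard h3 x a)
    rcases hx z hxz with rfl | rfl
    exacts [absurd rfl hza, hz]

/-- After the deletion `x` has at most one neighbour. -/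
theorem not_conn2_delEdge_of_degree_two [Finite V] (h3 : 3 ≤ S.ncard) (hxS : x ∈ S)
    (hx : ∀ z, G.Adj x z → z = a ∨ z = b) (ha : a ≠ x) (hb : b ≠ x) (hxy : G.Adj x y) :
    ¬Conn2 (delEdge G x y) S := by
  intro hc
  have key : ∀ c, c ≠ x → ∃ z, z ≠ c ∧ z ≠ y ∧ G.Adj x z := by
    intro c hcx
    obtain ⟨z, -, hzc, hxz⟩ := hc.exists_adj_ne hxS hcx (exists_ne_ne_of_ncard h3 x c)
    rw [delEdge_adj] at hxz
    exact ⟨z, hzc, by rintro rfl; exact hxz.2 rfl, hxz.1⟩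
  rcases hx y hxy with rfl | rfl
  · obtain ⟨z, h1, h2, h⟩ := key b hb
    rcases hx z h with rfl | rfl
    exacts [h2 rfl, h1 rfl]
  · obtain ⟨z, h1, h2, h⟩ := key a ha
    rcases hx z h with rfl | rfl
    exacts [h1 rfl, h2 rfl]

/-! #### Cycles -/

/-- No edge is deletable, since all degrees are two; all weights are `δ - 1` and the total defect is
`δ (δ - 1) - δ (δ - 1) = 0`. A 2-connected set on at least three vertices is closed under adjacency,
so it is everything and there is no flat to check. -/
theorem spadeOn_of_cycle (hδ : 2 < δ) (h : Nonempty (SimpleGraph.cycleGraph δ ≃g G)) :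
    Finite V ∧ Conn2 G Set.univ ∧ SpadeOn δ G Set.univ := by
  obtain ⟨φ⟩ := h
  obtain ⟨n, rfl⟩ : ∃ n, δ = n + 3 := ⟨δ - 3, by omega⟩
  have hfin : Finite V := Finite.of_equiv _ φ.toEquiv
  let p : ℕ → V := fun i => φ (Fin.ofNat (n + 3) i)
  have hval : ∀ i ≤ n + 2, ((Fin.ofNat (n + 3) i : Fin (n + 3)) : ℕ) = i := fun i hi =>
    Nat.mod_eq_of_lt (by omega)
  have hp : ∀ i : Fin (n + 3), p i = φ i := fun i => by
    have : Fin.ofNat (n + 3) (i : ℕ) = i := Fin.ext (hval i (by omega))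
    change φ _ = φ _
    rw [this]
  have hadj : ∀ i ≤ n + 2, ∀ j ≤ n + 2, (G.Adj (p i) (p j) ↔ i + 1 = j ∨ j + 1 = i ∨
      (i = 0 ∧ j = n + 2) ∨ (i = n + 2 ∧ j = 0)) := by
    intro i hi j hj
    change G.Adj (φ _) (φ _) ↔ _
    rw [φ.map_adj_iff, cycleGraph_adj_iff (by omega), hval i hi, hval j hj]
  have hsurj : ∀ z, ∃ i ≤ n + 2, p i = z := fun z =>
    ⟨(φ.symm z : Fin (n + 3)), by omega, by rw [hp]; simp⟩
  have hinj : ∀ i ≤ n + 2, ∀ j ≤ n + 2, p i = p j → i = j := by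
    intro i hi j hj hij
    have := congrArg Fin.val (φ.injective hij)
    rwa [hval i hi, hval j hj] at this
  have hends : G.Adj (p 0) (p (n + 2)) := (hadj 0 (by omega) _ le_rfl).2 (by omega)
  -- The cycle is viewed as the edge from `p 0` to `p (n + 2)` with one ear, so that the results on
  -- ears apply.
  have hear : IsFullEar G {p 0, p (n + 2)} (n + 2) p := by
    refine ⟨⟨hinj, by omega, by simp, by simp, ?_, fun i hi => (hadj i hi.le (i + 1) hi).2 (by omega)⟩,
      fun z => Or.inr (hsurj z), fun x y hxy => ?_⟩
    · rintro i h0 hi (h | h)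
      · have := hinj i hi.le 0 (by omega) h; omega
      · have := hinj i hi.le (n + 2) le_rfl h; omega
    · obtain ⟨i, hi, rfl⟩ := hsurj x
      obtain ⟨j, hj, rfl⟩ := hsurj y
      rcases (hadj i hi j hj).1 hxy with rfl | rfl | ⟨rfl, rfl⟩ | ⟨rfl, rfl⟩
      · exact Or.inr ⟨i, by omega, rfl⟩
      · exact Or.inr ⟨j, by omega, Sym2.eq_swap⟩
      · exact Or.inl (by simp)
      · exact Or.inl (by simp)
  have hdeg : ∀ x, ∃ a b, a ≠ x ∧ b ≠ x ∧ ∀ z, G.Adj x z → z = a ∨ z = b := by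
    intro x
    obtain ⟨i, hi, rfl⟩ := hsurj x
    have hne : ∀ j ≤ n + 2, j ≠ i → p j ≠ p i := fun j hj hji h => hji (hinj j hj i hi h)
    refine ⟨p (if i = n + 2 then 0 else i + 1), p (if i = 0 then n + 2 else i - 1), ?_, ?_, ?_⟩
    · split_ifs <;> exact hne _ (by omega) (by omega)
    · split_ifs <;> exact hne _ (by omega) (by omega)
    · intro z hz
      obtain ⟨j, hj, rfl⟩ := hsurj z
      rw [hadj i hi j hj] at hz
      have : j = (if i = n + 2 then 0 else i + 1) ∨ j = (if i = 0 then n + 2 else i - 1) := by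
        split_ifs <;> omega
      exact this.imp (congrArg p) (congrArg p)
  have hcpair : Conn2 G {p 0, p (n + 2)} := conn2_pair hends
  have hc : Conn2 G Set.univ := by
    rw [← hear.union_seg]; exact hear.conn2_union hcpair.add_edge hcpair.2.1
  have h3 : 3 ≤ (Set.univ : Set V).ncard := by
    rw [Set.ncard_univ, ← Nat.card_congr φ.toEquiv, Nat.card_fin]
    omega
  have hdel : ∀ x y, G.Adj x y → ¬Conn2 (delEdge G x y) Set.univ := by
    intro x y hxy
    obtain ⟨a, b, ha, hb, hx⟩ := hdeg x
    exact not_conn2_delEdge_of_degree_two h3 trivial hx ha hb hxy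
  have hw : ∀ x y, G.Adj x y → canonicalWeight (n + 3) G Set.univ s(x, y) = n + 3 - 1 :=
    fun x y hxy => canonicalWeight_of_not_conn2 (hdel x y hxy)
  refine ⟨hfin, hc, ⟨fun x _ y _ _ => canonicalWeight_range _, ?_, fun T _ hT3 hT hne _ => ?_⟩,
    fun x _ y _ hxy _ _ => hdel x y hxy⟩
  · rw [hear.defect_univ (fun i hi => hw _ _ (hear.adj i hi)), defect_pair hends.ne hends,
      hw _ _ hends]
    push_cast
    ring
  · exfalso
    obtain ⟨z, -, hz⟩ := hne
    obtain ⟨t, ht⟩ := hT.1.nonempty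
    refine hz (hc.2.1.subset_of_closed trivial ht (fun x _ y _ hxy hxT => ?_) trivial)
    obtain ⟨a, b, ha, hb, hx⟩ := hdeg x
    have := hT.mem_of_degree_two hT3 hxT hx ha hb
    rcases hx y hxy with rfl | rfl
    exacts [this.1, this.2]

/-! #### Subdivision -/

theorem IsFullEar.inner_adj (h : IsFullEar G S k p) {m : ℕ} (h0 : 0 < m) (hm : m < k) {z : V}
    (hz : G.Adj (p m) z) : z = p (m - 1) ∨ z = p (m + 1) := by
  rcases h.edges _ _ hz with h' | ⟨i, hi, he⟩
  · exact absurd h'.1 (h.inner m h0 hm)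
  · rw [Sym2.eq_iff] at he
    rcases he with ⟨h1, rfl⟩ | ⟨h1, rfl⟩
    · have := h.inj m hm.le i hi.le h1
      subst this
      exact Or.inr rfl
    · have := h.inj m hm.le (i + 1) hi h1
      subst this
      exact Or.inl rfl

/-- The graph before subdivision is `S` with the edge between the ends of the ear. That edge has
weight 1, so it is deletable and `S` is 2-connected without it. Trading it for an ear of `δ - 1`
edges of weight `δ - 1` keeps the total at 0. -/
theorem spadeOn_of_ear [Finite V] (hδ : 2 < δ) (h : IsFullEar G S k p) (hk : k = δ - 1)
    (hnadj : ¬G.Adj (p 0) (p k)) (hc : Conn2 (addEdge G (p 0) (p k)) S)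
    (hs : SpadeOn δ (addEdge G (p 0) (p k)) S)
    (hw : canonicalWeight δ (addEdge G (p 0) (p k)) S s(p 0, p k) = 1) :
    Conn2 G Set.univ ∧ SpadeOn δ G Set.univ := by
  have hk2 := h.two_le
  have hdelK := (canonicalWeight_eq_one_iff hδ).1 hw
  have hS : Conn2 G S := by rwa [addEdge_delEdge hnadj] at hdelK
  have hun := h.union_seg
  have hcG : Conn2 G Set.univ := by rw [← hun]; exact h.conn2_union hc hS.2.1
  have hsep := h.sep (exists_ne_ne_of_ncard (hs.three_le hδ hc) _ _)
  have hc' : Conn2 G (S ∪ seg p 0 k) := by rwa [hun]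
  have h3 : 3 ≤ (Set.univ : Set V).ncard :=
    (hs.three_le hδ hc).trans (Set.ncard_le_ncard (Set.subset_univ S))
  have hKadj : (addEdge G (p 0) (p k)).Adj (p 0) (p k) := addEdge_adj.2 (Or.inr ⟨rfl, hsep.ne⟩)
  have hinner : ∀ m, 0 < m → m < k → p (m - 1) ≠ p m ∧ p (m + 1) ≠ p m := by
    intro m h0 hm
    constructor <;> intro he
    · have := h.inj _ (by omega) _ (by omega) he; omega
    · have := h.inj _ (by omega) _ (by omega) he; omega
  have hear : ∀ i < k, ¬Conn2 (delEdge G (p i) (p (i + 1))) Set.univ := by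
    intro i hi
    rcases Nat.eq_zero_or_pos i with rfl | h0
    · have := not_conn2_delEdge_of_degree_two h3 (Set.mem_univ (p 1))
        (fun z => h.inner_adj (m := 1) (by omega) (by omega)) (hinner 1 (by omega) (by omega)).1
        (hinner 1 (by omega) (by omega)).2 (h.adj 0 hi).symm
      rwa [show delEdge G (p 1) (p 0) = delEdge G (p 0) (p 1) by
        unfold delEdge; rw [Sym2.eq_swap]] at this
    · exact not_conn2_delEdge_of_degree_two h3 (Set.mem_univ (p i))
        (fun z => h.inner_adj h0 hi) (hinner i h0 hi).1 (hinner i h0 hi).2 (h.adj i hi)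
  set w := canonicalWeight δ G Set.univ with hwdef
  set w' := canonicalWeight δ (addEdge G (p 0) (p k)) S with hwdef'
  have hww : ∀ x ∈ S, ∀ y ∈ S, G.Adj x y → s(x, y) ≠ s(p 0, p k) → w' s(x, y) = w s(x, y) := by
    intro x hx y hy hxy hne
    have := hsep.canonicalWeight_left (δ := δ) hc' hx hy hxy.ne hne
    rwa [hun] at this
  have hpair : defect δ G w {p 0, p k} = δ := defect_pair_of_not_adj hsep.ne hnadj
  have hpair' : defect δ (addEdge G (p 0) (p k)) w' {p 0, p k} = δ - 1 := by
    rw [defect_pair hsep.ne hKadj, hw]; push_cast; ring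
  have hdef : ∀ T ⊆ S, p 0 ∈ T → p k ∈ T →
      defect δ G w T = defect δ (addEdge G (p 0) (p k)) w' T + 1 := by
    intro T hT h0 hk
    have := defect_exchange (δ := δ) (G := G) (G' := addEdge G (p 0) (p k)) (w := w) (w' := w') h0
      hk hsep.ne (fun x y => addEdge_adj_iff) fun x hx y hy => hww x (hT hx) y (hT hy)
    linarith
  have hdS := hdef S subset_rfl h.first h.last
  rw [hs.relaxed.total] at hdS
  have htot : defect δ G w Set.univ = 0 := by
    rw [h.defect_univ (c := δ - 1) (fun i hi => canonicalWeight_of_not_conn2 (hear i hi)), hdS, hk]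
    rw [Nat.cast_sub (by omega)]
    push_cast
    ring
  refine ⟨hcG, ⟨fun x _ y _ _ => canonicalWeight_range _, htot, fun T _ hT3 hT hne hl => ?_⟩,
    fun x _ y _ hxy hne hl => ?_⟩
  -- Inner vertices have degree two, so a flat containing one of them contains the whole ear. Its
  -- trace on `S` is then a flat of the original graph with the same complement.
  · by_cases hin : ∃ m, 0 < m ∧ m < k ∧ p m ∈ T
    · obtain ⟨m, h0, hm, hmT⟩ := hin
      have step : ∀ i, 0 < i → i < k → p i ∈ T → p (i - 1) ∈ T ∧ p (i + 1) ∈ T :=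
        fun i h0 hi hiT => hT.mem_of_degree_two hT3 hiT (fun z => h.inner_adj h0 hi)
          (hinner i h0 hi).1 (hinner i h0 hi).2
      have hup : ∀ i, m ≤ i → i ≤ k → p i ∈ T := by
        intro i hmi
        induction i, hmi using Nat.le_induction with
        | base => exact fun _ => hmT
        | succ i hmi ih => exact fun hi => (step i (by omega) (by omega) (ih (by omega))).2
      have hdown : ∀ d ≤ m, p (m - d) ∈ T := by
        intro d
        induction d with
        | zero => exact fun _ => hmT
        | succ d ih => exact fun hd => (step (m - d) (by omega) (by omega) (ih (by omega))).1
      have hseg : seg p 0 k ⊆ T := by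
        rintro _ ⟨i, -, hi, rfl⟩
        by_cases him : m ≤ i
        · exact hup i him hi
        · have := hdown (m - i) (by omega)
          rwa [show m - (m - i) = i by omega] at this
      have hp0 : p 0 ∈ T ∩ S := ⟨hseg (mem_seg le_rfl (by omega)), h.first⟩
      have hpk : p k ∈ T ∩ S := ⟨hseg (mem_seg (by omega) le_rfl), h.last⟩
      have hTun : (T ∩ S) ∪ seg p 0 k = T := by
        apply Set.Subset.antisymm
        · exact Set.union_subset Set.inter_subset_left hseg
        · intro z hz
          rcases hun.ge (Set.mem_univ z) with h' | h'
          exacts [Or.inl ⟨hz, h'⟩, Or.inr h']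
      have hcompl : S \ (T ∩ S) = Set.univ \ T := by
        ext z
        constructor
        · rintro ⟨h1, h2⟩; exact ⟨trivial, fun h3 => h2 ⟨h3, h1⟩⟩
        · rintro ⟨-, h2⟩
          exact ⟨(hun.ge (Set.mem_univ z)).resolve_right fun h3 => h2 (hseg h3), fun h3 => h2 h3.1⟩
      by_cases hthird : ∃ c ∈ T ∩ S, c ≠ p 0 ∧ c ≠ p k
      · obtain ⟨c, hcT, hc0, hck⟩ := hthird
        have hsepT : Sep G (T ∩ S) (seg p 0 k) (p 0) (p k) := by
          refine ⟨?_, hsep.ne, ⟨c, hcT, fun h' => ?_⟩, ?_, fun x hx hx' y hy hy' => ?_⟩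
          · rw [← hsep.inter, Set.inter_assoc, Set.inter_eq_right.2]
            exact fun z hz => hseg hz.2
          · rcases hsep.eq_or_eq hcT.2 h' with h' | h'
            exacts [hc0 h', hck h']
          · obtain ⟨d, hd, hd'⟩ := hsep.right
            exact ⟨d, hd, fun h' => hd' h'.2⟩
          · exact hsep.cross x hx.2 hx' y hy fun h' => hy' ⟨hseg hy, h'⟩
        have h1 := hs.defect_eq_one hδ Set.inter_subset_right
          (hsepT.conn2_left (by rwa [hTun])) (by rwa [hcompl]) (by rw [hcompl]; exact hl.add_edge)
        have h2 := hsepT.defect_union (δ := δ) (w := w)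
        have h3 := hsep.defect_union (δ := δ) (w := w)
        have h4 := hdef _ Set.inter_subset_right hp0 hpk
        rw [hTun] at h2
        rw [hun, htot] at h3
        linarith
      -- If `T` meets `S` only in the ends of the ear, the complement of these ends in `S` is
      -- linked. The subdivided edge would then be contractible as well as deletable.
      · exfalso
        have he : T ∩ S = {p 0, p k} := by
          apply Set.Subset.antisymm
          · intro c hcT
            by_contra hcon
            exact hthird ⟨c, hcT, by simpa [not_or] using hcon⟩
          · rintro x (rfl | rfl)
            exacts [hp0, hpk]
        rw [he] at hcompl
        exact hs.contr _ h.first _ h.last hKadj (by rwa [hcompl])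
          (by rw [hcompl]; exact hl.add_edge) hdelK
    · push Not at hin
      have hTS : T ⊆ S := by
        intro z hz
        by_contra hzS
        obtain ⟨m, h1, h2, rfl⟩ := h.compl.le ⟨trivial, hzS⟩
        exact hin m (by omega) (by omega) hz
      by_cases huv : p 0 ∈ T ∧ p k ∈ T
      -- The linked complement contains inner vertices and neither end of the ear, so it stays among
      -- the inner vertices and `T = S`. Losing an edge of weight 1 raised the defect of `S` from 0
      -- to 1.
      · have : Set.univ \ T ⊆ seg p 1 (k - 1) := by
          refine hl.subset_of_closed (x := p 1) ⟨trivial, hin 1 (by omega) (by omega)⟩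
            (mem_seg le_rfl (by omega)) ?_
          rintro y - z ⟨-, hz⟩ hyz ⟨m, h1, h2, rfl⟩
          rcases h.inner_adj (by omega) (by omega) hyz with rfl | rfl
          · refine mem_seg ?_ (by omega)
            by_contra hcon
            exact hz (by rw [show m - 1 = 0 by omega]; exact huv.1)
          · refine mem_seg (by omega) ?_
            by_contra hcon
            exact hz (by rw [show m + 1 = k by omega]; exact huv.2)
        have hTe : T = S := by
          refine Set.Subset.antisymm hTS fun z hz => ?_
          by_contra hzT
          exact h.notMem_of_seg (this ⟨trivial, hzT⟩) hz
        rw [hTe, hdS]; rfl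
      · have hne' : (S \ T).Nonempty := by
          by_contra hcon
          rw [Set.not_nonempty_iff_eq_empty, Set.sdiff_eq_empty] at hcon
          exact huv ⟨hcon h.first, hcon h.last⟩
        have h1 := hs.defect_eq_one hδ hTS hT.add_edge hne' (hsep.linked_left (by rwa [hun]))
        rw [← h1]
        exact (defect_exchange_of_notMem (by tauto) (fun x y => addEdge_adj_iff)
          fun x hx y hy => hww x (hTS hx) y (hTS hy)).symm
  · rcases h.edges x y hxy with ⟨hx, hy⟩ | ⟨i, hi, he⟩
    · have hne' : s(x, y) ≠ s(p 0, p k) := fun he => hnadj (by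
        rwa [← SimpleGraph.mem_edgeSet, ← he, SimpleGraph.mem_edgeSet])
      rw [← hun, hsep.conn2_delEdge hc' hx hy hne' hxy.ne]
      refine hs.contr x hx y hy (addEdge_adj.2 (Or.inl hxy))
        (sdiff_pair_nonempty h.first h.last hsep.ne hne') ?_
      rw [← hsep.linked_sdiff_pair hc' hx hy hne', hun]
      exact hl
    · have := hear i hi
      unfold delEdge at this ⊢
      rwa [he]

/-! #### Glueing -/

/-- In each part `pq` has weight `δ - 1`, but in the union it becomes deletable and has weight 1.
Relative to `{p, q}` each part contributes `-1`, and `δ - 1` parts cancel the defect `δ - 1` of the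
pair itself. -/
theorem spadeOn_of_glueing [Finite V] (hδ : 2 < δ) {ι : Type*} [Fintype ι]
    (hcard : Fintype.card ι = δ - 1) (B : ι → Set V) {p q : V} (hp : ∀ i, p ∈ B i)
    (hq : ∀ i, q ∈ B i) (hinter : ∀ i j x, i ≠ j → x ∈ B i → x ∈ B j → x = p ∨ x = q)
    (hcov : ∀ z, ∃ i, z ∈ B i) (hedge : ∀ x y, G.Adj x y → ∃ i, x ∈ B i ∧ y ∈ B i)
    (hadj : G.Adj p q) (hC : ∀ i, Conn2 G (B i)) (hS : ∀ i, SpadeOn δ G (B i))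
    (hw : ∀ i, canonicalWeight δ G (B i) s(p, q) = δ - 1) :
    Conn2 G Set.univ ∧ SpadeOn δ G Set.univ := by
  classical
  have hK : addEdge G p q = G := addEdge_eq_self hadj
  have hnt : Nontrivial ι := Fintype.one_lt_card_iff_nontrivial.1 (by omega)
  have hthird : ∀ i, ∃ c ∈ B i, c ≠ p ∧ c ≠ q := fun i =>
    exists_ne_ne_of_ncard ((hS i).three_le hδ (hC i)) p q
  let R : ι → Set V := fun i => {z | ∃ j, j ≠ i ∧ z ∈ B j}
  have hsame : ∀ i x y, x ∈ B i → x ≠ p → x ≠ q → G.Adj x y → y ∈ B i := by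
    intro i x y hx hxp hxq hxy
    obtain ⟨j, hxj, hyj⟩ := hedge x y hxy
    by_cases hij : i = j
    · exact hij ▸ hyj
    · rcases hinter i j x hij hx hxj with h | h
      exacts [absurd h hxp, absurd h hxq]
  have hsep : ∀ i, Sep G (B i) (R i) p q := by
    intro i
    obtain ⟨j, hji⟩ := exists_ne i
    refine ⟨?_, hadj.ne, ?_, ?_, fun x hx hx' y hy hy' hxy => hy' (hsame i x y hx ?_ ?_ hxy)⟩
    · ext z
      constructor
      · rintro ⟨h1, l, hl, h2⟩
        exact hinter i l z hl.symm h1 h2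
      · rintro (rfl | rfl)
        exacts [⟨hp i, j, hji, hp j⟩, ⟨hq i, j, hji, hq j⟩]
    · obtain ⟨c, hc, hcp, hcq⟩ := hthird i
      refine ⟨c, hc, ?_⟩
      rintro ⟨l, hl, h2⟩
      rcases hinter i l c hl.symm hc h2 with h | h
      exacts [hcp h, hcq h]
    · obtain ⟨c, hc, hcp, hcq⟩ := hthird j
      refine ⟨c, ⟨j, hji, hc⟩, fun h2 => ?_⟩
      rcases hinter j i c hji hc h2 with h | h
      exacts [hcp h, hcq h]
    · rintro rfl; exact hx' ⟨j, hji, hp j⟩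
    · rintro rfl; exact hx' ⟨j, hji, hq j⟩
  have hun : ∀ i, B i ∪ R i = Set.univ := by
    refine fun i => Set.eq_univ_of_forall fun z => ?_
    obtain ⟨j, hj⟩ := hcov z
    by_cases hji : j = i
    · exact Or.inl (hji ▸ hj)
    · exact Or.inr ⟨j, hji, hj⟩
  have hlink : ∀ (Z : Set V) r, r ∉ Z → (∀ i, r ∈ B i) → (∀ i, Linked G (B i \ Z)) →
      Linked G (Set.univ \ Z) := by
    intro Z r hr hrB hl
    refine linked_of_root r ⟨trivial, hr⟩ fun P hP hPr z hz => ?_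
    obtain ⟨i, hi⟩ := hcov z
    exact hl i P (fun x hx y hy => hP x ⟨trivial, hx.2⟩ y ⟨trivial, hy.2⟩) r ⟨hrB i, hr⟩ z
      ⟨hi, hz.2⟩ hPr
  have hc : Conn2 G Set.univ := by
    refine ⟨⟨p, trivial, q, trivial, hadj.ne⟩, ?_, fun z _ => ?_⟩
    · have := hlink ∅ p (by simp) hp fun i => by rw [Set.sdiff_empty]; exact (hC i).2.1
      rwa [Set.sdiff_empty] at this
    · by_cases hzp : p = z
      · exact hlink _ q (fun h => hadj.ne (hzp.trans h.symm)) hq fun i => (hC i).linked_diff z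
      · exact hlink _ p hzp hp fun i => (hC i).linked_diff z
  have hci : ∀ i, Conn2 G (B i ∪ R i) := fun i => by rwa [hun]
  obtain ⟨i₀, -⟩ := exists_pair_ne ι
  have hdelpq : Conn2 (delEdge G p q) Set.univ := by
    have := (hsep i₀).conn2_del (hci i₀)
    rwa [hun] at this
  set w := canonicalWeight δ G Set.univ with hwdef
  have hww : ∀ i, ∀ x ∈ B i, ∀ y ∈ B i, G.Adj x y → s(x, y) ≠ s(p, q) →
      w s(x, y) = canonicalWeight δ G (B i) s(x, y) := by
    intro i x hx y hy hxy hne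
    have := (hsep i).canonicalWeight_left (δ := δ) (hci i) hx hy hxy.ne hne
    rw [hK, hun] at this
    exact this.symm
  have hpair : defect δ G w {p, q} = δ - 1 := by
    rw [defect_pair hadj.ne hadj, hwdef, canonicalWeight_of_conn2 hdelpq]; push_cast; ring
  have hdef : ∀ i, ∀ T ⊆ B i, p ∈ T → q ∈ T →
      defect δ G w T - defect δ G w {p, q} = defect δ G (canonicalWeight δ G (B i)) T - 1 := by
    intro i T hT hpT hqT
    have := defect_exchange (δ := δ) (G := G) (G' := G) (w := canonicalWeight δ G (B i)) (w' := w)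
      hpT hqT hadj.ne (fun x y _ => Iff.rfl) fun x hx y hy => hww i x (hT hx) y (hT hy)
    rw [this, defect_pair hadj.ne hadj, hw, Nat.cast_sub (by omega)]
    push_cast
    ring
  have hdB : ∀ i, defect δ G w (B i) - defect δ G w {p, q} = -1 := fun i => by
    rw [hdef i _ subset_rfl (hp i) (hq i), (hS i).relaxed.total]; rfl
  have htot : defect δ G w Set.univ = 0 := by
    have h1 := defect_biUnion (δ := δ) (w := w) (G := G) (I := (Finset.univ : Finset ι))
      Finset.univ_nonempty B p q hp hq hinter (by
        intro i j hij x hx y hy hxy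
        by_cases h : x = p ∨ x = q
        · rcases h with rfl | rfl
          exacts [Or.inl (hp j), Or.inl (hq j)]
        · rw [not_or] at h
          exact Or.inr (hsame i x y hx h.1 h.2 hxy))
    have h2 : (⋃ i ∈ (Finset.univ : Finset ι), B i) = Set.univ := by
      refine Set.eq_univ_of_forall fun z => ?_
      simpa using hcov z
    rw [h2, Finset.sum_congr rfl (fun i _ => hdB i), hpair, Finset.sum_const, Finset.card_univ,
      hcard, nsmul_eq_mul, Nat.cast_sub (by omega)] at h1
    push_cast at h1
    linarith
  refine ⟨hc, ⟨fun x _ y _ _ => canonicalWeight_range _, htot, fun T _ hT3 hT hne hl => ?_⟩,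
    fun x _ y _ hxy hne hl => ?_⟩
  · by_cases hpq : p ∈ T ∧ q ∈ T
    · obtain ⟨hpT, hqT⟩ := hpq
      obtain ⟨z, -, hz⟩ := hne
      obtain ⟨i, hi⟩ := hcov z
      -- The complement is linked and avoids `p` and `q`, so it stays in one part; all other parts
      -- lie in `T`.
      have hsub : Set.univ \ T ⊆ B i :=
        hl.subset_of_closed (x := z) ⟨trivial, hz⟩ hi fun x hx y _ hxy hxB =>
          hsame i x y hxB (fun h => hx.2 (h ▸ hpT)) (fun h => hx.2 (h ▸ hqT)) hxy
      have hpT' : p ∈ T ∩ B i := ⟨hpT, hp i⟩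
      have hqT' : q ∈ T ∩ B i := ⟨hqT, hq i⟩
      have hRT : R i ⊆ T := by
        intro x hx
        by_contra hxT
        rcases (hsep i).eq_or_eq (hsub ⟨trivial, hxT⟩) hx with rfl | rfl
        exacts [hxT hpT, hxT hqT]
      have hTun : (T ∩ B i) ∪ R i = T := by
        apply Set.Subset.antisymm
        · exact Set.union_subset Set.inter_subset_left hRT
        · intro x hx
          rcases (hun i).ge (Set.mem_univ x) with h | h
          exacts [Or.inl ⟨hx, h⟩, Or.inr h]
      have hcompl : B i \ (T ∩ B i) = Set.univ \ T := by
        ext x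
        constructor
        · rintro ⟨h1, h2⟩; exact ⟨trivial, fun h3 => h2 ⟨h3, h1⟩⟩
        · rintro ⟨h1, h2⟩; exact ⟨hsub ⟨h1, h2⟩, fun h3 => h2 h3.1⟩
      -- The other parts together have defect 1, so `d(T) = 1` means that `T ∩ B i` has the defect
      -- of `{p, q}`. Either it equals this pair, or it is a flat of the part, where both have
      -- defect 1; reweighting `pq` shifts both equally.
      have h1 : defect δ G w (T ∩ B i) - defect δ G w {p, q} = 0 := by
        by_cases hthird : ∃ c ∈ T ∩ B i, c ≠ p ∧ c ≠ q
        · obtain ⟨c, hcT, hcp, hcq⟩ := hthird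
          have hsepT : Sep G (T ∩ B i) (R i) p q := by
            refine ⟨?_, hadj.ne, ⟨c, hcT, fun h' => ?_⟩, ?_, fun x hx hx' y hy hy' => ?_⟩
            · rw [← (hsep i).inter, Set.inter_assoc, Set.inter_eq_right.2]
              exact fun z hz => hRT hz.2
            · rcases (hsep i).eq_or_eq hcT.2 h' with h' | h'
              exacts [hcp h', hcq h']
            · obtain ⟨d, hd, hd'⟩ := (hsep i).right
              exact ⟨d, hd, fun h' => hd' h'.2⟩
            · exact (hsep i).cross x hx.2 hx' y hy fun h' => hy' ⟨hRT hy, h'⟩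
          have hcT1 := hsepT.conn2_left (by rwa [hTun])
          rw [hK] at hcT1
          rw [hdef i _ Set.inter_subset_right hpT' hqT',
            (hS i).defect_eq_one hδ Set.inter_subset_right hcT1
              (by rw [hcompl]; exact ⟨z, trivial, hz⟩) (by rwa [hcompl]), sub_self]
        · have he : T ∩ B i = {p, q} := by
            apply Set.Subset.antisymm
            · intro c hcT
              by_contra hcon
              exact hthird ⟨c, hcT, by simpa [not_or] using hcon⟩
            · rintro x (rfl | rfl)
              exacts [hpT', hqT']
          rw [he, sub_self]
      have h2 := (hsep i).defect_union (δ := δ) (w := w)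
      have h3 := (hsep i).defect_union_of_subset (δ := δ) (w := w) (T := T ∩ B i)
        Set.inter_subset_right hpT' hqT'
      have h4 := hdB i
      rw [hun, htot] at h2
      rw [hTun] at h3
      linarith
    -- Here `r` is chosen among `p`, `q` so that `T \ {r}` avoids both. This linked set lies in a
    -- single part, and then so does `T`, because `r` belongs to every part.
    · have hr : ∃ r, (∀ i, r ∈ B i) ∧ ∀ z ∈ T \ {r}, z ≠ p ∧ z ≠ q := by
        by_cases hpT : p ∈ T
        · refine ⟨p, hp, fun z hz => ⟨hz.2, ?_⟩⟩
          rintro rfl; exact hpq ⟨hpT, hz.1⟩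
        · refine ⟨q, hq, fun z hz => ⟨?_, hz.2⟩⟩
          rintro rfl; exact hpT hz.1
      obtain ⟨r, hrB, hr⟩ := hr
      obtain ⟨z, hzT, hzr⟩ := hT.1.exists_ne r
      obtain ⟨i, hi⟩ := hcov z
      have hTB : T ⊆ B i := by
        have := (hT.linked_diff r).subset_of_closed (x := z) (B := B i) ⟨hzT, hzr⟩ hi
          fun x hx y _ hxy hxB => hsame i x y hxB (hr x hx).1 (hr x hx).2 hxy
        intro x hx
        by_cases hxr : x = r
        · exact hxr ▸ hrB i
        · exact this ⟨hx, hxr⟩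
      have hne' : (B i \ T).Nonempty := by
        by_contra hcon
        rw [Set.not_nonempty_iff_eq_empty, Set.sdiff_eq_empty] at hcon
        exact hpq ⟨hcon (hp i), hcon (hq i)⟩
      have hl' := (hsep i).linked_left (Z := T) (by rwa [hun])
      rw [hK] at hl'
      rw [← (hS i).defect_eq_one hδ hTB hT hne' hl']
      exact defect_exchange_of_notMem (u := p) (v := q) (by tauto) (fun x y _ => Iff.rfl)
        fun x hx y hy => hww i x (hTB hx) y (hTB hy)
  · obtain ⟨i, hx, hy⟩ := hedge x y hxy
    by_cases he : s(x, y) = s(p, q)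
    · have e : ({x, y} : Set V) = {p, q} := by
        rw [Sym2.eq_iff] at he
        rcases he with ⟨rfl, rfl⟩ | ⟨rfl, rfl⟩
        exacts [rfl, Set.pair_comm _ _]
      rw [e] at hl
      have := (hsep i).not_linked
      rw [hun] at this
      exact absurd hl this
    · have h1 := (hsep i).conn2_delEdge (hci i) hx hy he hxy.ne
      have h2 := (hsep i).linked_sdiff_pair (hci i) hx hy he
      rw [hun, hK] at h1 h2
      rw [h1]
      exact (hS i).contr x hx y hy hxy
        (sdiff_pair_nonempty (hp i) (hq i) hadj.ne he) (h2.1 hl)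

end Construction

/-! ### The abstract constructions and the class of obtainable graphs -/

theorem IsWeight.canonicalWeight_eq {V : Type u} [Finite V] {δ : ℕ} {G : SimpleGraph V}
    {w : Sym2 V → ℕ} {x y : V} (hδ : 2 < δ) (hw : IsWeight δ G w) (hc : Conn2 G Set.univ)
    (hs : SpadeOn δ G Set.univ) (hxy : G.Adj x y) :
    canonicalWeight δ G Set.univ s(x, y) = w s(x, y) :=
  (hw.eq_canonicalWeight hc (hs.three_le hδ hc) hxy).symm

theorem spadeOn_of_isGlueing {V : Type u} {δ : ℕ} (hδ : 2 < δ) {G : SimpleGraph V}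
    {W : Fin (δ - 1) → Type u} {H : ∀ i, SimpleGraph (W i)} {a b : ∀ i, W i}
    (hH : ∀ i, Finite (W i) ∧ Conn2 (H i) Set.univ ∧ SpadeOn δ (H i) Set.univ)
    (hab : ∀ i, (H i).Adj (a i) (b i))
    (hw : ∀ i, canonicalWeight δ (H i) Set.univ s(a i, b i) = δ - 1) (hG : IsGlueing H a b G) :
    Finite V ∧ Conn2 G Set.univ ∧ SpadeOn δ G Set.univ := by
  obtain ⟨p, q, f, hf, hp, hq, hinter, hcov, hadj⟩ := hG
  have hfinW := fun i => (hH i).1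
  have hfin : Finite V := by
    refine Finite.of_surjective (fun t : Σ i, W i => f t.1 t.2) fun z => ?_
    obtain ⟨i, x, rfl⟩ := hcov z
    exact ⟨⟨i, x⟩, rfl⟩
  have hends : ∀ i x, f i x = p ∨ f i x = q → x = a i ∨ x = b i := by
    rintro i x (h | h)
    · exact Or.inl (hf i (h.trans (hp i).symm))
    · exact Or.inr (hf i (h.trans (hq i).symm))
  let F : ∀ i, H i ↪g G := fun i => ⟨⟨f i, hf i⟩, by
    intro x y
    change G.Adj (f i x) (f i y) ↔ _
    rw [hadj]
    constructor
    · rintro ⟨j, x', y', h, hx, hy⟩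
      by_cases hij : i = j
      · subst hij
        rwa [← hf i hx, ← hf i hy]
      -- Vertices shared by two different parts are ends of the glued edge. An edge of another part
      -- between them is therefore the common edge, which every part contains.
      · have hne : x ≠ y := by
          rintro rfl
          exact h.ne (hf j (hx.trans hy.symm))
        have h1 := hends i x (hinter i j x x' hij hx.symm)
        have h2 := hends i y (hinter i j y y' hij hy.symm)
        rcases h1 with rfl | rfl <;> rcases h2 with rfl | rfl
        exacts [absurd rfl hne, hab i, (hab i).symm, absurd rfl hne]
    · exact fun h => ⟨i, x, y, h, rfl, rfl⟩⟩
  have hi₀ : 0 < δ - 1 := by omega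
  refine ⟨hfin, spadeOn_of_glueing hδ (Fintype.card_fin _) (fun i => F i '' Set.univ)
    (p := p) (q := q) (fun i => ⟨a i, trivial, hp i⟩) (fun i => ⟨b i, trivial, hq i⟩) ?_ ?_ ?_ ?_
    (fun i => (conn2_image (F i)).2 (hH i).2.1) (fun i => (spadeOn_image (F i)).2 (hH i).2.2) ?_⟩
  · rintro i j z hij ⟨x, -, rfl⟩ ⟨y, -, hy⟩
    exact hinter i j x y hij hy.symm
  · intro z
    obtain ⟨i, x, rfl⟩ := hcov z
    exact ⟨i, x, trivial, rfl⟩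
  · intro x y hxy
    obtain ⟨i, x', y', -, rfl, rfl⟩ := (hadj x y).1 hxy
    exact ⟨i, ⟨x', trivial, rfl⟩, ⟨y', trivial, rfl⟩⟩
  · exact (hadj p q).2 ⟨⟨0, hi₀⟩, _, _, hab _, hp _, hq _⟩
  · intro i
    rw [← hw i, ← canonicalWeight_image (F i)]
    congr 2
    · exact (hp i).symm
    · exact (hq i).symm

theorem spadeOn_of_isSubdivision {V W : Type u} {δ : ℕ} (hδ : 2 < δ) {G : SimpleGraph V}
    {H : SimpleGraph W} {a b : W} [Finite W] (hc : Conn2 H Set.univ) (hs : SpadeOn δ H Set.univ)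
    (hab : H.Adj a b) (hw : canonicalWeight δ H Set.univ s(a, b) = 1)
    (hG : IsSubdivision (δ - 1) H a b G) :
    Finite V ∧ Conn2 G Set.univ ∧ SpadeOn δ G Set.univ := by
  obtain ⟨k, hk⟩ : ∃ k, k = δ - 1 := ⟨_, rfl⟩
  rw [← hk] at hG
  obtain ⟨f, P, hf, hP, hP0, hPk, hinner, hcov, hadj⟩ := hG
  have hfin : Finite V := by
    refine Finite.of_surjective (Sum.elim f P) fun z => ?_
    rcases hcov z with ⟨x, rfl⟩ | ⟨i, rfl⟩
    exacts [⟨Sum.inl x, rfl⟩, ⟨Sum.inr i, rfl⟩]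
  -- Indices are reduced modulo `k + 1`; only those up to `k` are used.
  let p : ℕ → V := fun i => P (Fin.ofNat (k + 1) i)
  have hp : ∀ i (hi : i < k + 1), p i = P ⟨i, hi⟩ := fun i hi =>
    congrArg P (Fin.ext (Nat.mod_eq_of_lt hi))
  have hp0 : p 0 = f a := (hp 0 (by omega)).trans hP0
  have hpk : p k = f b := (hp k (by omega)).trans hPk
  have hedge : ∀ i : Fin k, s(P i.castSucc, P i.succ) = s(p i, p (i + 1)) := fun i => by
    rw [hp i (by omega), hp (i + 1) (by omega)]; rfl
  have hpinner : ∀ i, 0 < i → i < k → p i ∉ f '' Set.univ := by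
    rintro i h0 hi ⟨x, -, hx⟩
    rw [hp i (by omega)] at hx
    rcases hinner x _ hx with h | h
    · exact h0.ne' (congrArg Fin.val h)
    · exact hi.ne (congrArg Fin.val h)
  have hpadj : ∀ i < k, G.Adj (p i) (p (i + 1)) := fun i hi =>
    (hadj _ _).2 (Or.inr ⟨⟨i, hi⟩, (hedge ⟨i, hi⟩).symm⟩)
  have hear : IsFullEar G (f '' Set.univ) k p := by
    refine ⟨⟨fun i hi j hj hij => ?_, by omega, ⟨a, trivial, hp0.symm⟩, ⟨b, trivial, hpk.symm⟩,
      hpinner, hpadj⟩, fun z => ?_, fun x y hxy => ?_⟩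
    · rw [hp i (by omega), hp j (by omega)] at hij
      exact congrArg Fin.val (hP hij)
    · rcases hcov z with ⟨x, rfl⟩ | ⟨i, rfl⟩
      · exact Or.inl ⟨x, trivial, rfl⟩
      · exact Or.inr ⟨i, by omega, hp i i.2⟩
    · rcases (hadj x y).1 hxy with ⟨x', y', -, -, rfl, rfl⟩ | ⟨i, he⟩
      · exact Or.inl ⟨⟨x', trivial, rfl⟩, ⟨y', trivial, rfl⟩⟩
      · exact Or.inr ⟨i, i.2, he.trans (hedge i)⟩
  have hGf : ∀ x y, G.Adj (f x) (f y) ↔ H.Adj x y ∧ s(x, y) ≠ s(a, b) := by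
    intro x y
    rw [hadj]
    constructor
    · rintro (⟨x', y', h, hne, hx, hy⟩ | ⟨i, he⟩)
      · obtain rfl := hf hx
        obtain rfl := hf hy
        exact ⟨h, hne⟩
      · rw [hedge] at he
        have hmem : p i ∈ f '' Set.univ ∧ p (i + 1) ∈ f '' Set.univ := by
          rw [Sym2.eq_iff] at he
          rcases he with ⟨h1, h2⟩ | ⟨h1, h2⟩
          exacts [⟨⟨x, trivial, h1⟩, ⟨y, trivial, h2⟩⟩, ⟨⟨y, trivial, h2⟩, ⟨x, trivial, h1⟩⟩]
        have := hear.edge_notMem i.2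
        tauto
    · rintro ⟨h, hne⟩
      exact Or.inl ⟨x, y, h, hne, rfl, rfl⟩
  have hnadj : ¬G.Adj (p 0) (p k) := by
    rw [hp0, hpk, hGf]
    exact fun h => h.2 rfl
  let F : H ↪g addEdge G (p 0) (p k) := ⟨⟨f, hf⟩, by
    intro x y
    change (addEdge G (p 0) (p k)).Adj (f x) (f y) ↔ _
    rw [addEdge_adj, hGf, hp0, hpk, hf.ne_iff, ← Sym2.map_mk, ← Sym2.map_mk,
      (Sym2.map.injective hf).eq_iff]
    constructor
    · rintro (h | ⟨h, -⟩)
      · exact h.1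
      · rwa [← SimpleGraph.mem_edgeSet, h, SimpleGraph.mem_edgeSet]
    · intro h
      by_cases he : s(x, y) = s(a, b)
      · exact Or.inr ⟨he, h.ne⟩
      · exact Or.inl ⟨h, he⟩⟩
  refine ⟨hfin, spadeOn_of_ear hδ hear hk hnadj ((conn2_image F).2 hc) ((spadeOn_image F).2 hs) ?_⟩
  rw [← hw, ← canonicalWeight_image F]
  exact congrArg (canonicalWeight δ _ (f '' Set.univ))
    (show s(p 0, p k) = s(f a, f b) by rw [hp0, hpk])

/-- Finiteness and 2-connectedness are not part of the definition of the class but are needed in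
every step, so they are carried along in the induction. Uniqueness identifies the weight functions
given with the parts with the canonical ones. -/
theorem Obtainable.spadeOn {V : Type u} {δ : ℕ} (hδ : 2 < δ) {G : SimpleGraph V}
    (h : Obtainable δ G) : Finite V ∧ Conn2 G Set.univ ∧ SpadeOn δ G Set.univ := by
  induction h with
  | cycle G h => exact spadeOn_of_cycle hδ h
  | glue G W H w a b hH hw hab hwab hG ih =>
    refine spadeOn_of_isGlueing hδ ih hab (fun i => ?_) hG
    have := (ih i).1
    rw [(hw i).canonicalWeight_eq hδ (ih i).2.1 (ih i).2.2 (hab i), hwab i]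
  | subdivide G H w a b hH hw hab hwab hG ih =>
    obtain ⟨hfin, hc, hs⟩ := ih
    exact spadeOn_of_isSubdivision hδ hc hs hab
      (by rw [hw.canonicalWeight_eq hδ hc hs hab, hwab]) hG

end GraphicGorenstein

theorem mainTheorem4 {V : Type u} [Finite V] (G : SimpleGraph V)
    (hG : GraphicGorenstein.TwoConnected G) (δ : ℕ) (hδ : 2 < δ) :
    GraphicGorenstein.Spade δ G ↔ GraphicGorenstein.Obtainable δ G := by
  have hc := GraphicGorenstein.twoConnected_iff.1 hG
  exact (GraphicGorenstein.spade_iff hδ hc).trans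
    ⟨GraphicGorenstein.obtainable_of_spadeOn hδ hc, fun h => (h.spadeOn hδ).2.2⟩
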